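/- **Theorem (Random product states for optimizing a $k$-local Hamiltonian).** Let $n,k\ge 1$ and let $H=\sum_{P\in\{I,X,Y,Z\}^{\otimes n}}\alpha_P P$ with real coefficients $\alpha_P$ be an $n$-qubit $k$-local Hamiltonian, i.e. $\alpha_P=0$ unless $|P|\le k$, where $\mathsf{dom}(P)$ is the set of qubits on which $P$ acts nontrivially and $|P|=|\mathsf{dom}(P)|$. Let $\mathsf{nnz}(H)=|\{P:\alpha_P\ne 0\}|$. For an integer $1\le d_e\le n$ and real $c_e$, say that $H$ has expansion coefficient $c_e$ and expansion dimension $d_e$ if for every $\Upsilon\subseteq\{1,\dots,n\}$ with $|\Upsilon|=d_e$, $$\big|\{P:\alpha_P\neq 0\text{ and }(\Upsilon\subseteq\mathsf{dom}(P)\text{ or }\mathsf{dom}(P)\subseteq\Upsilon)\}\big|\le c_e .$$ Put $r=2d_e/(d_e+1)\in[1,2)$ and $$C(c_e,d_e,k)=\frac{\sqrt{2\,(k!)}}{c_e^{1/(2d_e)}\;k^{\,k+3/2+1/r}\;(\sqrt6+2\sqrt3)^k}.$$ There is a randomized algorithm (one program of a unit-cost random-access machine over the reals, with arithmetic, square roots,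 comparisons and uniform samples from $[0,1]$) which, given $n$, $k$ and the list of the nonzero Pauli coefficients of $H$, always halts after $\mathcal O(nk+\mathsf{nnz}(H)2^k)$ operations, with an absolute implied constant, and outputs a random pure product state $|\psi\rangle=|\psi_1\rangle\otimes\cdots\otimes|\psi_n\rangle$ such that, whenever $H$ has expansion coefficient $c_e$ and expansion dimension $d_e$, either $$\mathbb E_{|\psi\rangle}\langle\psi|H|\psi\rangle\ \ge\ \mathbb E_{|\phi\rangle:\mathrm{Haar}}\langle\phi|H|\phi\rangle+C(c_e,d_e,k)\Big(\sum_{P\ne I}|\alpha_P|^r\Big)^{1/r}$$ or $$\mathbb E_{|\psi\rangle}\langle\psi|H|\psi\rangle\ \le\ \mathbb E_{|\phi\rangle:\mathrm{Haar}}\langle\phi|H|\phi\rangle-C(c_e,d_e,k)\Big(\sum_{P\ne I}|\alpha_P|^r\Big)^{1/r}.$$ Here the average over Haar-random pure $n$-qubit states is $\mathbb E_{|\phi\rangle:\mathrm{Haar}}\langle\phi|H|\phi\rangle=\alpha_I$. Moreover $C(c_e,d_e,k)=\Theta_k\big(c_e^{-1/(2d_e)}\big)$: for each $k\ge1$ there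 are constants $0<A_k\le B_k$ with $A_k c_e^{-1/(2d_e)}\le C(c_e,d_e,k)\le B_k c_e^{-1/(2d_e)}$ for all real $c_e>0$ and integers $d_e\ge1$. -/

import Mathlib

open MeasureTheory

noncomputable section

/-! ### Pauli strings and Hamiltonians -/

/-- An `n`-qubit Pauli string; the labels `0, 1, 2, 3` stand for `I, X, Y, Z`. -/
abbrev PauliString (n : ℕ) : Type := Fin n → Fin 4

/-- The identity string `I ⊗ ⋯ ⊗ I`. -/
def identityString (n : ℕ) : PauliString n := fun _ => 0

/-- The matrices `I, X, Y, Z`. -/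
def pauliMatrix : Fin 4 → Matrix (Fin 2) (Fin 2) ℂ :=
  ![1, !![0, 1; 1, 0], !![0, -Complex.I; Complex.I, 0], !![1, 0; 0, -1]]

/-- The tensor product of the Pauli matrices of a string, in the computational basis
`Fin n → Fin 2` of `(ℂ²)^{⊗ n}`. -/
def PauliString.toMatrix {n : ℕ} (P : PauliString n) :
    Matrix (Fin n → Fin 2) (Fin n → Fin 2) ℂ :=
  Matrix.of fun x y => ∏ i, pauliMatrix (P i) (x i) (y i)

/-- The set of qubits on which `P` acts nontrivially. -/
def PauliString.dom {n : ℕ} (P : PauliString n) : Finset (Fin n) :=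
  Finset.univ.filter fun i => P i ≠ 0

/-- The number of non-identity components of `P`. -/
def PauliString.weight {n : ℕ} (P : PauliString n) : ℕ := P.dom.card

/-- The Hamiltonian `H = ∑_P α_P P` with real Pauli coefficients `α`. -/
def hamiltonian {n : ℕ} (α : PauliString n → ℝ) : Matrix (Fin n → Fin 2) (Fin n → Fin 2) ℂ :=
  ∑ P, (α P : ℂ) • P.toMatrix

/-- `H` is `k`-local: only strings of weight at most `k` occur. -/
def IsLocalHamiltonian {n : ℕ} (k : ℕ) (α : PauliString n → ℝ) : Prop :=
  ∀ P, α P ≠ 0 → P.weight ≤ k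

/-- The number of nonzero Pauli coefficients. -/
def nnz {n : ℕ} (α : PauliString n → ℝ) : ℕ := {P | α P ≠ 0}.ncard

/-- `H` has expansion coefficient `c` and expansion dimension `d`. -/
def HasExpansion {n : ℕ} (α : PauliString n → ℝ) (c : ℝ) (d : ℕ) : Prop :=
  ∀ Υ : Finset (Fin n), Υ.card = d →
    ({P : PauliString n | α P ≠ 0 ∧ (Υ ⊆ P.dom ∨ P.dom ⊆ Υ)}.ncard : ℝ) ≤ c

/-! ### States and energies -/

/-- The energy `⟨ψ|H|ψ⟩` (a real number, `H` being Hermitian). -/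
def energy {n : ℕ} (α : PauliString n → ℝ) (ψ : (Fin n → Fin 2) → ℂ) : ℝ :=
  (star ψ ⬝ᵥ (hamiltonian α).mulVec ψ).re

/-- The product vector `|ψ₁⟩ ⊗ ⋯ ⊗ |ψₙ⟩`. -/
def productVector {n : ℕ} (ψ : Fin n → Fin 2 → ℂ) : (Fin n → Fin 2) → ℂ :=
  fun x => ∏ i, ψ i (x i)

/-- The average of `⟨φ|H|φ⟩` over Haar-random pure `n`-qubit states, that is, over the normalized
surface measure of the unit sphere of `(ℂ²)^{⊗ n}`. -/
def haarEnergy {n : ℕ} (α : PauliString n → ℝ) : ℝ :=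
  ⨍ φ : Metric.sphere (0 : EuclideanSpace ℂ (Fin n → Fin 2)) 1, energy α (fun x => φ.1 x)
    ∂((volume : Measure (EuclideanSpace ℂ (Fin n → Fin 2))).toSphere)

/-- The exponent `r = 2 d / (d + 1)`. -/
def expansionExponent (d : ℕ) : ℝ := 2 * d / (d + 1)

/-- The `ℓ_r` norm of the non-identity Pauli coefficients. -/
def nonIdentityNorm {n : ℕ} (α : PauliString n → ℝ) (r : ℝ) : ℝ :=
  (∑ P ∈ Finset.univ.erase (identityString n), |α P| ^ r) ^ (1 / r)

/-- The constant `C(c, d, k)`. -/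
def advantageConstant (c : ℝ) (d k : ℕ) : ℝ :=
  √(2 * (k.factorial : ℝ)) /
    (c ^ (1 / (2 * (d : ℝ))) * (k : ℝ) ^ ((k : ℝ) + 3 / 2 + 1 / expansionExponent d) *
      (√6 + 2 * √3) ^ k)

/-! ### A randomized random-access machine over the reals

The machine has a memory of natural numbers and a memory of real numbers. Each consists of arrays
with two indices, so a cell is addressed by the array's name and a row and a column. A program
mentions finitely many array names, as literals; rows and columns are computed. The unit-cost
operations are: access to a cell; addition, truncated subtraction and comparison of naturals;
`+`, `-`, `*`, `/`, square root and comparison of reals; conversion of a natural to a real; and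
drawing a uniform sample from `[0, 1]`. -/

/-- A configuration: the two memories, and the samples from `[0, 1]` that are still to be drawn. -/
structure MachineState where
  nat : ℕ → ℕ → ℕ → ℕ
  real : ℕ → ℕ → ℕ → ℝ
  tape : ℕ → unitInterval

inductive NatExpr : Type where
  | lit (c : ℕ) : NatExpr
  | read (a : ℕ) (i j : NatExpr) : NatExpr
  | add (e f : NatExpr) : NatExpr
  | sub (e f : NatExpr) : NatExpr

def NatExpr.eval (s : MachineState) : NatExpr → ℕ
  | .lit c => c
  | .read a i j => s.nat a (i.eval s) (j.eval s)
  | .add e f => e.eval s + f.eval s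
  | .sub e f => e.eval s - f.eval s

/-- The number of unit-cost operations in the evaluation of an expression. -/
def NatExpr.cost : NatExpr → ℕ
  | .lit _ => 1
  | .read _ i j => i.cost + j.cost + 1
  | .add e f => e.cost + f.cost + 1
  | .sub e f => e.cost + f.cost + 1

inductive RealExpr : Type where
  | ofNat (e : NatExpr) : RealExpr
  | read (a : ℕ) (i j : NatExpr) : RealExpr
  | add (e f : RealExpr) : RealExpr
  | sub (e f : RealExpr) : RealExpr
  | mul (e f : RealExpr) : RealExpr
  | div (e f : RealExpr) : RealExpr
  | sqrt (e : RealExpr) : RealExpr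

def RealExpr.eval (s : MachineState) : RealExpr → ℝ
  | .ofNat e => (e.eval s : ℝ)
  | .read a i j => s.real a (i.eval s) (j.eval s)
  | .add e f => e.eval s + f.eval s
  | .sub e f => e.eval s - f.eval s
  | .mul e f => e.eval s * f.eval s
  | .div e f => e.eval s / f.eval s
  | .sqrt e => √(e.eval s)

def RealExpr.cost : RealExpr → ℕ
  | .ofNat e => e.cost + 1
  | .read _ i j => i.cost + j.cost + 1
  | .add e f => e.cost + f.cost + 1
  | .sub e f => e.cost + f.cost + 1
  | .mul e f => e.cost + f.cost + 1
  | .div e f => e.cost + f.cost + 1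
  | .sqrt e => e.cost + 1

inductive Test : Type where
  | natLe (e f : NatExpr) : Test
  | realLe (e f : RealExpr) : Test
  | not (b : Test) : Test
  | and (b c : Test) : Test

def Test.Holds (s : MachineState) : Test → Prop
  | .natLe e f => e.eval s ≤ f.eval s
  | .realLe e f => e.eval s ≤ f.eval s
  | .not b => ¬ b.Holds s
  | .and b c => b.Holds s ∧ c.Holds s

def Test.cost : Test → ℕ
  | .natLe e f => e.cost + f.cost + 1
  | .realLe e f => e.cost + f.cost + 1
  | .not b => b.cost + 1
  | .and b c => b.cost + c.cost + 1

inductive Program : Type where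
  | skip : Program
  | setNat (a : ℕ) (i j e : NatExpr) : Program
  | setReal (a : ℕ) (i j : NatExpr) (e : RealExpr) : Program
  | sample (a : ℕ) (i j : NatExpr) : Program
  | seq (p q : Program) : Program
  | branch (b : Test) (p q : Program) : Program
  | loop (b : Test) (p : Program) : Program

def MachineState.writeNat (s : MachineState) (a i j v : ℕ) : MachineState :=
  { s with nat := fun a' i' j' => if a' = a ∧ i' = i ∧ j' = j then v else s.nat a' i' j' }

def MachineState.writeReal (s : MachineState) (a i j : ℕ) (v : ℝ) : MachineState :=
  { s with real := fun a' i' j' => if a' = a ∧ i' = i ∧ j' = j then v else s.real a' i' j' }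

/-- Draw the next sample and store it in a cell of the real memory. -/
def MachineState.draw (s : MachineState) (a i j : ℕ) : MachineState :=
  { s.writeReal a i j (s.tape 0 : ℝ) with tape := fun m => s.tape (m + 1) }

/-- `Runs p s t s'`: started in `s`, the program `p` halts in `s'` after `t` unit-cost operations. -/
inductive Runs : Program → MachineState → ℕ → MachineState → Prop where
  | skip (s : MachineState) : Runs .skip s 1 s
  | setNat (s : MachineState) (a : ℕ) (i j e : NatExpr) :
      Runs (.setNat a i j e) s (i.cost + j.cost + e.cost + 1)
        (s.writeNat a (i.eval s) (j.eval s) (e.eval s))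
  | setReal (s : MachineState) (a : ℕ) (i j : NatExpr) (e : RealExpr) :
      Runs (.setReal a i j e) s (i.cost + j.cost + e.cost + 1)
        (s.writeReal a (i.eval s) (j.eval s) (e.eval s))
  | sample (s : MachineState) (a : ℕ) (i j : NatExpr) :
      Runs (.sample a i j) s (i.cost + j.cost + 1) (s.draw a (i.eval s) (j.eval s))
  | seq {p q : Program} {s s' s'' : MachineState} {t t' : ℕ} :
      Runs p s t s' → Runs q s' t' s'' → Runs (.seq p q) s (t + t') s''
  | branchTrue {b : Test} {p q : Program} {s s' : MachineState} {t : ℕ} :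
      b.Holds s → Runs p s t s' → Runs (.branch b p q) s (b.cost + 1 + t) s'
  | branchFalse {b : Test} {p q : Program} {s s' : MachineState} {t : ℕ} :
      ¬ b.Holds s → Runs q s t s' → Runs (.branch b p q) s (b.cost + 1 + t) s'
  | loopDone {b : Test} {p : Program} {s : MachineState} :
      ¬ b.Holds s → Runs (.loop b p) s (b.cost + 1) s
  | loopStep {b : Test} {p : Program} {s s' s'' : MachineState} {t t' : ℕ} :
      b.Holds s → Runs p s t s' → Runs (.loop b p) s' t' s'' →
        Runs (.loop b p) s (b.cost + 1 + t + t') s''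

/-- A program has at most one run from a given configuration (which includes the samples). -/
theorem Runs.deterministic {p : Program} {s s₁ s₂ : MachineState} {t₁ t₂ : ℕ}
    (h₁ : Runs p s t₁ s₁) (h₂ : Runs p s t₂ s₂) : t₁ = t₂ ∧ s₁ = s₂ := by
  induction h₁ generalizing t₂ s₂ with
  | skip => cases h₂; exact ⟨rfl, rfl⟩
  | setNat => cases h₂; exact ⟨rfl, rfl⟩
  | setReal => cases h₂; exact ⟨rfl, rfl⟩
  | sample => cases h₂; exact ⟨rfl, rfl⟩
  | seq _ _ ih ih' =>
    cases h₂ with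
    | seq k k' =>
      obtain ⟨rfl, rfl⟩ := ih k
      obtain ⟨rfl, rfl⟩ := ih' k'
      exact ⟨rfl, rfl⟩
  | branchTrue hb _ ih =>
    cases h₂ with
    | branchTrue _ k =>
      obtain ⟨rfl, rfl⟩ := ih k
      exact ⟨rfl, rfl⟩
    | branchFalse hb' _ => exact absurd hb hb'
  | branchFalse hb _ ih =>
    cases h₂ with
    | branchTrue hb' _ => exact absurd hb' hb
    | branchFalse _ k =>
      obtain ⟨rfl, rfl⟩ := ih k
      exact ⟨rfl, rfl⟩
  | loopDone hb =>
    cases h₂ with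
    | loopDone _ => exact ⟨rfl, rfl⟩
    | loopStep hb' _ _ => exact absurd hb' hb
  | loopStep hb _ _ ih ih' =>
    cases h₂ with
    | loopDone hb' => exact absurd hb hb'
    | loopStep _ k k' =>
      obtain ⟨rfl, rfl⟩ := ih k
      obtain ⟨rfl, rfl⟩ := ih' k'
      exact ⟨rfl, rfl⟩

/-! ### Input and output of the machine -/

/-- `L` lists the Pauli strings with nonzero coefficient, each once, in some order. -/
def ListsTerms {n : ℕ} (α : PauliString n → ℝ) (L : List (PauliString n)) : Prop :=
  L.Nodup ∧ ∀ P, P ∈ L ↔ α P ≠ 0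

/-- The natural-number part of the sparse description of `H`. Array `0` holds `n`, `k` and the
number of terms in rows `0, 1, 2` of column `0`. For the `i`-th term `P`, cell `(i, 0)` of array `1`
holds the weight of `P`, and row `i` of arrays `2` and `3` holds the qubits of `dom P` in increasing
order and the labels `1, 2, 3` of `P` there. All other cells are zero. -/
def inputNat {n : ℕ} (k : ℕ) (L : List (PauliString n)) (a i j : ℕ) : ℕ :=
  match a with
  | 0 => if j = 0 then [n, k, L.length].getD i 0 else 0
  | 1 => if j = 0 then (L[i]?.map fun P => P.weight).getD 0 else 0
  | 2 => (L[i]?.bind fun P => P.dom.sort[j]?.map fun q => q.val).getD 0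
  | 3 => (L[i]?.bind fun P => P.dom.sort[j]?.map fun q => (P q).val).getD 0
  | _ => 0

/-- The real part of the description: cell `(i, 0)` of array `0` holds the coefficient of the `i`-th
term. All other cells are zero. -/
def inputReal {n : ℕ} (α : PauliString n → ℝ) (L : List (PauliString n)) (a i j : ℕ) : ℝ :=
  if a = 0 ∧ j = 0 then (L[i]?.map α).getD 0 else 0

/-- The initial configuration on input `n, k, H`, with random samples `ω`. -/
def inputState {n : ℕ} (k : ℕ) (α : PauliString n → ℝ) (L : List (PauliString n))
    (ω : ℕ → unitInterval) : MachineState where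
  nat := inputNat k L
  real := inputReal α L
  tape := ω

/-- The one-qubit vectors that a halting configuration describes: row `q` of array `1` of the real
memory holds `Re ψ_q(0), Im ψ_q(0), Re ψ_q(1), Im ψ_q(1)`. -/
def outputVectors (n : ℕ) (s : MachineState) : Fin n → Fin 2 → ℂ :=
  fun q b => ⟨s.real 1 q (2 * b), s.real 1 q (2 * b + 1)⟩

/-- The law of the samples: independent and uniform on `[0, 1]`. -/
def tapeMeasure : Measure (ℕ → unitInterval) :=
  Measure.infinitePi fun _ => (volume : Measure unitInterval)

end

/-!
The Haar average of a Pauli string other than the identity vanishes, because a Pauli matrix on one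
qubit maps the string to its negative (`haarEnergy_eq`). So the task is to find a random product
state whose mean energy deviates from the coefficient of the identity.

Give every qubit the Bloch vector `(± 1, ± 1, ± 1) / √3`. If the signs are independent and have means
`X w`, where `w` runs over the pairs of a qubit and an axis, the mean energy is a polynomial in `X`
that is affine in each variable: a term `P` contributes `α_P (1 / √3) ^ |P| ∏ X w`
(`integral_energy_roundSign`). The means are of the form `X = (y + t σ) / 2` with sign vectors `y`
and `σ` and `|t| ≤ 1`, so in terms of the coefficients `g_P = α_P / √12 ^ |P|` the polynomial `f` has to
be large in absolute value at `y + t σ`. The parameters are found without randomness.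

* The point `y`. For independent random signs the derivative `∂_v f` has second moment `b_v ^ 2`, the
  sum of the `g_P ^ 2` with `v` in `P`, and hypercontractivity bounds its first absolute moment from
  below by a multiple of `b_v`. An explicit potential, built from the squared norm of `∂_v f` and from
  a norm with weight `3 ^ e` in degree `e`, certifies such a bound and does not decrease if the
  signs `y w` are chosen one after the other by the method of conditional expectations
  (`IsTrie.potential_le`); at the end it gives `∑_v b_v ≤ 3 ^ (k - 1) ∑_v |∂_v f (y)|`
  (`IsTrie.sum_abs_ge`). To update the potential cheaply, the derivatives are stored in a trie with
  one tree for each `v`. It has at most `k ^ 2` nodes for each term besides the roots, and every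
  node is visited a bounded number of times.
* The direction `σ` consists of the signs of `∂_v f (y)`. Then `f (y + t σ)` is a polynomial of degree
  at most `k` in `t` with linear coefficient `∑_v |∂_v f (y)|`, so by Richardson extrapolation it is
  large at one of the points `± 2 ^ (-i)` with `i < k` (`exists_scaleNode_multilinear`).

Together, the advantage is at least `3√3 / 18 ^ k` times the sum over the qubits `q` of the local
norms, the `ℓ²` norms of the coefficients of the terms that act on `q` (`mainProgram_spec`). The
expansion property enters only in the analysis: by Hölder's inequality, it bounds the `ℓ_r` norm of
the coefficients by `c ^ (1 / (2 d))` times the sum of the local norms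
(`HasExpansion.nonIdentityNorm_le`), and `3√3 / 18 ^ k` exceeds the rest of the constant
(`advantageConstant_mul_le`).

The running time is `O(n + k + m k ^ 2)` for `m` terms. The programs are verified by total-correctness
triples with time bounds (`Reaches`). They use the following arrays besides those of the input, for
variables `v`, `w`, nodes `x` and terms `i`. Natural numbers: `4` registers, `5` children, `6` parents,
`7` roots of the nodes, `8` and `9` the lists of the nodes with a given symbol and their lengths. Reals:
`2` scalars, `3` the coefficients `g_i`, `4` the coefficients on the nodes `x`, `5` the weights of
the nodes, `6` and `7` the squared norms of the derivatives, `8` auxiliary sums, `9` the signs `y w`, `10`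
the signs `σ w`, `11` the random signs.
-/

noncomputable section

/-! ### Haar averages of Pauli strings -/

/-- The expectation value `⟨φ|P|φ⟩` of a Pauli string. -/
def PauliString.expectation {n : ℕ} (P : PauliString n) (φ : (Fin n → Fin 2) → ℂ) : ℂ :=
  ∑ x, ∑ y, star (φ x) * P.toMatrix x y * φ y

theorem energy_eq_sum_expectation {n : ℕ} (α : PauliString n → ℝ) (φ : (Fin n → Fin 2) → ℂ) :
    energy α φ = ∑ P, α P * (P.expectation φ).re := by
  have h : star φ ⬝ᵥ (hamiltonian α).mulVec φ = ∑ P, (α P : ℂ) * P.expectation φ := by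
    unfold hamiltonian PauliString.expectation
    rw [Matrix.sum_mulVec, dotProduct_sum]
    refine Finset.sum_congr rfl fun P _ => ?_
    rw [Matrix.smul_mulVec, dotProduct_smul, smul_eq_mul]
    congr 1
    simp only [dotProduct, Matrix.mulVec, Pi.star_apply, Finset.mul_sum, mul_assoc]
  rw [energy, h, Complex.re_sum]
  simp

open scoped Pointwise in
theorem measurePreserving_toSphere {E : Type*} [NormedAddCommGroup E] [InnerProductSpace ℝ E]
    [FiniteDimensional ℝ E] [MeasurableSpace E] [BorelSpace E] (U : E ≃ₗᵢ[ℝ] E)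
    (f : Metric.sphere (0 : E) 1 ≃ᵐ Metric.sphere (0 : E) 1) (hf : ∀ x, (f x : E) = U x) :
    MeasurePreserving f (volume : Measure E).toSphere (volume : Measure E).toSphere := by
  refine ⟨f.measurable, Measure.ext fun s hs => ?_⟩
  rw [Measure.map_apply f.measurable hs, Measure.toSphere_apply' _ hs,
    Measure.toSphere_apply' _ (f.measurable hs)]
  congr 1
  have h : U ⁻¹' (Set.Ioo (0 : ℝ) 1 • (Subtype.val '' s)) =
      Set.Ioo (0 : ℝ) 1 • (Subtype.val '' (f ⁻¹' s)) := by
    ext x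
    simp only [Set.mem_preimage, Set.mem_smul, Set.mem_image]
    constructor
    · rintro ⟨r, hr, _, ⟨z, hz, rfl⟩, h⟩
      refine ⟨r, hr, _, ⟨f.symm z, by simpa using hz, rfl⟩, U.injective ?_⟩
      rw [map_smul, ← hf, f.apply_symm_apply, h]
    · rintro ⟨r, hr, _, ⟨z, hz, rfl⟩, rfl⟩
      exact ⟨r, hr, _, ⟨f z, hz, rfl⟩, by rw [map_smul, hf]⟩
  rw [← h]
  exact (U.measurePreserving.measure_preimage_equiv (f := U.toHomeomorph.toMeasurableEquiv) _)

theorem integral_toSphere_comp {E : Type*} [NormedAddCommGroup E] [InnerProductSpace ℝ E]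
    [FiniteDimensional ℝ E] [MeasurableSpace E] [BorelSpace E] (U : E ≃ₗᵢ[ℝ] E) (g : E → ℝ) :
    ∫ x : Metric.sphere (0 : E) 1, g (U x) ∂(volume : Measure E).toSphere =
      ∫ x : Metric.sphere (0 : E) 1, g x ∂(volume : Measure E).toSphere := by
  have hm : ∀ (V : E ≃ₗᵢ[ℝ] E) (x : Metric.sphere (0 : E) 1), V x ∈ Metric.sphere (0 : E) 1 :=
    fun V x => by simp
  let f : Metric.sphere (0 : E) 1 ≃ᵐ Metric.sphere (0 : E) 1 :=
    { toFun := fun x => ⟨U x, hm U x⟩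
      invFun := fun x => ⟨U.symm x, hm U.symm x⟩
      left_inv := fun x => by ext; simp
      right_inv := fun x => by ext; simp
      measurable_toFun := by
        exact (U.continuous.comp continuous_subtype_val).measurable.subtype_mk
      measurable_invFun := by
        exact (U.symm.continuous.comp continuous_subtype_val).measurable.subtype_mk }
  exact (measurePreserving_toSphere U f fun x => rfl).integral_comp' fun x => g x

/-- The matrix `Z` on qubit `q`, as an isometry of the state space. -/
def phaseFlip {n : ℕ} (q : Fin n) :
    EuclideanSpace ℂ (Fin n → Fin 2) ≃ₗᵢ[ℝ] EuclideanSpace ℂ (Fin n → Fin 2) :=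
  LinearIsometryEquiv.piLpCongrRight 2 fun x =>
    if x q = 0 then LinearIsometryEquiv.refl ℝ ℂ else LinearIsometryEquiv.neg ℝ

/-- The permutation of the computational basis that flips qubit `q`. -/
def flipEquiv {n : ℕ} (q : Fin n) : (Fin n → Fin 2) ≃ (Fin n → Fin 2) :=
  Equiv.piCongrRight fun i => if i = q then Equiv.swap 0 1 else Equiv.refl _

/-- The matrix `X` on qubit `q`, as an isometry of the state space. -/
def bitFlip {n : ℕ} (q : Fin n) :
    EuclideanSpace ℂ (Fin n → Fin 2) ≃ₗᵢ[ℝ] EuclideanSpace ℂ (Fin n → Fin 2) :=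
  LinearIsometryEquiv.piLpCongrLeft 2 ℝ ℂ (flipEquiv q)

theorem expectation_phaseFlip {n : ℕ} (P : PauliString n) (q : Fin n) (h : P q = 1 ∨ P q = 2)
    (φ : EuclideanSpace ℂ (Fin n → Fin 2)) :
    P.expectation (fun x => phaseFlip q φ x) = -P.expectation (fun x => φ x) := by
  unfold PauliString.expectation
  simp only [← Finset.sum_neg_distrib]
  refine Finset.sum_congr rfl fun x _ => Finset.sum_congr rfl fun y _ => ?_
  have hφ : ∀ x, phaseFlip q φ x = if x q = 0 then φ x else -φ x := fun x => by
    simp only [phaseFlip, LinearIsometryEquiv.piLpCongrRight_apply]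
    split_ifs <;> simp
  by_cases hxy : x q = y q
  · have : P.toMatrix x y = 0 := by
      refine Finset.prod_eq_zero (Finset.mem_univ q) ?_
      rw [hxy]
      generalize y q = b
      rcases h with h | h <;> rw [h] <;> fin_cases b <;> simp [pauliMatrix]
    simp [this]
  · rw [hφ, hφ]
    have : (x q = 0 ∧ y q = 1) ∨ (x q = 1 ∧ y q = 0) := by omega
    rcases this with ⟨h1, h2⟩ | ⟨h1, h2⟩ <;> simp [h1, h2]

theorem expectation_bitFlip {n : ℕ} (P : PauliString n) (q : Fin n) (h : P q = 3)
    (φ : EuclideanSpace ℂ (Fin n → Fin 2)) :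
    P.expectation (fun x => bitFlip q φ x) = -P.expectation (fun x => φ x) := by
  unfold PauliString.expectation
  rw [← Equiv.sum_comp (flipEquiv q)]
  simp only [← Finset.sum_neg_distrib]
  refine Finset.sum_congr rfl fun x _ => ?_
  rw [← Equiv.sum_comp (flipEquiv q)]
  refine Finset.sum_congr rfl fun y _ => ?_
  have hφ : ∀ x, bitFlip q φ (flipEquiv q x) = φ x := fun x => by
    simp [bitFlip, LinearIsometryEquiv.piLpCongrLeft_apply, Equiv.piCongrLeft'_apply]
  have hP : P.toMatrix (flipEquiv q x) (flipEquiv q y) = -P.toMatrix x y := by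
    simp only [PauliString.toMatrix, Matrix.of_apply]
    rw [← Finset.mul_prod_erase _ _ (Finset.mem_univ q),
      ← Finset.mul_prod_erase _ (fun i => pauliMatrix (P i) (x i) (y i)) (Finset.mem_univ q),
      ← neg_mul]
    congr 1
    · simp only [flipEquiv, Equiv.piCongrRight_apply, Pi.map_apply, if_true]
      rw [h]
      generalize x q = a
      generalize y q = b
      fin_cases a <;> fin_cases b <;> simp [pauliMatrix]
    · refine Finset.prod_congr rfl fun i hi => ?_
      simp [flipEquiv, Finset.ne_of_mem_erase hi]
  rw [hφ, hφ, hP]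
  ring

theorem expectation_identityString {n : ℕ} (φ : (Fin n → Fin 2) → ℂ) :
    (identityString n).expectation φ = ((∑ x, ‖φ x‖ ^ 2 : ℝ) : ℂ) := by
  have h : (identityString n).toMatrix = 1 := by
    ext x y
    simp only [PauliString.toMatrix, identityString, Matrix.of_apply, pauliMatrix,
      Matrix.cons_val_zero, Matrix.one_apply]
    by_cases hxy : x = y
    · simp [hxy]
    · rw [if_neg hxy]
      obtain ⟨i, hi⟩ := Function.ne_iff.1 hxy
      exact Finset.prod_eq_zero (Finset.mem_univ i) (if_neg hi)
  unfold PauliString.expectation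
  rw [h]
  push_cast
  refine Finset.sum_congr rfl fun x _ => ?_
  simp [Matrix.one_apply, ← Complex.conj_mul']

theorem continuous_expectation {n : ℕ} (P : PauliString n) :
    Continuous fun φ : EuclideanSpace ℂ (Fin n → Fin 2) => (P.expectation fun x => φ x).re := by
  unfold PauliString.expectation
  fun_prop

/-- A Pauli string other than the identity is mapped to its negative by conjugation with a suitable
one-qubit Pauli matrix, so its Haar average vanishes. -/
theorem integral_expectation_eq_zero {n : ℕ} {P : PauliString n} (hP : P ≠ identityString n) :
    ∫ φ : Metric.sphere (0 : EuclideanSpace ℂ (Fin n → Fin 2)) 1,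
      (P.expectation fun x => φ.1 x).re
        ∂(volume : Measure (EuclideanSpace ℂ (Fin n → Fin 2))).toSphere = 0 := by
  obtain ⟨q, hq⟩ := Function.ne_iff.1 hP
  have key : ∃ U : EuclideanSpace ℂ (Fin n → Fin 2) ≃ₗᵢ[ℝ] EuclideanSpace ℂ (Fin n → Fin 2),
      ∀ φ, P.expectation (fun x => U φ x) = -P.expectation (fun x => φ x) := by
    have : P q ≠ 0 := hq
    have h : (P q = 1 ∨ P q = 2) ∨ P q = 3 := by omega
    rcases h with h | h
    · exact ⟨phaseFlip q, expectation_phaseFlip P q h⟩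
    · exact ⟨bitFlip q, expectation_bitFlip P q h⟩
  obtain ⟨U, hU⟩ := key
  have h := integral_toSphere_comp U fun φ => (P.expectation fun x => φ x).re
  simp only [hU, Complex.neg_re, integral_neg] at h
  linarith

theorem haarEnergy_eq {n : ℕ} (α : PauliString n → ℝ) :
    haarEnergy α = α (identityString n) := by
  have hint : ∀ P : PauliString n, Integrable
      (fun φ : Metric.sphere (0 : EuclideanSpace ℂ (Fin n → Fin 2)) 1 =>
        α P * (P.expectation fun x => φ.1 x).re)
      (volume : Measure (EuclideanSpace ℂ (Fin n → Fin 2))).toSphere := fun P =>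
    (((continuous_expectation P).comp continuous_subtype_val).const_smul
      (α P)).integrable_of_hasCompactSupport (HasCompactSupport.of_compactSpace _)
  have h1 : ∀ φ : Metric.sphere (0 : EuclideanSpace ℂ (Fin n → Fin 2)) 1,
      ((identityString n).expectation fun x => φ.1 x).re = 1 := fun φ => by
    rw [expectation_identityString, Complex.ofReal_re, ← EuclideanSpace.norm_sq_eq]
    simp
  have hne : (volume : Measure (EuclideanSpace ℂ (Fin n → Fin 2))).toSphere.real Set.univ ≠ 0 := by
    rw [Ne, measureReal_eq_zero_iff, Measure.measure_univ_eq_zero]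
    exact Measure.toSphere_ne_zero _
  unfold haarEnergy
  simp only [energy_eq_sum_expectation]
  rw [average_eq, integral_finsetSum _ fun P _ => hint P,
    Finset.sum_eq_single (identityString n)]
  · simp only [h1, integral_const, smul_eq_mul, mul_one]
    field_simp
  · intro P _ hP
    rw [integral_const_mul, integral_expectation_eq_zero hP, mul_zero]
  · simp

/-! ### The norm inequality -/

/-- The root of the sum of the squared coefficients of the terms that act nontrivially on `q`. -/
def localNorm {n : ℕ} (α : PauliString n → ℝ) (q : Fin n) : ℝ :=
  √(∑ P with P q ≠ 0, α P ^ 2)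

theorem PauliString.mem_dom {n : ℕ} {P : PauliString n} {q : Fin n} : q ∈ P.dom ↔ P q ≠ 0 := by
  simp [PauliString.dom]

theorem PauliString.dom_nonempty {n : ℕ} {P : PauliString n} (h : P ≠ identityString n) :
    P.dom.Nonempty := by
  obtain ⟨q, hq⟩ := Function.ne_iff.1 h
  exact ⟨q, PauliString.mem_dom.2 hq⟩

/-- A nonempty finite set is the set of values of a `d`-tuple or, if it is too large for that, it
contains the values of an injective `d`-tuple. -/
theorem exists_tuple {n : ℕ} (d : ℕ) {s : Finset (Fin n)} (hs : s.Nonempty) :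
    ∃ g : Fin d → Fin n, (∀ j, g j ∈ s) ∧
      ((Finset.univ.image g).card = d ∨ Finset.univ.image g = s) := by
  rcases le_total d s.card with h | h
  · refine ⟨fun j => s.equivFin.symm (Fin.castLE h j), fun j => by simp, Or.inl ?_⟩
    rw [Finset.card_image_of_injective _ fun i j hij => by
      simpa [Subtype.ext_iff, Fin.ext_iff] using hij]
    simp
  · have : Nonempty s := hs.to_subtype
    have hc : Fintype.card s ≤ Fintype.card (Fin d) := by simpa using h
    obtain ⟨f⟩ := Function.Embedding.nonempty_of_card_le hc
    obtain ⟨g, hg⟩ := f.injective.hasLeftInverse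
    refine ⟨fun j => g j, fun j => (g j).2, Or.inr ?_⟩
    ext x
    simp only [Finset.mem_image, Finset.mem_univ, true_and]
    exact ⟨by rintro ⟨j, rfl⟩; exact (g j).2, fun hx => ⟨f ⟨x, hx⟩, by rw [hg]⟩⟩

/-- The expansion property bounds a sum of `d`-th powers of weights by the `d`-th power of a sum:
each term is charged to a `d`-tuple of qubits, and at most `c` terms are charged to a tuple. -/
theorem HasExpansion.sum_pow_le {n : ℕ} {α : PauliString n → ℝ} {c : ℝ} {d : ℕ} (hd : 1 ≤ d)
    (hdn : d ≤ n) (h : HasExpansion α c d) (b : Fin n → ℝ) (hb : ∀ q, 0 ≤ b q)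
    (w : PauliString n → ℝ) (hw0 : ∀ P, 0 ≤ w P) (s : Finset (PauliString n))
    (hs : ∀ P ∈ s, P ≠ identityString n ∧ α P ≠ 0) (hw : ∀ P ∈ s, ∀ q ∈ P.dom, w P ≤ b q) :
    ∑ P ∈ s, w P ^ d ≤ c * (∑ q, b q) ^ d := by
  classical
  have hn : 0 < n := by omega
  have ex : ∀ P : PauliString n, ∃ g : Fin d → Fin n, P ≠ identityString n →
      (∀ j, g j ∈ P.dom) ∧ ((Finset.univ.image g).card = d ∨ Finset.univ.image g = P.dom) :=
    fun P => by
      by_cases hP : P = identityString n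
      · exact ⟨fun _ => ⟨0, hn⟩, fun h => absurd hP h⟩
      · obtain ⟨g, hg⟩ := exists_tuple d (PauliString.dom_nonempty hP)
        exact ⟨g, fun _ => hg⟩
  choose g hg using ex
  calc ∑ P ∈ s, w P ^ d ≤ ∑ P ∈ s, ∏ j, b (g P j) := by
        refine Finset.sum_le_sum fun P hP => ?_
        calc w P ^ d = ∏ _j : Fin d, w P := by simp
          _ ≤ _ := Finset.prod_le_prod (fun _ _ => hw0 P) fun j _ =>
            hw P hP _ ((hg P (hs P hP).1).1 j)
    _ = ∑ t : Fin d → Fin n, ∑ P ∈ s with g P = t, ∏ j, b (g P j) :=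
        (Finset.sum_fiberwise s g _).symm
    _ ≤ ∑ t : Fin d → Fin n, c * ∏ j, b (t j) := by
        refine Finset.sum_le_sum fun t _ => ?_
        have h1 : ∑ P ∈ s with g P = t, ∏ j, b (g P j) =
            ((s.filter fun P => g P = t).card : ℝ) * ∏ j, b (t j) := by
          rw [← nsmul_eq_mul, ← Finset.sum_const]
          refine Finset.sum_congr rfl fun P hP => ?_
          rw [(Finset.mem_filter.1 hP).2]
        rw [h1]
        refine mul_le_mul_of_nonneg_right ?_ (Finset.prod_nonneg fun j _ => hb _)
        have hcard : (Finset.univ.image t).card ≤ d := by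
          simpa using Finset.card_image_le (s := (Finset.univ : Finset (Fin d))) (f := t)
        obtain ⟨Υ, hΥ, hΥd⟩ := Finset.exists_superset_card_eq hcard (by simpa using hdn)
        refine le_trans ?_ (h Υ hΥd)
        rw [← Set.ncard_coe_finset]
        refine Nat.cast_le.2 (Set.ncard_le_ncard (fun P hP => ?_) (Set.toFinite _))
        obtain ⟨hPs, hPt⟩ := Finset.mem_filter.1 (Finset.mem_coe.1 hP)
        obtain ⟨hP1, hPα⟩ := hs P hPs
        obtain ⟨hm, hor⟩ := hg P hP1
        rw [hPt] at hm hor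
        refine ⟨hPα, ?_⟩
        have hsub : Finset.univ.image t ⊆ P.dom := by
          intro x hx
          obtain ⟨j, -, rfl⟩ := Finset.mem_image.1 hx
          exact hm j
        rcases hor with hor | hor
        · left
          rwa [← Finset.eq_of_subset_of_card_le hΥ (by omega)]
        · right
          rwa [← hor]
    _ = c * (∑ q, b q) ^ d := by
        rw [← Finset.mul_sum, ← Fintype.piFinset_univ, ← Finset.prod_univ_sum]
        simp

theorem HasExpansion.nonneg {n : ℕ} {α : PauliString n → ℝ} {c : ℝ} {d : ℕ} (hdn : d ≤ n)
    (h : HasExpansion α c d) : 0 ≤ c := by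
  obtain ⟨Υ, -, hΥ⟩ := Finset.exists_superset_card_eq (s := (∅ : Finset (Fin n))) (n := d)
    (by simp) (by simpa using hdn)
  exact le_trans (Nat.cast_nonneg _) (h Υ hΥ)

/-- Hölder's inequality with the weights `w P = min_{q ∈ dom P} b_q`, where `b_q` is the local norm
at `q`: the sum of `α_P² / w_P` is at most `∑_q b_q`, and the sum of `w_P ^ d` is bounded by the
expansion property. -/
theorem HasExpansion.nonIdentityNorm_le {n : ℕ} {α : PauliString n → ℝ} {c : ℝ} {d : ℕ}
    (hd : 1 ≤ d) (hdn : d ≤ n) (h : HasExpansion α c d) :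
    nonIdentityNorm α (expansionExponent d) ≤
      c ^ (1 / (2 * (d : ℝ))) * ∑ q, localNorm α q := by
  classical
  have hc := h.nonneg hdn
  have hd0 : (0 : ℝ) < d := by exact_mod_cast hd
  set b := localNorm α with hb
  have hb0 : ∀ q, 0 ≤ b q := fun q => Real.sqrt_nonneg _
  have hb2 : ∀ q, b q ^ 2 = ∑ P with P q ≠ 0, α P ^ 2 := fun q =>
    Real.sq_sqrt (Finset.sum_nonneg fun P _ => sq_nonneg _)
  have hB : 0 ≤ ∑ q, b q := Finset.sum_nonneg fun q _ => hb0 q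
  set B := ∑ q, b q with hBdef
  have hn : 0 < n := by omega
  have ex : ∀ P : PauliString n, ∃ q : Fin n, P ≠ identityString n →
      q ∈ P.dom ∧ ∀ q' ∈ P.dom, b q ≤ b q' := fun P => by
    by_cases hP : P = identityString n
    · exact ⟨⟨0, hn⟩, fun h => absurd hP h⟩
    · obtain ⟨q, hq⟩ := Finset.exists_min_image P.dom b (PauliString.dom_nonempty hP)
      exact ⟨q, fun _ => hq⟩
  choose m hm using ex
  set s := (Finset.univ.erase (identityString n)).filter fun P => α P ≠ 0 with hs
  have hs1 : ∀ P ∈ s, P ≠ identityString n ∧ α P ≠ 0 := fun P hP => by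
    simpa [hs] using hP
  have hαb : ∀ P q, P q ≠ 0 → α P ^ 2 ≤ b q ^ 2 := fun P q hPq => by
    rw [hb2]
    exact Finset.single_le_sum (f := fun P => α P ^ 2) (fun P _ => sq_nonneg _) (by simpa using hPq)
  have hwpos : ∀ P ∈ s, 0 < b (m P) := fun P hP => by
    have h1 := hαb P (m P) (PauliString.mem_dom.1 (hm P (hs1 P hP).1).1)
    have h2 : 0 < α P ^ 2 := by have := (hs1 P hP).2; positivity
    refine lt_of_le_of_ne (hb0 _) fun h0 => ?_
    rw [← h0] at h1
    nlinarith
  have hsum1 : ∑ P ∈ s, α P ^ 2 / b (m P) ≤ B := by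
    rw [← Finset.sum_fiberwise s m]
    refine Finset.sum_le_sum fun q _ => ?_
    calc ∑ P ∈ s with m P = q, α P ^ 2 / b (m P)
        = (∑ P ∈ s with m P = q, α P ^ 2) / b q := by
          rw [Finset.sum_div]
          exact Finset.sum_congr rfl fun P hP => by rw [(Finset.mem_filter.1 hP).2]
      _ ≤ b q ^ 2 / b q := by
          refine div_le_div_of_nonneg_right ?_ (hb0 q)
          rw [hb2]
          refine Finset.sum_le_sum_of_subset_of_nonneg (fun P hP => ?_) fun _ _ _ => sq_nonneg _
          obtain ⟨hPs, rfl⟩ := Finset.mem_filter.1 hP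
          simpa using PauliString.mem_dom.1 (hm P (hs1 P hPs).1).1
      _ ≤ b q := by
          rcases eq_or_ne (b q) 0 with h0 | h0
          · simp [h0]
          · rw [sq, mul_div_cancel_right₀ _ h0]
  have hsum2 : ∑ P ∈ s, b (m P) ^ d ≤ c * B ^ d :=
    h.sum_pow_le hd hdn b hb0 (fun P => b (m P)) (fun P => hb0 _) s hs1
      fun P hP q hq => (hm P (hs1 P hP).1).2 q hq
  set e : ℝ := d / (d + 1) with he
  have he0 : 0 < e := by positivity
  have hconj : ((d + 1 : ℝ) / d).HolderConjugate (d + 1) := by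
    rw [Real.holderConjugate_iff]
    refine ⟨by rw [lt_div_iff₀ hd0]; linarith, ?_⟩
    field_simp
  have hmain : ∑ P ∈ Finset.univ.erase (identityString n), |α P| ^ expansionExponent d ≤
      B ^ e * (c * B ^ d) ^ (1 / (d + 1 : ℝ)) := by
    have hr0 : expansionExponent d ≠ 0 := by
      unfold expansionExponent
      positivity
    have hr : expansionExponent d = 2 * e := by
      unfold expansionExponent
      rw [he]
      ring
    calc ∑ P ∈ Finset.univ.erase (identityString n), |α P| ^ expansionExponent d
        = ∑ P ∈ s, |α P| ^ expansionExponent d := by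
          rw [hs, Finset.sum_filter]
          refine Finset.sum_congr rfl fun P _ => ?_
          split_ifs with h0
          · rfl
          · rw [not_not.1 h0, abs_zero, Real.zero_rpow hr0]
      _ = ∑ P ∈ s, (α P ^ 2 / b (m P)) ^ e * b (m P) ^ e := by
          refine Finset.sum_congr rfl fun P hP => ?_
          have hw := hwpos P hP
          rw [← Real.mul_rpow (by positivity) hw.le, div_mul_cancel₀ _ hw.ne', hr,
            Real.rpow_mul (abs_nonneg _), ← sq_abs]
          norm_num
      _ ≤ (∑ P ∈ s, ((α P ^ 2 / b (m P)) ^ e) ^ ((d + 1 : ℝ) / d)) ^ (1 / ((d + 1 : ℝ) / d)) *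
            (∑ P ∈ s, (b (m P) ^ e) ^ (d + 1 : ℝ)) ^ (1 / (d + 1 : ℝ)) :=
          Real.inner_le_Lp_mul_Lq_of_nonneg s hconj
            (fun P hP => Real.rpow_nonneg (div_nonneg (sq_nonneg _) (hb0 _)) _)
            (fun P hP => Real.rpow_nonneg (hb0 _) _)
      _ = (∑ P ∈ s, α P ^ 2 / b (m P)) ^ e * (∑ P ∈ s, b (m P) ^ d) ^ (1 / (d + 1 : ℝ)) := by
          congr 1
          · rw [one_div_div]
            congr 1
            refine Finset.sum_congr rfl fun P _ => ?_
            rw [← Real.rpow_mul (div_nonneg (sq_nonneg _) (hb0 _)),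
              show e * ((d + 1 : ℝ) / d) = 1 by rw [he]; field_simp, Real.rpow_one]
          · congr 1
            refine Finset.sum_congr rfl fun P _ => ?_
            rw [← Real.rpow_mul (hb0 _), show e * (d + 1 : ℝ) = (d : ℕ) by rw [he]; field_simp,
              Real.rpow_natCast]
      _ ≤ _ := by
          have h1 : 0 ≤ ∑ P ∈ s, α P ^ 2 / b (m P) :=
            Finset.sum_nonneg fun P _ => div_nonneg (sq_nonneg _) (hb0 _)
          have h2 : 0 ≤ ∑ P ∈ s, b (m P) ^ d :=
            Finset.sum_nonneg fun P _ => pow_nonneg (hb0 _) _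
          gcongr
  have hexp : 1 / expansionExponent d = (d + 1) / (2 * d) := by
    unfold expansionExponent
    rw [one_div_div]
  unfold nonIdentityNorm
  calc _ ≤ (B ^ e * (c * B ^ d) ^ (1 / (d + 1 : ℝ))) ^ (1 / expansionExponent d) := by
        refine Real.rpow_le_rpow (Finset.sum_nonneg fun P _ => Real.rpow_nonneg (abs_nonneg _) _)
          hmain ?_
        rw [hexp]
        positivity
    _ = c ^ (1 / (2 * (d : ℝ))) * B := by
        rw [hexp, Real.mul_rpow (by positivity) (by positivity), ← Real.rpow_mul hB,
          ← Real.rpow_mul (by positivity), Real.mul_rpow hc (by positivity), ← Real.rpow_natCast B,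
          ← Real.rpow_mul hB,
          show e * ((d + 1) / (2 * d)) = 1 / 2 by rw [he]; field_simp,
          show 1 / (d + 1 : ℝ) * ((d + 1) / (2 * d)) = 1 / (2 * d) by field_simp,
          show (d : ℝ) * (1 / (2 * d)) = 1 / 2 by field_simp]
        rw [mul_left_comm, ← Real.sqrt_eq_rpow, Real.mul_self_sqrt hB]

/-! ### The constants -/

theorem one_div_expansionExponent_mem {d : ℕ} (hd : 1 ≤ d) :
    1 / 2 ≤ 1 / expansionExponent d ∧ 1 / expansionExponent d ≤ 1 := by
  have hd0 : (1 : ℝ) ≤ d := by exact_mod_cast hd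
  unfold expansionExponent
  rw [one_div_div]
  constructor
  · rw [div_le_div_iff₀ (by norm_num) (by positivity)]
    linarith
  · rw [div_le_one (by positivity)]
    linarith

theorem advantageConstant_bounds (k : ℕ) (hk : 1 ≤ k) : ∃ A B : ℝ, 0 < A ∧ 0 < B ∧
    ∀ (c : ℝ) (d : ℕ), 0 < c → 1 ≤ d →
      A * (1 / c ^ (1 / (2 * (d : ℝ)))) ≤ advantageConstant c d k ∧
      advantageConstant c d k ≤ B * (1 / c ^ (1 / (2 * (d : ℝ)))) := by
  have hk1 : (1 : ℝ) ≤ k := by exact_mod_cast hk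
  have hk0 : (0 : ℝ) < k := by linarith
  refine ⟨√(2 * (k.factorial : ℝ)) / ((k : ℝ) ^ ((k : ℝ) + 3 / 2 + 1) * (√6 + 2 * √3) ^ k),
    √(2 * (k.factorial : ℝ)) / ((k : ℝ) ^ ((k : ℝ) + 3 / 2 + 1 / 2) * (√6 + 2 * √3) ^ k),
    by positivity, by positivity, fun c d hc hd => ?_⟩
  obtain ⟨h1, h2⟩ := one_div_expansionExponent_mem hd
  unfold advantageConstant
  rw [← mul_div_assoc, ← mul_div_assoc, mul_one, mul_one, div_div, div_div,
    mul_comm _ (c ^ _), mul_comm _ (c ^ _), ← mul_assoc, ← mul_assoc]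
  constructor
  · gcongr
  · gcongr

/-- The square of the inequality between `3√3 / 18 ^ k` and the constant, with the lower bound `5.9`
for `√6 + 2√3`. -/
theorem two_mul_factorial_mul_pow_le (k : ℕ) (hk : 1 ≤ k) :
    2 * (k.factorial : ℝ) * (324 / 34.81) ^ k ≤ 27 * (k : ℝ) ^ (2 * k + 4) := by
  rcases Nat.lt_or_ge k 3 with h | h
  · interval_cases k <;> norm_num [Nat.factorial]
  · induction k, h using Nat.le_induction with
    | base => norm_num [Nat.factorial]
    | succ k h3 ih =>
      have ih := ih (by omega)
      have hk3 : (3 : ℝ) ≤ k := by exact_mod_cast h3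
      have hB : 1 + ((2 * k + 4 : ℕ) : ℝ) * (1 / k) ≤ (1 + 1 / (k : ℝ)) ^ (2 * k + 4) :=
        one_add_mul_le_pow (by have : (0 : ℝ) ≤ 1 / k := by positivity
                               linarith) _
      have hB' : 3 ≤ (1 + 1 / (k : ℝ)) ^ (2 * k + 4) := by
        refine le_trans ?_ hB
        push_cast
        field_simp
        linarith
      have hpow : ((k + 1 : ℕ) : ℝ) ^ (2 * (k + 1) + 4) =
          (k : ℝ) ^ (2 * k + 4) * (1 + 1 / (k : ℝ)) ^ (2 * k + 4) * (k + 1) ^ 2 := by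
        have h1 : (k : ℝ) * (1 + 1 / k) = k + 1 := by field_simp
        rw [← mul_pow, h1]
        push_cast
        ring
      rw [hpow, Nat.factorial_succ, pow_succ]
      push_cast
      calc 2 * ((k + 1 : ℝ) * k.factorial) * ((324 / 34.81) ^ k * (324 / 34.81))
          = (2 * k.factorial * (324 / 34.81) ^ k) * ((k + 1) * (324 / 34.81)) := by ring
        _ ≤ (27 * (k : ℝ) ^ (2 * k + 4)) * (3 * (k + 1) ^ 2) := by
            refine mul_le_mul ih ?_ (by positivity) (by positivity)
            nlinarith
        _ ≤ (27 * (k : ℝ) ^ (2 * k + 4)) * ((1 + 1 / (k : ℝ)) ^ (2 * k + 4) * (k + 1) ^ 2) := by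
            gcongr
        _ = _ := by ring

/-- The advantage `3√3 / 18 ^ k` guaranteed by the algorithm exceeds the constant of the theorem. -/
theorem advantageConstant_mul_le {c : ℝ} {d k : ℕ} (hc : 0 ≤ c) (hd : 1 ≤ d) (hk : 1 ≤ k) {x B : ℝ}
    (hB : 0 ≤ B) (hx : x ≤ c ^ (1 / (2 * (d : ℝ))) * B) :
    advantageConstant c d k * x ≤ 3 * √3 / 18 ^ k * B := by
  have hk1 : (1 : ℝ) ≤ k := by exact_mod_cast hk
  have hk0 : (0 : ℝ) < k := by linarith
  obtain ⟨h1, -⟩ := one_div_expansionExponent_mem hd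
  rcases (Real.rpow_nonneg hc (1 / (2 * (d : ℝ)))).eq_or_lt with h0 | h0
  · -- For `c = 0` the constant is `0`, by the convention for division by zero.
    unfold advantageConstant
    rw [← h0]
    simp only [zero_mul, div_zero]
    positivity
  · have hA : 0 ≤ advantageConstant c d k := by
      unfold advantageConstant
      positivity
    refine le_trans (mul_le_mul_of_nonneg_left hx hA) ?_
    rw [← mul_assoc]
    refine mul_le_mul_of_nonneg_right ?_ hB
    have e1 : advantageConstant c d k * c ^ (1 / (2 * (d : ℝ))) =
        √(2 * (k.factorial : ℝ)) / ((k : ℝ) ^ ((k : ℝ) + 3 / 2 + 1 / expansionExponent d) *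
          (√6 + 2 * √3) ^ k) := by
      unfold advantageConstant
      field_simp
    have e2 : (k : ℝ) ^ (k + 2) ≤ (k : ℝ) ^ ((k : ℝ) + 3 / 2 + 1 / expansionExponent d) := by
      rw [← Real.rpow_natCast]
      refine Real.rpow_le_rpow_of_exponent_le hk1 ?_
      push_cast
      linarith
    have e3 : (5.9 : ℝ) ≤ √6 + 2 * √3 := by
      have h6 : (2.449 : ℝ) ≤ √6 := Real.le_sqrt_of_sq_le (by norm_num)
      have h3 : (1.732 : ℝ) ≤ √3 := Real.le_sqrt_of_sq_le (by norm_num)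
      linarith
    have e4 : √(2 * (k.factorial : ℝ)) * 18 ^ k ≤ 3 * √3 * ((k : ℝ) ^ (k + 2) * 5.9 ^ k) := by
      refine (sq_le_sq₀ (by positivity) (by positivity)).1 ?_
      have h3 : √3 ^ 2 = (3 : ℝ) := Real.sq_sqrt (by norm_num)
      have hf : √(2 * (k.factorial : ℝ)) ^ 2 = 2 * k.factorial := Real.sq_sqrt (by positivity)
      have hmain := two_mul_factorial_mul_pow_le k hk
      calc (√(2 * (k.factorial : ℝ)) * 18 ^ k) ^ 2 =
            2 * k.factorial * (324 / 34.81) ^ k * 34.81 ^ k := by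
            rw [mul_pow, hf, mul_assoc (2 * (k.factorial : ℝ)), ← mul_pow, ← pow_mul, mul_comm k 2,
              pow_mul]
            norm_num
        _ ≤ 27 * (k : ℝ) ^ (2 * k + 4) * 34.81 ^ k := by gcongr
        _ = (3 * √3 * ((k : ℝ) ^ (k + 2) * 5.9 ^ k)) ^ 2 := by
            have : (34.81 : ℝ) ^ k = (5.9 ^ k) ^ 2 := by
              rw [← pow_mul, mul_comm k 2, pow_mul]
              norm_num
            rw [this, mul_pow, mul_pow, h3]
            ring
    rw [e1, div_le_div_iff₀ (by positivity) (by positivity)]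
    refine e4.trans ?_
    gcongr

/-! ### Energies of product states -/

/-- The expectation value of the one-qubit Pauli matrix with label `p` in the state `ψ`. -/
def qubitExpectation (p : Fin 4) (ψ : Fin 2 → ℂ) : ℂ :=
  ∑ a, ∑ b, star (ψ a) * pauliMatrix p a b * ψ b

theorem expectation_productVector {n : ℕ} (P : PauliString n) (ψ : Fin n → Fin 2 → ℂ) :
    P.expectation (productVector ψ) = ∏ q, qubitExpectation (P q) (ψ q) := by
  unfold qubitExpectation PauliString.expectation
  rw [Finset.prod_univ_sum, Fintype.piFinset_univ]
  refine Finset.sum_congr rfl fun x _ => ?_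
  rw [Finset.prod_univ_sum, Fintype.piFinset_univ]
  refine Finset.sum_congr rfl fun y _ => ?_
  simp only [productVector, PauliString.toMatrix, Matrix.of_apply, star_prod,
    Finset.prod_mul_distrib]

/-- The pure one-qubit state with Bloch vector `(x, y, z)`, for `z > -1`. -/
def blochState (x y z : ℝ) : Fin 2 → ℂ :=
  ![⟨√((1 + z) / 2), 0⟩, ⟨x / (2 * √((1 + z) / 2)), y / (2 * √((1 + z) / 2))⟩]

theorem sum_norm_sq_blochState {x y z : ℝ} (hz : -1 < z) (h : x ^ 2 + y ^ 2 + z ^ 2 = 1) :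
    ∑ b, ‖blochState x y z b‖ ^ 2 = 1 := by
  have hA : 0 < √((1 + z) / 2) := Real.sqrt_pos.2 (by linarith)
  have hA2 : √((1 + z) / 2) ^ 2 = (1 + z) / 2 := Real.sq_sqrt (by linarith)
  simp only [blochState, Fin.sum_univ_two, Complex.sq_norm, Complex.normSq_mk,
    Matrix.cons_val_zero, Matrix.cons_val_one]
  generalize √((1 + z) / 2) = A at *
  field_simp
  rw [hA2]
  nlinarith

theorem qubitExpectation_blochState {x y z : ℝ} (hz : -1 < z) (h : x ^ 2 + y ^ 2 + z ^ 2 = 1)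
    (p : Fin 4) : qubitExpectation p (blochState x y z) = ((![1, x, y, z] p : ℝ) : ℂ) := by
  have hA : 0 < √((1 + z) / 2) := Real.sqrt_pos.2 (by linarith)
  have hA2 : √((1 + z) / 2) ^ 2 = (1 + z) / 2 := Real.sq_sqrt (by linarith)
  unfold qubitExpectation blochState
  generalize √((1 + z) / 2) = A at *
  have hz' : z = 2 * A ^ 2 - 1 := by linarith
  fin_cases p <;> apply Complex.ext <;>
    simp [Fin.sum_univ_two, pauliMatrix, Complex.mul_re, Complex.mul_im] <;> field_simp <;>
    first | (ring; done) | (subst hz'; nlinarith)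

/-- The number of the variable that stands for the Bloch component of qubit `q` along the axis of
`P`. -/
def PauliString.code {n : ℕ} (P : PauliString n) (q : Fin n) : ℕ := 4 * q + P q

theorem PauliString.code_injective {n : ℕ} (P : PauliString n) : Function.Injective P.code := by
  intro q q' h
  unfold PauliString.code at h
  ext
  omega

/-- The variables on which the expectation value of `P` depends. -/
def PauliString.vars {n : ℕ} (P : PauliString n) : Finset ℕ := P.dom.image P.code

theorem PauliString.prod_vars {n : ℕ} (P : PauliString n) (f : ℕ → ℝ) :
    ∏ w ∈ P.vars, f w = ∏ q ∈ P.dom, f (P.code q) :=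
  Finset.prod_image fun _ _ _ _ h => P.code_injective h

theorem PauliString.card_vars {n : ℕ} (P : PauliString n) : P.vars.card = P.weight :=
  Finset.card_image_of_injective _ P.code_injective

theorem PauliString.lt_of_mem_vars {n : ℕ} {P : PauliString n} {w : ℕ} (h : w ∈ P.vars) :
    w < 4 * n := by
  obtain ⟨q, -, rfl⟩ := Finset.mem_image.1 h
  unfold PauliString.code
  omega

theorem PauliString.code_mem_vars {n : ℕ} {P P' : PauliString n} {q : Fin n} :
    P.code q ∈ P'.vars ↔ P q ≠ 0 ∧ P' q = P q := by
  unfold PauliString.vars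
  rw [Finset.mem_image]
  constructor
  · rintro ⟨q', h, h'⟩
    unfold PauliString.code at h'
    have h1 : q' = q := by ext; omega
    subst h1
    have h2 : P' q' = P q' := by ext; omega
    exact ⟨h2 ▸ PauliString.mem_dom.1 h, h2⟩
  · rintro ⟨h, h'⟩
    exact ⟨q, PauliString.mem_dom.2 (h' ▸ h), by unfold PauliString.code; rw [h']⟩

theorem PauliString.vars_injective {n : ℕ} :
    Function.Injective (PauliString.vars : PauliString n → Finset ℕ) := by
  intro P P' h
  funext q
  by_cases h0 : P q = 0
  · by_contra h1
    have h2 : P'.code q ∈ P.vars := h ▸ PauliString.code_mem_vars.2 ⟨by rw [← h0]; exact Ne.symm h1, rfl⟩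
    exact h1 (PauliString.code_mem_vars.1 h2).2
  · have h2 : P.code q ∈ P'.vars := h ▸ PauliString.code_mem_vars.2 ⟨h0, rfl⟩
    exact (PauliString.code_mem_vars.1 h2).2.symm

/-- The product state in which the Bloch vector of qubit `q` is
`(Z (4q+1), Z (4q+2), Z (4q+3)) / √3`. -/
def signState (n : ℕ) (Z : ℕ → ℝ) : Fin n → Fin 2 → ℂ :=
  fun q => blochState (Z (4 * q + 1) / √3) (Z (4 * q + 2) / √3) (Z (4 * q + 3) / √3)

theorem sign_bloch {Z : ℕ → ℝ} (hZ : ∀ w, Z w = 1 ∨ Z w = -1) (a b c : ℕ) :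
    -1 < Z c / √3 ∧ (Z a / √3) ^ 2 + (Z b / √3) ^ 2 + (Z c / √3) ^ 2 = 1 := by
  have h3 : (1 : ℝ) < √3 := Real.lt_sqrt_of_sq_lt (by norm_num)
  have hsq : ∀ w, Z w ^ 2 = 1 := fun w => by rcases hZ w with h | h <;> rw [h] <;> norm_num
  constructor
  · rw [lt_div_iff₀ (by linarith)]
    rcases hZ c with h | h <;> rw [h] <;> linarith
  · rw [div_pow, div_pow, div_pow, hsq, hsq, hsq, Real.sq_sqrt (by norm_num)]
    norm_num

theorem sum_norm_sq_signState {n : ℕ} {Z : ℕ → ℝ} (hZ : ∀ w, Z w = 1 ∨ Z w = -1) (q : Fin n) :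
    ∑ b, ‖signState n Z q b‖ ^ 2 = 1 :=
  sum_norm_sq_blochState (sign_bloch hZ (4 * q + 1) (4 * q + 2) (4 * q + 3)).1
    (sign_bloch hZ (4 * q + 1) (4 * q + 2) (4 * q + 3)).2

theorem energy_signState {n : ℕ} (α : PauliString n → ℝ) {Z : ℕ → ℝ}
    (hZ : ∀ w, Z w = 1 ∨ Z w = -1) :
    energy α (productVector (signState n Z)) =
      ∑ P : PauliString n, α P * ((1 / √3) ^ P.weight * ∏ w ∈ P.vars, Z w) := by
  rw [energy_eq_sum_expectation]
  refine Finset.sum_congr rfl fun P _ => ?_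
  congr 1
  have h : ∀ q, qubitExpectation (P q) (signState n Z q) =
      ((if P q ≠ 0 then 1 / √3 * Z (P.code q) else 1 : ℝ) : ℂ) := fun q => by
    unfold signState PauliString.code
    obtain ⟨h1, h2⟩ := sign_bloch hZ (4 * q + 1) (4 * q + 2) (4 * q + 3)
    rw [qubitExpectation_blochState h1 h2]
    generalize P q = p
    fin_cases p <;> simp [div_eq_inv_mul]
  rw [expectation_productVector, Finset.prod_congr rfl fun q _ => h q, ← Complex.ofReal_prod,
    Complex.ofReal_re, ← Finset.prod_filter, Finset.prod_mul_distrib, Finset.prod_const,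
    PauliString.prod_vars]
  rfl

/-! ### Randomized rounding -/

/-- The sign with mean `x` computed from a uniform sample `u`. -/
def roundSign (x : ℝ) (u : unitInterval) : ℝ := if 2 * (u : ℝ) - 1 ≤ x then 1 else -1

theorem roundSign_eq (x : ℝ) (u : unitInterval) : roundSign x u = 1 ∨ roundSign x u = -1 := by
  unfold roundSign
  split_ifs <;> simp

theorem measurable_roundSign (x : ℝ) : Measurable (roundSign x) :=
  Measurable.ite (measurableSet_le (by fun_prop) measurable_const) measurable_const
    measurable_const

theorem integral_roundSign {x : ℝ} (h1 : -1 ≤ x) (h2 : x ≤ 1) : ∫ u, roundSign x u = x := by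
  have hs : MeasurableSet {u : unitInterval | 2 * (u : ℝ) - 1 ≤ x} :=
    measurableSet_le (by fun_prop) measurable_const
  have h : ∀ u, roundSign x u =
      {u : unitInterval | 2 * (u : ℝ) - 1 ≤ x}.indicator (fun _ => (2 : ℝ)) u - 1 := fun u => by
    unfold roundSign
    by_cases hu : 2 * (u : ℝ) - 1 ≤ x
    · rw [if_pos hu, Set.indicator_of_mem (by exact hu)]; norm_num
    · rw [if_neg hu, Set.indicator_of_notMem (by exact hu)]; norm_num
  have hv : (volume : Measure unitInterval).real {u | 2 * (u : ℝ) - 1 ≤ x} = (1 + x) / 2 := by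
    have : Subtype.val '' {u : unitInterval | 2 * (u : ℝ) - 1 ≤ x} = Set.Icc 0 ((1 + x) / 2) := by
      ext v
      simp only [Set.mem_image, Set.mem_ofPred_eq, Subtype.exists, exists_and_right, exists_eq_right,
        Set.mem_Icc]
      constructor
      · rintro ⟨hv, h⟩
        exact ⟨hv.1, by linarith⟩
      · rintro ⟨h0, h⟩
        exact ⟨⟨h0, by linarith⟩, by linarith⟩
    rw [measureReal_def, unitInterval.volume_apply, this, Real.volume_Icc, sub_zero,
      ENNReal.toReal_ofReal (by linarith)]
  simp only [h]
  rw [integral_sub ((integrable_const _).indicator hs) (integrable_const _),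
    integral_indicator_const _ hs, hv]
  simp

theorem integral_prod_roundSign {X : ℕ → ℝ} (h1 : ∀ w, -1 ≤ X w) (h2 : ∀ w, X w ≤ 1)
    (S : Finset ℕ) :
    ∫ ω, ∏ w ∈ S, roundSign (X w) (ω w) ∂tapeMeasure = ∏ w ∈ S, X w := by
  have hind : ProbabilityTheory.iIndepFun (fun (w : S) (ω : ℕ → unitInterval) => ω w)
      tapeMeasure :=
    (ProbabilityTheory.iIndepFun_infinitePi (X := fun (_ : ℕ) (u : unitInterval) => u)
      (by fun_prop)).precomp Subtype.val_injective
  have h := hind.integral_fun_prod_comp (𝕜 := ℝ) (f := fun (w : S) u => roundSign (X w) u)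
    (fun w => (measurable_pi_apply _).aemeasurable)
    fun w => (measurable_roundSign _).aestronglyMeasurable
  have hw : ∀ w : ℕ, ∫ ω, roundSign (X w) (ω w) ∂tapeMeasure = X w := fun w => by
    have h3 := integral_roundSign (h1 w) (h2 w)
    rw [← Measure.infinitePi_map_eval (fun _ : ℕ => (volume : Measure unitInterval)) w,
      integral_map (measurable_pi_apply w).aemeasurable
        (measurable_roundSign _).aestronglyMeasurable] at h3
    exact h3
  rw [Finset.prod_coe_sort S fun w => ∫ ω, roundSign (X w) (ω w) ∂tapeMeasure] at h
  simp only [hw] at h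
  rw [← h]
  refine integral_congr_ae (Filter.Eventually.of_forall fun ω => ?_)
  exact (Finset.prod_coe_sort S fun w => roundSign (X w) (ω w)).symm

theorem integrable_prod_roundSign (X : ℕ → ℝ) (S : Finset ℕ) :
    Integrable (fun ω : ℕ → unitInterval => ∏ w ∈ S, roundSign (X w) (ω w)) tapeMeasure := by
  have : IsProbabilityMeasure tapeMeasure := by unfold tapeMeasure; infer_instance
  refine Integrable.of_bound (C := 1) (Measurable.aestronglyMeasurable ?_)
    (Filter.Eventually.of_forall fun ω => ?_)
  · exact Finset.measurable_prod _ fun w _ =>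
      (measurable_roundSign _).comp (measurable_pi_apply w)
  · rw [norm_prod]
    refine Finset.prod_le_one (fun _ _ => norm_nonneg _) fun w _ => ?_
    rcases roundSign_eq (X w) (ω w) with h | h <;> rw [h] <;> simp

/-- Rounding the variables independently preserves the mean energy. -/
theorem integral_energy_roundSign {n : ℕ} (α : PauliString n → ℝ) {X : ℕ → ℝ}
    (h1 : ∀ w, -1 ≤ X w) (h2 : ∀ w, X w ≤ 1) :
    Integrable (fun ω => energy α (productVector (signState n fun w => roundSign (X w) (ω w))))
      tapeMeasure ∧
    ∫ ω, energy α (productVector (signState n fun w => roundSign (X w) (ω w))) ∂tapeMeasure =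
      ∑ P : PauliString n, α P * ((1 / √3) ^ P.weight * ∏ w ∈ P.vars, X w) := by
  have h : ∀ ω : ℕ → unitInterval,
      energy α (productVector (signState n fun w => roundSign (X w) (ω w))) = _ :=
    fun ω => energy_signState α fun w => roundSign_eq (X w) (ω w)
  simp only [h]
  have hint : ∀ P : PauliString n, Integrable (fun ω : ℕ → unitInterval =>
      α P * ((1 / √3) ^ P.weight * ∏ w ∈ P.vars, roundSign (X w) (ω w))) tapeMeasure := fun P =>
    ((integrable_prod_roundSign X P.vars).const_mul _).const_mul _
  refine ⟨integrable_finsetSum _ fun P _ => hint P, ?_⟩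
  rw [integral_finsetSum _ fun P _ => hint P]
  refine Finset.sum_congr rfl fun P _ => ?_
  rw [integral_const_mul, integral_const_mul, integral_prod_roundSign h1 h2]

/-! ### Reading off a linear coefficient -/

/-- The points `1, -1, 1/2, -1/2, 1/4, -1/4, …`. -/
def scaleNode : ℕ → ℝ
  | 0 => 1
  | c + 1 => if 0 ≤ scaleNode c then -scaleNode c else -scaleNode c / 2

theorem scaleNode_two_mul (i : ℕ) :
    scaleNode (2 * i) = (1 / 2) ^ i ∧ scaleNode (2 * i + 1) = -(1 / 2) ^ i := by
  have h : ∀ i, scaleNode (2 * i) = (1 / 2) ^ i → scaleNode (2 * i + 1) = -(1 / 2) ^ i := by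
    intro i h
    rw [scaleNode, h, if_pos (by positivity)]
  induction i with
  | zero => exact ⟨by simp [scaleNode], h 0 (by simp [scaleNode])⟩
  | succ i ih =>
    have h1 : scaleNode (2 * (i + 1)) = (1 / 2) ^ (i + 1) := by
      rw [show 2 * (i + 1) = 2 * i + 1 + 1 by ring, scaleNode, ih.2, if_neg]
      · ring
      · have : (0 : ℝ) < (1 / 2) ^ i := by positivity
        linarith
    exact ⟨h1, h _ h1⟩

theorem abs_scaleNode_le (c : ℕ) : |scaleNode c| ≤ 1 := by
  have h : ∀ i : ℕ, |((1 : ℝ) / 2) ^ i| ≤ 1 := fun i => by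
    rw [abs_of_nonneg (by positivity)]
    exact pow_le_one₀ (by norm_num) (by norm_num)
  rcases Nat.even_or_odd' c with ⟨i, rfl | rfl⟩
  · rw [(scaleNode_two_mul i).1]; exact h i
  · rw [(scaleNode_two_mul i).2, abs_neg]; exact h i

/-- Richardson extrapolation: the combination `q t - 2 ^ (2m+1) * q (t / 2)` removes the top
coefficient of an odd polynomial `q` of degree `2m+1`, multiplies the linear one by `1 - 4 ^ m`, and
increases the bound by a factor of at most `1 + 2 * 4 ^ m ≤ 3 * (4 ^ m - 1)`. -/
theorem exists_node_odd (m : ℕ) (c : ℕ → ℝ) : ∃ i < m + 1,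
    |c 0| ≤ 3 ^ m * |∑ j ∈ Finset.range (m + 1), c j * ((1 / 2 : ℝ) ^ i) ^ (2 * j + 1)| := by
  induction m generalizing c with
  | zero => exact ⟨0, by simp, by simp⟩
  | succ m ih =>
    let c' : ℕ → ℝ := fun j => c j * (1 - 4 ^ (m + 1 - j))
    obtain ⟨i, hi, h⟩ := ih c'
    set Q : ℝ → ℝ := fun t => ∑ j ∈ Finset.range (m + 1 + 1), c j * t ^ (2 * j + 1) with hQ
    have hcomb : ∑ j ∈ Finset.range (m + 1), c' j * ((1 / 2 : ℝ) ^ i) ^ (2 * j + 1) =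
        Q ((1 / 2) ^ i) - 2 * 4 ^ (m + 1) * Q ((1 / 2) ^ (i + 1)) := by
      simp only [hQ]
      rw [Finset.mul_sum, ← Finset.sum_sub_distrib, Finset.sum_range_succ _ (m + 1)]
      have h4 : ∀ j, ((2 : ℝ) ^ (2 * j + 1)) = 2 * 4 ^ j := fun j => by
        rw [pow_succ, pow_mul]; norm_num; ring
      have hz : c (m + 1) * ((1 / 2 : ℝ) ^ i) ^ (2 * (m + 1) + 1) -
          2 * 4 ^ (m + 1) * (c (m + 1) * ((1 / 2 : ℝ) ^ (i + 1)) ^ (2 * (m + 1) + 1)) = 0 := by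
        rw [pow_succ (1 / 2 : ℝ) i, mul_pow, one_div_pow 2 (2 * (m + 1) + 1), h4]
        field_simp
        ring
      rw [hz, add_zero]
      refine Finset.sum_congr rfl fun j hj => ?_
      have hj' : j ≤ m := by simpa [Nat.lt_succ_iff] using hj
      rw [pow_succ (1 / 2 : ℝ) i, mul_pow, one_div_pow 2 (2 * j + 1), h4]
      simp only [c']
      rw [show (4 : ℝ) ^ (m + 1) = 4 ^ (m + 1 - j) * 4 ^ j by rw [← pow_add]; congr 1; omega]
      field_simp
    have h4m : (4 : ℝ) ≤ 4 ^ (m + 1) := by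
      calc (4 : ℝ) = 4 ^ 1 := by norm_num
        _ ≤ _ := pow_le_pow_right₀ (by norm_num) (by omega)
    have hc0 : |c' 0| = |c 0| * (4 ^ (m + 1) - 1) := by
      simp only [c', Nat.sub_zero]
      rw [abs_mul, abs_sub_comm, abs_of_nonneg (by linarith : (0 : ℝ) ≤ 4 ^ (m + 1) - 1)]
    rw [hcomb, hc0] at h
    have hle : ∀ B, |Q ((1 / 2) ^ i)| ≤ B → |Q ((1 / 2) ^ (i + 1))| ≤ B →
        |c 0| ≤ 3 ^ (m + 1) * B := by
      intro B h1 h2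
      have hB : 0 ≤ B := le_trans (abs_nonneg _) h1
      have h3 : |Q ((1 / 2) ^ i) - 2 * 4 ^ (m + 1) * Q ((1 / 2) ^ (i + 1))| ≤
          (3 * (4 ^ (m + 1) - 1)) * B := by
        refine (abs_sub _ _).trans ?_
        rw [abs_mul, abs_of_nonneg (by positivity : (0 : ℝ) ≤ 2 * 4 ^ (m + 1))]
        nlinarith
      have h5 := h.trans (mul_le_mul_of_nonneg_left h3 (by positivity))
      have h6 : |c 0| * (4 ^ (m + 1) - 1) ≤ (3 ^ (m + 1) * B) * (4 ^ (m + 1) - 1) := by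
        refine h5.trans (le_of_eq ?_)
        ring
      exact le_of_mul_le_mul_right h6 (by linarith)
    rcases le_total |Q ((1 / 2) ^ i)| |Q ((1 / 2) ^ (i + 1))| with h1 | h1
    · exact ⟨i + 1, by omega, hle _ h1 le_rfl⟩
    · exact ⟨i, by omega, hle _ le_rfl h1⟩

/-- The odd part of a polynomial. -/
theorem sum_sub_sum_neg (a : ℕ → ℝ) (t : ℝ) (K : ℕ) :
    ∑ j ∈ Finset.range K, a j * t ^ j - ∑ j ∈ Finset.range K, a j * (-t) ^ j =
      2 * ∑ j ∈ Finset.range (K / 2), a (2 * j + 1) * t ^ (2 * j + 1) := by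
  induction K with
  | zero => simp
  | succ K ih =>
    rw [Finset.sum_range_succ, Finset.sum_range_succ, add_sub_add_comm, ih]
    rcases Nat.even_or_odd' K with ⟨i, rfl | rfl⟩
    · rw [show (2 * i + 1) / 2 = i by omega, show 2 * i / 2 = i by omega,
        Even.neg_pow (even_two_mul i)]
      ring
    · rw [show (2 * i + 1 + 1) / 2 = i + 1 by omega, show (2 * i + 1) / 2 = i by omega,
        Finset.sum_range_succ, Odd.neg_pow (odd_two_mul_add_one i)]
      ring

/-- The linear coefficient of a polynomial is bounded by its values at the nodes. -/
theorem exists_scaleNode {k : ℕ} (hk : 1 ≤ k) (p : Polynomial ℝ) (hp : p.natDegree ≤ k) :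
    ∃ c < 2 * k, |p.coeff 1| ≤ √3 ^ (k - 1) * |p.eval (scaleNode c)| := by
  obtain ⟨i, hi, h⟩ := exists_node_odd ((k + 1) / 2 - 1) fun j => p.coeff (2 * j + 1)
  have hm : (k + 1) / 2 - 1 + 1 = (k + 1) / 2 := by omega
  rw [hm] at hi h
  have hev : ∀ t, p.eval t = ∑ j ∈ Finset.range (k + 1), p.coeff j * t ^ j := fun t =>
    Polynomial.eval_eq_sum_range' (by omega) t
  have hodd := sum_sub_sum_neg p.coeff ((1 / 2) ^ i) (k + 1)
  rw [← hev, ← hev] at hodd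
  have h3 : (3 : ℝ) ^ ((k + 1) / 2 - 1) ≤ √3 ^ (k - 1) := by
    have h1 : (1 : ℝ) ≤ √3 := Real.one_le_sqrt.2 (by norm_num)
    calc (3 : ℝ) ^ ((k + 1) / 2 - 1) = √3 ^ (2 * ((k + 1) / 2 - 1)) := by
          rw [pow_mul, Real.sq_sqrt (by norm_num)]
      _ ≤ _ := pow_le_pow_right₀ h1 (by omega)
  obtain ⟨n1, n2⟩ := scaleNode_two_mul i
  have hle : ∀ B, |p.eval ((1 / 2) ^ i)| ≤ B → |p.eval (-(1 / 2) ^ i)| ≤ B →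
      |p.coeff 1| ≤ √3 ^ (k - 1) * B := by
    intro B h1 h2
    refine h.trans (mul_le_mul h3 ?_ (abs_nonneg _) (by positivity))
    have := abs_sub (p.eval ((1 / 2) ^ i)) (p.eval (-(1 / 2) ^ i))
    rw [hodd, abs_mul, abs_two] at this
    linarith
  rcases le_total |p.eval ((1 / 2) ^ i)| |p.eval (-(1 / 2) ^ i)| with h1 | h1
  · exact ⟨2 * i + 1, by omega, by rw [n2]; exact hle _ h1 le_rfl⟩
  · exact ⟨2 * i, by omega, by rw [n1]; exact hle _ le_rfl h1⟩

open Polynomial in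
/-- Along the segment `y + t s` a polynomial that is affine in each variable has the directional
derivative `∑_w s_w ∂_w f(y)` as its linear coefficient, so it is large at one of the nodes. -/
theorem exists_scaleNode_multilinear {ι : Type*} (I : Finset ι) (S : ι → Finset ℕ) (g : ι → ℝ)
    {k : ℕ} (hk : 1 ≤ k) (hS : ∀ i ∈ I, (S i).card ≤ k) (y s : ℕ → ℝ) : ∃ c < 2 * k,
    |∑ i ∈ I, g i * ∑ w ∈ S i, s w * ∏ v ∈ (S i).erase w, y v| ≤
      √3 ^ (k - 1) * |∑ i ∈ I, g i * ∏ w ∈ S i, (y w + scaleNode c * s w)| := by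
  classical
  let p : ℝ[X] := ∑ i ∈ I, C (g i) * ∏ w ∈ S i, (C (y w) + X * C (s w))
  have hdeg : p.natDegree ≤ k := by
    refine natDegree_sum_le_of_forall_le _ _ fun i hi => ?_
    refine (natDegree_C_mul_le _ _).trans ((natDegree_prod_le _ _).trans ?_)
    refine le_trans (Finset.sum_le_card_nsmul _ _ 1 fun w _ => ?_) (by simpa using hS i hi)
    compute_degree
  have hev : ∀ t, p.eval t = ∑ i ∈ I, g i * ∏ w ∈ S i, (y w + t * s w) := fun t => by
    simp [p, eval_finsetSum, eval_prod, mul_comm t]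
  have hco : p.coeff 1 = ∑ i ∈ I, g i * ∑ w ∈ S i, s w * ∏ v ∈ (S i).erase w, y v := by
    have h1 : p.coeff 1 = (derivative p).eval 0 := by
      rw [← coeff_zero_eq_eval_zero, coeff_derivative]
      simp
    rw [h1]
    simp only [p, derivative_sum, derivative_C_mul, derivative_prod_finset, eval_finsetSum,
      eval_mul, eval_C, eval_prod]
    refine Finset.sum_congr rfl fun i _ => ?_
    congr 1
    refine Finset.sum_congr rfl fun w _ => ?_
    simp only [derivative_add, derivative_C, derivative_mul, derivative_X, mul_zero, one_mul,
      eval_add, eval_mul, eval_C, eval_X, zero_mul, add_zero, zero_add]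
    ring
  obtain ⟨c, hc, h⟩ := exists_scaleNode hk p hdeg
  exact ⟨c, hc, by rw [hco, hev] at h; exact h⟩

/-! ### Tries -/

/-- A forest that stores sets of variables below `N`. The nodes are the numbers below `C`, and
`0, …, N - 1` are the roots. A path from the root `v` reads a set in decreasing order; `sym x` is
the last variable read on the way to the node `x` (with the convention `sym v = N` for a root), and
`own x`, `lab x` are the root and the set of variables of the path to `x`. -/
structure IsTrie (N C : ℕ) (par sym own : ℕ → ℕ) (lab : ℕ → Finset ℕ) : Prop where
  le : N ≤ C
  sym_root : ∀ x < N, sym x = N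
  own_root : ∀ x < N, own x = x
  lab_root : ∀ x < N, lab x = ∅
  par_lt : ∀ x, N ≤ x → x < C → par x < x
  sym_lt : ∀ x, N ≤ x → x < C → sym x < N
  sym_lt_par : ∀ x, N ≤ x → x < C → sym x < sym (par x)
  own_par : ∀ x, N ≤ x → x < C → own x = own (par x)
  lab_par : ∀ x, N ≤ x → x < C → lab x = insert (sym x) (lab (par x))
  inj : ∀ x x', N ≤ x → x < C → N ≤ x' → x' < C → par x = par x' → sym x = sym x' → x = x'

namespace IsTrie

variable {N C : ℕ} {par sym own : ℕ → ℕ} {lab : ℕ → Finset ℕ}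

theorem sym_le_of_mem (h : IsTrie N C par sym own lab) {x : ℕ} (hx : x < C) :
    ∀ w ∈ lab x, sym x ≤ w := by
  induction x using Nat.strong_induction_on with
  | _ x ih =>
    intro w hw
    rcases lt_or_ge x N with hN | hN
    · rw [h.lab_root x hN] at hw
      simp at hw
    · have hp := h.par_lt x hN hx
      rw [h.lab_par x hN hx, Finset.mem_insert] at hw
      rcases hw with rfl | hw
      · exact le_rfl
      · exact (h.sym_lt_par x hN hx).le.trans (ih _ hp (hp.trans hx) w hw)

theorem sym_notMem_par (h : IsTrie N C par sym own lab) {x : ℕ} (hN : N ≤ x) (hx : x < C) :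
    sym x ∉ lab (par x) := fun hm =>
  absurd (h.sym_le_of_mem ((h.par_lt x hN hx).trans hx) _ hm) (h.sym_lt_par x hN hx).not_ge

theorem own_lt (h : IsTrie N C par sym own lab) {x : ℕ} (hx : x < C) : own x < N := by
  induction x using Nat.strong_induction_on with
  | _ x ih =>
    rcases lt_or_ge x N with hN | hN
    · rwa [h.own_root x hN]
    · have hp := h.par_lt x hN hx
      rw [h.own_par x hN hx]
      exact ih _ hp (hp.trans hx)

/-- A node is determined by its root and its set. -/
theorem ext_node (h : IsTrie N C par sym own lab) {x x' : ℕ} (hx : x < C) (hx' : x' < C)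
    (ho : own x = own x') (hl : lab x = lab x') : x = x' := by
  induction x using Nat.strong_induction_on generalizing x' with
  | _ x ih =>
    have aux : ∀ x, N ≤ x → x < C → lab x ≠ ∅ := fun x hN hx => by
      rw [h.lab_par x hN hx]
      exact Finset.insert_ne_empty _ _
    rcases lt_or_ge x N with hN | hN <;> rcases lt_or_ge x' N with hN' | hN'
    · rwa [h.own_root x hN, h.own_root x' hN'] at ho
    · exact absurd (hl.symm.trans (h.lab_root x hN)) (aux x' hN' hx')
    · exact absurd (hl.trans (h.lab_root x' hN')) (aux x hN hx)
    · have hp := h.par_lt x hN hx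
      have hp' := h.par_lt x' hN' hx'
      have e : sym x = sym x' := by
        apply le_antisymm
        · apply h.sym_le_of_mem hx
          rw [hl, h.lab_par x' hN' hx']
          exact Finset.mem_insert_self _ _
        · apply h.sym_le_of_mem hx'
          rw [← hl, h.lab_par x hN hx]
          exact Finset.mem_insert_self _ _
      refine h.inj x x' hN hx hN' hx' (ih _ hp (hp.trans hx) (hp'.trans hx') ?_ ?_) e
      · rw [← h.own_par x hN hx, ← h.own_par x' hN' hx', ho]
      · rw [h.lab_par x hN hx, h.lab_par x' hN' hx', e] at hl
        have n1 := h.sym_notMem_par hN hx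
        have n2 := h.sym_notMem_par hN' hx'
        rw [e] at n1
        rw [← Finset.erase_insert n1, hl, Finset.erase_insert n2]

end IsTrie

/-! ### The potential function -/

/-- The nodes of the tree `v` whose variables are all at least `j`. They carry the coefficients of a
polynomial once the variables below `j` have been given values. -/
def liveNodes (C : ℕ) (sym own : ℕ → ℕ) (j v : ℕ) : Finset ℕ :=
  (Finset.range C).filter fun x => j ≤ sym x ∧ own x = v

/-- The nodes of the tree `v` with symbol `j`. -/
def symNodes (C : ℕ) (sym own : ℕ → ℕ) (j v : ℕ) : Finset ℕ :=
  (Finset.range C).filter fun x => sym x = j ∧ own x = v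

/-- The nodes with symbol `j`. -/
def levelNodes (C : ℕ) (sym : ℕ → ℕ) (j : ℕ) : Finset ℕ :=
  (Finset.range C).filter fun x => sym x = j

/-- The coefficients after the variable `j` has been given the value `y`: those of the nodes with
symbol `j` have moved to their parents, with a factor `y`. -/
def substitute (C : ℕ) (par sym : ℕ → ℕ) (j : ℕ) (y : ℝ) (τ : ℕ → ℝ) (p : ℕ) : ℝ :=
  τ p + y * ∑ x ∈ levelNodes C sym j with par x = p, τ x

section Potential

variable {N C : ℕ} {par sym own : ℕ → ℕ} {lab : ℕ → Finset ℕ}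

theorem sum_liveNodes_eq_add (F : ℕ → ℝ) (j v : ℕ) :
    ∑ x ∈ liveNodes C sym own j v, F x =
      ∑ x ∈ liveNodes C sym own (j + 1) v, F x + ∑ x ∈ symNodes C sym own j v, F x := by
  rw [← Finset.sum_union]
  · refine Finset.sum_congr ?_ fun _ _ => rfl
    ext x
    simp only [liveNodes, symNodes, Finset.mem_filter, Finset.mem_union, Finset.mem_range]
    omega
  · rw [Finset.disjoint_left]
    intro x hx hx'
    simp only [liveNodes, symNodes, Finset.mem_filter] at hx hx'
    omega

theorem IsTrie.of_mem_symNodes (h : IsTrie N C par sym own lab) {j v x : ℕ} (hj : j < N)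
    (hx : x ∈ symNodes C sym own j v) : N ≤ x ∧ x < C ∧ sym x = j ∧ own x = v := by
  simp only [symNodes, Finset.mem_filter, Finset.mem_range] at hx
  refine ⟨?_, hx.1, hx.2.1, hx.2.2⟩
  by_contra hN
  have := h.sym_root x (not_le.1 hN)
  omega

theorem IsTrie.par_mem_liveNodes (h : IsTrie N C par sym own lab) {j v x : ℕ} (hj : j < N)
    (hx : x ∈ symNodes C sym own j v) : par x ∈ liveNodes C sym own (j + 1) v := by
  obtain ⟨hN, hC, hs, ho⟩ := h.of_mem_symNodes hj hx
  simp only [liveNodes, Finset.mem_filter, Finset.mem_range]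
  refine ⟨(h.par_lt x hN hC).trans hC, ?_, ?_⟩
  · have := h.sym_lt_par x hN hC
    omega
  · rw [← h.own_par x hN hC, ho]

theorem IsTrie.level_eq (h : IsTrie N C par sym own lab) {j v p : ℕ} (hj : j < N)
    (hp : p ∈ liveNodes C sym own (j + 1) v) :
    (levelNodes C sym j).filter (fun x => par x = p) =
      (symNodes C sym own j v).filter fun x => par x = p := by
  ext x
  simp only [levelNodes, symNodes, liveNodes, Finset.mem_filter, Finset.mem_range] at hp ⊢
  constructor
  · rintro ⟨⟨hC, hs⟩, rfl⟩
    refine ⟨⟨hC, hs, ?_⟩, rfl⟩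
    have hN : N ≤ x := by
      by_contra hN
      have := h.sym_root x (not_le.1 hN)
      omega
    rw [h.own_par x hN hC, hp.2.2]
  · rintro ⟨⟨hC, hs, -⟩, rfl⟩
    exact ⟨⟨hC, hs⟩, rfl⟩

/-- The nodes with symbol `j` are distributed over the parents. -/
theorem IsTrie.sum_mul_children (h : IsTrie N C par sym own lab) {j v : ℕ} (hj : j < N)
    (F τ : ℕ → ℝ) :
    ∑ p ∈ liveNodes C sym own (j + 1) v,
      F p * ∑ x ∈ levelNodes C sym j with par x = p, τ x =
      ∑ x ∈ symNodes C sym own j v, F (par x) * τ x := by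
  rw [← Finset.sum_fiberwise_of_maps_to (fun x hx => h.par_mem_liveNodes hj hx)]
  refine Finset.sum_congr rfl fun p hp => ?_
  rw [h.level_eq hj hp, Finset.mul_sum]
  exact Finset.sum_congr rfl fun x hx => by rw [(Finset.mem_filter.1 hx).2]

/-- A node has at most one child with symbol `j`. -/
theorem IsTrie.sq_sum_children (h : IsTrie N C par sym own lab) {j : ℕ} (hj : j < N)
    (τ : ℕ → ℝ) (p : ℕ) :
    (∑ x ∈ levelNodes C sym j with par x = p, τ x) ^ 2 =
      ∑ x ∈ levelNodes C sym j with par x = p, τ x ^ 2 := by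
  rcases Finset.eq_empty_or_nonempty ((levelNodes C sym j).filter fun x => par x = p) with
    h0 | ⟨x, hx⟩
  · rw [h0]; simp
  · have : (levelNodes C sym j).filter (fun x => par x = p) = {x} := by
      rw [Finset.eq_singleton_iff_unique_mem]
      refine ⟨hx, fun x' hx' => ?_⟩
      simp only [levelNodes, Finset.mem_filter, Finset.mem_range] at hx hx'
      have aux : ∀ x, sym x = j → N ≤ x := fun x hs => by
        by_contra hN
        have := h.sym_root x (not_le.1 hN)
        omega
      exact h.inj _ _ (aux _ hx'.1.2) hx'.1.1 (aux _ hx.1.2) hx.1.1 (hx'.2.trans hx.2.symm)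
        (hx'.1.2.trans hx.1.2.symm)
    rw [this]; simp

/-- The effect of a substitution on a weighted sum of squares. -/
theorem IsTrie.sum_sq_substitute (h : IsTrie N C par sym own lab) {j v : ℕ} (hj : j < N)
    (F τ : ℕ → ℝ) (y : ℝ) :
    ∑ p ∈ liveNodes C sym own (j + 1) v, F p * substitute C par sym j y τ p ^ 2 =
      ∑ p ∈ liveNodes C sym own (j + 1) v, F p * τ p ^ 2 +
      2 * y * ∑ x ∈ symNodes C sym own j v, F (par x) * τ (par x) * τ x +
      y ^ 2 * ∑ x ∈ symNodes C sym own j v, F (par x) * τ x ^ 2 := by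
  rw [← h.sum_mul_children hj (fun p => F p * τ p) τ,
    ← h.sum_mul_children hj F fun x => τ x ^ 2, Finset.mul_sum, Finset.mul_sum,
    ← Finset.sum_add_distrib, ← Finset.sum_add_distrib]
  refine Finset.sum_congr rfl fun p _ => ?_
  rw [← h.sq_sum_children hj τ p, substitute]
  ring

/-- The squared norm of the polynomial of the tree `v`. -/
def normSq (C : ℕ) (sym own : ℕ → ℕ) (j : ℕ) (τ : ℕ → ℝ) (v : ℕ) : ℝ :=
  ∑ x ∈ liveNodes C sym own j v, τ x ^ 2

/-- The squared norm of the polynomial of the tree `v`, with weight `3 ^ e` in degree `e`. -/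
def weightedNormSq (C : ℕ) (sym own : ℕ → ℕ) (lab : ℕ → Finset ℕ) (j : ℕ) (τ : ℕ → ℝ)
    (v : ℕ) : ℝ :=
  ∑ x ∈ liveNodes C sym own j v, 3 ^ (lab x).card * τ x ^ 2

/-- The weight in which the node `x` enters the sums over a level: `3 ^ e` for a parent of
degree `e`. -/
def parWeight (par : ℕ → ℕ) (lab : ℕ → Finset ℕ) (x : ℕ) : ℝ := 3 ^ (lab (par x)).card

theorem IsTrie.normSq_substitute (h : IsTrie N C par sym own lab) {j v : ℕ} (hj : j < N)
    (τ : ℕ → ℝ) {y : ℝ} (hy : y ^ 2 = 1) :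
    normSq C sym own (j + 1) (substitute C par sym j y τ) v = normSq C sym own j τ v +
      2 * y * ∑ x ∈ symNodes C sym own j v, τ (par x) * τ x := by
  have h1 := h.sum_sq_substitute (v := v) hj (fun _ => 1) τ y
  simp only [one_mul] at h1
  unfold normSq
  rw [h1, sum_liveNodes_eq_add _ j, hy]
  ring

theorem IsTrie.weightedNormSq_eq (h : IsTrie N C par sym own lab) {j v : ℕ} (hj : j < N)
    (τ : ℕ → ℝ) :
    weightedNormSq C sym own lab j τ v = weightedNormSq C sym own lab (j + 1) τ v +
      3 * ∑ x ∈ symNodes C sym own j v, parWeight par lab x * τ x ^ 2 := by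
  unfold weightedNormSq
  rw [sum_liveNodes_eq_add _ j, Finset.mul_sum]
  congr 1
  refine Finset.sum_congr rfl fun x hx => ?_
  obtain ⟨hN, hC, hs, ho⟩ := h.of_mem_symNodes hj hx
  rw [parWeight, h.lab_par x hN hC, Finset.card_insert_of_notMem (h.sym_notMem_par hN hC)]
  ring

theorem IsTrie.weightedNormSq_substitute (h : IsTrie N C par sym own lab) {j v : ℕ} (hj : j < N)
    (τ : ℕ → ℝ) {y : ℝ} (hy : y ^ 2 = 1) :
    weightedNormSq C sym own lab (j + 1) (substitute C par sym j y τ) v =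
      weightedNormSq C sym own lab j τ v -
      2 * ∑ x ∈ symNodes C sym own j v, parWeight par lab x * τ x ^ 2 +
      2 * y * ∑ x ∈ symNodes C sym own j v, parWeight par lab x * τ (par x) * τ x := by
  rw [h.weightedNormSq_eq hj]
  unfold weightedNormSq
  rw [h.sum_sq_substitute hj, hy]
  unfold parWeight
  ring

/-- The Cauchy–Schwarz inequality between the coefficients of a level and those of the parents. -/
theorem IsTrie.sq_sum_le (h : IsTrie N C par sym own lab) {j v : ℕ} (hj : j < N) (τ : ℕ → ℝ) :
    (∑ x ∈ symNodes C sym own j v, parWeight par lab x * τ (par x) * τ x) ^ 2 ≤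
      weightedNormSq C sym own lab (j + 1) τ v *
        ∑ x ∈ symNodes C sym own j v, parWeight par lab x * τ x ^ 2 := by
  have hquad : ∀ y : ℝ, 0 ≤
      (∑ x ∈ symNodes C sym own j v, parWeight par lab x * τ x ^ 2) * (y * y) +
      (2 * ∑ x ∈ symNodes C sym own j v, parWeight par lab x * τ (par x) * τ x) * y +
      weightedNormSq C sym own lab (j + 1) τ v := fun y => by
    have h1 := h.sum_sq_substitute (v := v) hj (fun p => 3 ^ (lab p).card) τ y
    have h2 : 0 ≤ ∑ p ∈ liveNodes C sym own (j + 1) v,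
        3 ^ (lab p).card * substitute C par sym j y τ p ^ 2 :=
      Finset.sum_nonneg fun p _ => by positivity
    rw [h1] at h2
    unfold weightedNormSq parWeight
    linarith
  have := discrim_le_zero hquad
  unfold discrim at this
  linarith

/-- The potential. When the variables are given independent random signs, the expectation of the
squared norm does not change, and that of the square of the weighted norm does not increase, so that
of the potential does not decrease. Trees with `b v = 0` contribute nothing, by the convention for
division by zero. -/
def potential (N C : ℕ) (sym own : ℕ → ℕ) (lab : ℕ → Finset ℕ) (b : ℕ → ℝ) (μ : ℝ) (j : ℕ)
    (τ : ℕ → ℝ) : ℝ :=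
  ∑ v ∈ Finset.range N,
    (normSq C sym own j τ v / b v - μ * weightedNormSq C sym own lab j τ v ^ 2 / b v ^ 3)

/-- The part of the change of the potential that is odd in the sign given to the variable `j`, up to
a factor `2`. -/
def potentialSlope (N C : ℕ) (par sym own : ℕ → ℕ) (lab : ℕ → Finset ℕ) (b : ℕ → ℝ) (μ : ℝ)
    (j : ℕ) (τ : ℕ → ℝ) : ℝ :=
  ∑ v ∈ Finset.range N, ((∑ x ∈ symNodes C sym own j v, τ (par x) * τ x) / b v -
    2 * μ * (weightedNormSq C sym own lab j τ v -
      2 * ∑ x ∈ symNodes C sym own j v, parWeight par lab x * τ x ^ 2) *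
      (∑ x ∈ symNodes C sym own j v, parWeight par lab x * τ (par x) * τ x) / b v ^ 3)

/-- The potential does not decrease if the sign is that of the slope. The even part of the change is
nonnegative by the Cauchy–Schwarz inequality: the factor `3` in the weights leaves room for it. -/
theorem IsTrie.potential_le (h : IsTrie N C par sym own lab) {j : ℕ} (hj : j < N) {b : ℕ → ℝ}
    (hb : ∀ v, 0 ≤ b v) {μ : ℝ} (hμ : 0 ≤ μ) (τ : ℕ → ℝ) {y : ℝ} (hy : y ^ 2 = 1)
    (hD : 0 ≤ y * potentialSlope N C par sym own lab b μ j τ) :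
    potential N C sym own lab b μ j τ ≤
      potential N C sym own lab b μ (j + 1) (substitute C par sym j y τ) := by
  rw [← sub_nonneg]
  have key : 2 * (y * potentialSlope N C par sym own lab b μ j τ) ≤
      potential N C sym own lab b μ (j + 1) (substitute C par sym j y τ) -
      potential N C sym own lab b μ j τ := by
    unfold potential potentialSlope
    rw [← Finset.sum_sub_distrib, ← mul_assoc, Finset.mul_sum]
    refine Finset.sum_le_sum fun v _ => ?_
    have hcs := h.sq_sum_le (v := v) hj τ
    have hU : 0 ≤ weightedNormSq C sym own lab (j + 1) τ v :=
      Finset.sum_nonneg fun x _ => by positivity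
    have hW : 0 ≤ ∑ x ∈ symNodes C sym own j v, parWeight par lab x * τ x ^ 2 :=
      Finset.sum_nonneg fun x _ => by unfold parWeight; positivity
    rw [h.normSq_substitute hj τ hy, h.weightedNormSq_substitute hj τ hy,
      h.weightedNormSq_eq hj τ]
    generalize weightedNormSq C sym own lab (j + 1) τ v = U at *
    generalize ∑ x ∈ symNodes C sym own j v, parWeight par lab x * τ x ^ 2 = W at *
    generalize ∑ x ∈ symNodes C sym own j v, parWeight par lab x * τ (par x) * τ x = c at *
    generalize ∑ x ∈ symNodes C sym own j v, τ (par x) * τ x = e at *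
    generalize normSq C sym own j τ v = n at *
    have h3 : 0 ≤ μ / b v ^ 3 := div_nonneg hμ (pow_nonneg (hb v) _)
    have h4 : 0 ≤ μ / b v ^ 3 * (4 * (U * W) + 8 * W ^ 2 - 4 * c ^ 2) :=
      mul_nonneg h3 (by nlinarith)
    have e1 : (n + 2 * y * e) / b v - μ * (U + 3 * W - 2 * W + 2 * y * c) ^ 2 / b v ^ 3 -
        (n / b v - μ * (U + 3 * W) ^ 2 / b v ^ 3) -
        2 * y * (e / b v - 2 * μ * (U + 3 * W - 2 * W) * c / b v ^ 3) =
        μ / b v ^ 3 * (4 * (U * W) + 8 * W ^ 2 - 4 * (y ^ 2 * c ^ 2)) := by ring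
    rw [hy, one_mul] at e1
    linarith
  linarith

/-- The value of the polynomial of the tree `v` at `z`. -/
def treeValue (C : ℕ) (sym own : ℕ → ℕ) (lab : ℕ → Finset ℕ) (j : ℕ) (τ : ℕ → ℝ) (z : ℕ → ℝ)
    (v : ℕ) : ℝ :=
  ∑ x ∈ liveNodes C sym own j v, τ x * ∏ w ∈ lab x, z w

theorem IsTrie.treeValue_substitute (h : IsTrie N C par sym own lab) {j v : ℕ} (hj : j < N)
    (τ z : ℕ → ℝ) :
    treeValue C sym own lab (j + 1) (substitute C par sym j (z j) τ) z v =
      treeValue C sym own lab j τ z v := by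
  unfold treeValue
  rw [sum_liveNodes_eq_add _ j]
  have h1 : ∑ x ∈ symNodes C sym own j v, τ x * ∏ w ∈ lab x, z w =
      ∑ p ∈ liveNodes C sym own (j + 1) v, (z j * ∏ w ∈ lab p, z w) *
        ∑ x ∈ levelNodes C sym j with par x = p, τ x := by
    rw [h.sum_mul_children hj (fun p => z j * ∏ w ∈ lab p, z w)]
    refine Finset.sum_congr rfl fun x hx => ?_
    obtain ⟨hN, hC, hs, ho⟩ := h.of_mem_symNodes hj hx
    rw [h.lab_par x hN hC, Finset.prod_insert (h.sym_notMem_par hN hC), hs]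
    ring
  rw [h1, ← Finset.sum_add_distrib]
  refine Finset.sum_congr rfl fun p _ => ?_
  unfold substitute
  ring

theorem IsTrie.liveNodes_last (h : IsTrie N C par sym own lab) {v : ℕ} (hv : v < N) :
    liveNodes C sym own N v = {v} := by
  ext x
  simp only [liveNodes, Finset.mem_filter, Finset.mem_range, Finset.mem_singleton]
  constructor
  · rintro ⟨hC, hs, ho⟩
    have hN : x < N := by
      by_contra hN
      have := h.sym_lt x (not_lt.1 hN) hC
      omega
    rw [← ho, h.own_root x hN]
  · rintro rfl
    exact ⟨hv.trans_le h.le, (h.sym_root x hv).ge, h.own_root x hv⟩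

theorem IsTrie.liveNodes_zero {v : ℕ} :
    liveNodes C sym own 0 v = (Finset.range C).filter fun x => own x = v := by
  simp [liveNodes]

/-- The quartic `z - z³ / (3 r²)` is at most `2 r / 3`, so a lower bound for the potential at the end
is a lower bound for the sum of the absolute values. -/
theorem IsTrie.sum_abs_ge (h : IsTrie N C par sym own lab) {b : ℕ → ℝ} (hb : ∀ v, 0 ≤ b v)
    {r : ℝ} (hr : 0 < r) {τ₀ τ : ℕ → ℝ}
    (h0 : ∀ v < N, normSq C sym own 0 τ₀ v = b v ^ 2)
    (hw : ∀ v < N, weightedNormSq C sym own lab 0 τ₀ v ≤ r * b v ^ 2)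
    (hpot : potential N C sym own lab b (1 / (3 * r ^ 2)) 0 τ₀ ≤
      potential N C sym own lab b (1 / (3 * r ^ 2)) N τ) (hz : ∀ v < N, b v = 0 → τ v = 0) :
    ∑ v ∈ Finset.range N, b v ≤ r * ∑ v ∈ Finset.range N, |τ v| := by
  have h1 : 2 / 3 * ∑ v ∈ Finset.range N, b v ≤
      potential N C sym own lab b (1 / (3 * r ^ 2)) 0 τ₀ := by
    unfold potential
    rw [Finset.mul_sum]
    refine Finset.sum_le_sum fun v hv => ?_
    have hv := Finset.mem_range.1 hv
    rw [h0 v hv]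
    rcases (hb v).eq_or_lt with hbv | hbv
    · -- The summand is zero, being a difference of quotients with denominator `0`.
      rw [← hbv]; simp
    · have hnn : 0 ≤ weightedNormSq C sym own lab 0 τ₀ v :=
        Finset.sum_nonneg fun x _ => by positivity
      have h2 : weightedNormSq C sym own lab 0 τ₀ v ^ 2 ≤ (r * b v ^ 2) ^ 2 :=
        pow_le_pow_left₀ hnn (hw v hv) 2
      have h3 : 1 / (3 * r ^ 2) * weightedNormSq C sym own lab 0 τ₀ v ^ 2 / b v ^ 3 ≤
          1 / 3 * b v := by
        rw [div_le_iff₀ (by positivity), one_div_mul_eq_div, div_le_iff₀ (by positivity)]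
        refine h2.trans (le_of_eq (by ring))
      have h4 : b v ^ 2 / b v = b v := by field_simp
      rw [h4]
      linarith
  have h2 : potential N C sym own lab b (1 / (3 * r ^ 2)) N τ ≤
      2 / 3 * (r * ∑ v ∈ Finset.range N, |τ v|) := by
    unfold potential
    rw [Finset.mul_sum, Finset.mul_sum]
    refine Finset.sum_le_sum fun v hv => ?_
    have hv := Finset.mem_range.1 hv
    have e1 : normSq C sym own N τ v = τ v ^ 2 := by
      rw [normSq, h.liveNodes_last hv, Finset.sum_singleton]
    have e2 : weightedNormSq C sym own lab N τ v = τ v ^ 2 := by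
      rw [weightedNormSq, h.liveNodes_last hv, Finset.sum_singleton, h.lab_root v hv]
      simp
    rw [e1, e2, ← sq_abs]
    rcases (hb v).eq_or_lt with hbv | hbv
    · rw [hz v hv hbv.symm]; simp
    · have ht := abs_nonneg (τ v)
      generalize |τ v| = t at *
      generalize b v = β at *
      have h3 : 0 ≤ (t - r * β) ^ 2 * (t + 2 * (r * β)) := by positivity
      have e3 : t ^ 2 / β - 1 / (3 * r ^ 2) * (t ^ 2) ^ 2 / β ^ 3 =
          (3 * r ^ 2 * β ^ 2 * t - t ^ 3) * t / (3 * r ^ 2 * β ^ 3) := by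
        field_simp
      rw [e3, div_le_iff₀ (by positivity)]
      have h4 : (3 * r ^ 2 * β ^ 2 * t - t ^ 3) ≤ 2 * (r * β) ^ 3 := by nlinarith
      calc (3 * r ^ 2 * β ^ 2 * t - t ^ 3) * t ≤ 2 * (r * β) ^ 3 * t :=
            mul_le_mul_of_nonneg_right h4 ht
        _ = _ := by ring
  linarith

end Potential

/-! ### A trie of the derivatives of a polynomial -/

/-- The coefficients `τ` on the trie are those of the polynomials
`∑_{i < m, v ∈ D_i} g_i ∏_{w ∈ S_i \ {v}} z_w`, where `D_i ⊆ S_i` is the set of the variables with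
respect to which the term `i` has been differentiated. -/
structure StoresDerivatives (C : ℕ) (own : ℕ → ℕ) (lab : ℕ → Finset ℕ) (m : ℕ)
    (D S : ℕ → Finset ℕ) (g τ : ℕ → ℝ) : Prop where
  cover : ∀ i < m, ∀ v ∈ D i, ∃ x < C, own x = v ∧ lab x = (S i).erase v
  val : ∀ x < C, τ x = ∑ i ∈ Finset.range m with own x ∈ D i ∧ (S i).erase (own x) = lab x, g i

section Derivatives

variable {N C : ℕ} {par sym own : ℕ → ℕ} {lab : ℕ → Finset ℕ} {m : ℕ} {S : ℕ → Finset ℕ}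
  {g τ : ℕ → ℝ}

theorem erase_injOn {a b : Finset ℕ} {v : ℕ} (ha : v ∈ a) (hb : v ∈ b)
    (h : a.erase v = b.erase v) : a = b := by
  rw [← Finset.insert_erase ha, ← Finset.insert_erase hb, h]

/-- Sums over the nodes of a tree are sums over the terms that contain its variable. -/
theorem StoresDerivatives.sum_eq (hs : StoresDerivatives C own lab m S S g τ)
    (h : IsTrie N C par sym own lab) (hS : ∀ i < m, ∀ i' < m, S i = S i' → i = i')
    (φ : ℝ → Finset ℕ → ℝ) (hφ : ∀ Q, φ 0 Q = 0) (v : ℕ) :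
    ∑ x ∈ liveNodes C sym own 0 v, φ (τ x) (lab x) =
      ∑ i ∈ Finset.range m with v ∈ S i, φ (g i) ((S i).erase v) := by
  classical
  rw [IsTrie.liveNodes_zero]
  have hval : ∀ x < C, ∀ i < m, own x ∈ S i → (S i).erase (own x) = lab x → τ x = g i := by
    intro x hx i hi h1 h2
    rw [hs.val x hx, Finset.sum_eq_single_of_mem i]
    · simpa using ⟨hi, h1, h2⟩
    · intro i' hi' hne
      simp only [Finset.mem_filter, Finset.mem_range] at hi'
      exact absurd (hS i' hi'.1 i hi (erase_injOn hi'.2.1 h1 (hi'.2.2.trans h2.symm))) hne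
  symm
  have ex : ∀ i, ∃ x, i < m → v ∈ S i → x < C ∧ own x = v ∧ lab x = (S i).erase v := by
    intro i
    by_cases hi : i < m ∧ v ∈ S i
    · obtain ⟨x, hx⟩ := hs.cover i hi.1 v hi.2
      exact ⟨x, fun _ _ => hx⟩
    · exact ⟨0, fun h1 h2 => absurd ⟨h1, h2⟩ hi⟩
  choose f hf using ex
  refine Finset.sum_of_injOn f ?_ ?_ ?_ ?_
  · intro i hi i' hi' he
    simp only [Finset.coe_filter, Finset.mem_range, Set.mem_ofPred_eq] at hi hi'
    have a := hf i hi.1 hi.2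
    have a' := hf i' hi'.1 hi'.2
    exact hS i hi.1 i' hi'.1 (erase_injOn hi.2 hi'.2 (by rw [← a.2.2, ← a'.2.2, he]))
  · intro i hi
    simp only [Finset.coe_filter, Finset.mem_range, Set.mem_ofPred_eq] at hi ⊢
    have a := hf i hi.1 hi.2
    exact ⟨a.1, a.2.1⟩
  · intro x hx hx'
    simp only [Finset.mem_filter, Finset.mem_range] at hx
    rw [hs.val x hx.1, Finset.sum_eq_zero, hφ]
    intro i hi
    simp only [Finset.mem_filter, Finset.mem_range] at hi
    rw [hx.2] at hi
    exfalso
    apply hx'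
    have a := hf i hi.1 hi.2.1
    refine ⟨i, by simpa using ⟨hi.1, hi.2.1⟩, ?_⟩
    exact h.ext_node a.1 hx.1 (a.2.1.trans hx.2.symm) (a.2.2.trans hi.2.2)
  · intro i hi
    simp only [Finset.mem_filter, Finset.mem_range] at hi
    have a := hf i hi.1 hi.2
    rw [a.2.2, hval (f i) a.1 i hi.1 (by rw [a.2.1]; exact hi.2) (by rw [a.2.1, a.2.2])]

theorem StoresDerivatives.normSq_eq (hs : StoresDerivatives C own lab m S S g τ)
    (h : IsTrie N C par sym own lab) (hS : ∀ i < m, ∀ i' < m, S i = S i' → i = i') (v : ℕ) :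
    normSq C sym own 0 τ v = ∑ i ∈ Finset.range m with v ∈ S i, g i ^ 2 :=
  hs.sum_eq h hS (fun t _ => t ^ 2) (by simp) v

theorem StoresDerivatives.weightedNormSq_eq (hs : StoresDerivatives C own lab m S S g τ)
    (h : IsTrie N C par sym own lab) (hS : ∀ i < m, ∀ i' < m, S i = S i' → i = i') (v : ℕ) :
    weightedNormSq C sym own lab 0 τ v =
      ∑ i ∈ Finset.range m with v ∈ S i, 3 ^ ((S i).card - 1) * g i ^ 2 := by
  refine (hs.sum_eq h hS (fun t Q => 3 ^ Q.card * t ^ 2) (by simp) v).trans ?_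
  refine Finset.sum_congr rfl fun i hi => ?_
  rw [Finset.card_erase_of_mem (Finset.mem_filter.1 hi).2]

theorem StoresDerivatives.treeValue_eq (hs : StoresDerivatives C own lab m S S g τ)
    (h : IsTrie N C par sym own lab) (hS : ∀ i < m, ∀ i' < m, S i = S i' → i = i') (z : ℕ → ℝ)
    (v : ℕ) : treeValue C sym own lab 0 τ z v =
      ∑ i ∈ Finset.range m with v ∈ S i, g i * ∏ w ∈ (S i).erase v, z w :=
  hs.sum_eq h hS (fun t Q => t * ∏ w ∈ Q, z w) (by simp) v

end Derivatives

/-! ### Running programs -/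

/-- The array `f` with the entry at `(i, j)` replaced by `v`. -/
def setEntry {β : Type*} (f : ℕ → ℕ → β) (i j : ℕ) (v : β) : ℕ → ℕ → β :=
  fun i' j' => if i' = i ∧ j' = j then v else f i' j'

theorem setEntry_apply {β : Type*} (f : ℕ → ℕ → β) (i j : ℕ) (v : β) (i' j' : ℕ) :
    setEntry f i j v i' j' = if i' = i ∧ j' = j then v else f i' j' := rfl

@[simp]
theorem MachineState.nat_writeNat (s : MachineState) (a i j v a' : ℕ) :
    (s.writeNat a i j v).nat a' = if a' = a then setEntry (s.nat a) i j v else s.nat a' := by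
  funext i' j'
  by_cases h : a' = a
  · subst h; simp [MachineState.writeNat, setEntry]
  · simp [MachineState.writeNat, h]

@[simp]
theorem MachineState.real_writeNat (s : MachineState) (a i j v : ℕ) :
    (s.writeNat a i j v).real = s.real := rfl

@[simp]
theorem MachineState.tape_writeNat (s : MachineState) (a i j v : ℕ) :
    (s.writeNat a i j v).tape = s.tape := rfl

@[simp]
theorem MachineState.real_writeReal (s : MachineState) (a i j : ℕ) (v : ℝ) (a' : ℕ) :
    (s.writeReal a i j v).real a' = if a' = a then setEntry (s.real a) i j v else s.real a' := by
  funext i' j'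
  by_cases h : a' = a
  · subst h; simp [MachineState.writeReal, setEntry]
  · simp [MachineState.writeReal, h]

@[simp]
theorem MachineState.nat_writeReal (s : MachineState) (a i j : ℕ) (v : ℝ) :
    (s.writeReal a i j v).nat = s.nat := rfl

@[simp]
theorem MachineState.tape_writeReal (s : MachineState) (a i j : ℕ) (v : ℝ) :
    (s.writeReal a i j v).tape = s.tape := rfl

@[simp]
theorem MachineState.nat_draw (s : MachineState) (a i j : ℕ) : (s.draw a i j).nat = s.nat := rfl

@[simp]
theorem MachineState.real_draw (s : MachineState) (a i j a' : ℕ) :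
    (s.draw a i j).real a' =
      if a' = a then setEntry (s.real a) i j (s.tape 0 : ℝ) else s.real a' :=
  s.real_writeReal a i j _ a'

@[simp]
theorem MachineState.tape_draw (s : MachineState) (a i j : ℕ) :
    (s.draw a i j).tape = fun m => s.tape (m + 1) := rfl

/-- `p`, started in `s`, halts after at most `T` operations in a configuration satisfying `Q`. -/
def Reaches (p : Program) (s : MachineState) (T : ℕ) (Q : MachineState → Prop) : Prop :=
  ∃ (t : ℕ) (s' : MachineState), Runs p s t s' ∧ t ≤ T ∧ Q s'

theorem Reaches.mono {p : Program} {s : MachineState} {T T' : ℕ} {Q Q' : MachineState → Prop}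
    (h : Reaches p s T Q) (hT : T ≤ T') (hQ : ∀ s', Q s' → Q' s') : Reaches p s T' Q' := by
  obtain ⟨t, s', hr, ht, hq⟩ := h
  exact ⟨t, s', hr, ht.trans hT, hQ _ hq⟩

theorem Reaches.seq {p q : Program} {s : MachineState} {T T' : ℕ} {Q R : MachineState → Prop}
    (h : Reaches p s T Q) (h' : ∀ s', Q s' → Reaches q s' T' R) :
    Reaches (.seq p q) s (T + T') R := by
  obtain ⟨t, s', hr, ht, hq⟩ := h
  obtain ⟨t', s'', hr', ht', hq'⟩ := h' s' hq
  exact ⟨t + t', s'', .seq hr hr', by omega, hq'⟩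

/-- The weakest precondition of a loop-free program. For a loop it is `False`: loops are treated by
`Reaches.forLoop`. -/
def Program.pre : Program → (MachineState → Prop) → MachineState → Prop
  | .skip, Q, s => Q s
  | .setNat a i j e, Q, s => Q (s.writeNat a (i.eval s) (j.eval s) (e.eval s))
  | .setReal a i j e, Q, s => Q (s.writeReal a (i.eval s) (j.eval s) (e.eval s))
  | .sample a i j, Q, s => Q (s.draw a (i.eval s) (j.eval s))
  | .seq p q, Q, s => p.pre (q.pre Q) s
  | .branch b p q, Q, s => (b.Holds s → p.pre Q s) ∧ (¬ b.Holds s → q.pre Q s)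
  | .loop _ _, _, _ => False

/-- A bound for the number of operations of a loop-free program; the value at a loop is irrelevant. -/
def Program.bound : Program → ℕ
  | .skip => 1
  | .setNat _ i j e => i.cost + j.cost + e.cost + 1
  | .setReal _ i j e => i.cost + j.cost + e.cost + 1
  | .sample _ i j => i.cost + j.cost + 1
  | .seq p q => p.bound + q.bound
  | .branch b p q => b.cost + 1 + (p.bound + q.bound)
  | .loop _ _ => 0

/-- Programs with a loop are covered only vacuously. -/
theorem Program.reaches (p : Program) {Q : MachineState → Prop} {s : MachineState}
    (h : p.pre Q s) : Reaches p s p.bound Q := by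
  induction p generalizing Q s with
  | skip => exact ⟨_, _, .skip s, le_rfl, h⟩
  | setNat a i j e => exact ⟨_, _, .setNat s a i j e, le_rfl, h⟩
  | setReal a i j e => exact ⟨_, _, .setReal s a i j e, le_rfl, h⟩
  | sample a i j => exact ⟨_, _, .sample s a i j, le_rfl, h⟩
  | seq p q ihp ihq => exact (ihp h).seq fun s' h' => ihq h'
  | branch b p q ihp ihq =>
    by_cases hb : b.Holds s
    · obtain ⟨t, s', hr, ht, hq⟩ := ihp (h.1 hb)
      exact ⟨_, s', .branchTrue hb hr, by simp only [Program.bound]; omega, hq⟩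
    · obtain ⟨t, s', hr, ht, hq⟩ := ihq (h.2 hb)
      exact ⟨_, s', .branchFalse hb hr, by simp only [Program.bound]; omega, hq⟩
  | loop b p => exact h.elim

/-- The register `r`: a cell of the natural-number memory that is used as a variable. -/
def reg (r : ℕ) : NatExpr := .read 4 (.lit r) (.lit 0)

/-- Assign a value to the register `r`. -/
def setReg (r : ℕ) (e : NatExpr) : Program := .setNat 4 (.lit r) (.lit 0) e

/-- A real scalar variable. -/
def scalar (r : ℕ) : RealExpr := .read 2 (.lit r) (.lit 0)

/-- Assign a value to a real scalar variable. -/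
def setScalar (r : ℕ) (e : RealExpr) : Program := .setReal 2 (.lit r) (.lit 0) e

/-- The program `for reg c := 0, …, B - 1 do p`. -/
def forLoop (c : ℕ) (B : NatExpr) (p : Program) : Program :=
  .seq (setReg c (.lit 0))
    (.loop (.not (.natLe B (reg c))) (.seq p (setReg c (.add (reg c) (.lit 1)))))

theorem eval_reg (s : MachineState) (r : ℕ) : (reg r).eval s = s.nat 4 r 0 := rfl

/-- The rule for `for` loops, with an invariant `I` and a bound `κ i` for the `i`-th iteration. The
body must restore the counter, and the invariant is to hold again after the counter has been
increased. -/
theorem Reaches.forLoop {c : ℕ} {B : NatExpr} {p : Program} {M : ℕ} (κ : ℕ → ℕ)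
    (I : ℕ → MachineState → Prop) (hB : ∀ i s, I i s → B.eval s = M)
    (hc : ∀ i s, I i s → s.nat 4 c 0 = i)
    (hp : ∀ i < M, ∀ s, I i s →
      Reaches p s (κ i) fun s' => s'.nat 4 c 0 = i ∧ I (i + 1) (s'.writeNat 4 c 0 (i + 1)))
    {s : MachineState} (h0 : I 0 (s.writeNat 4 c 0 0)) :
    Reaches (forLoop c B p) s (∑ i ∈ Finset.range M, (κ i + (B.cost + 14)) + (B.cost + 14))
      (I M) := by
  have key : ∀ d i s, i + d = M → I i s →
      ∃ t s', Runs (.loop (.not (.natLe B (reg c))) (.seq p (setReg c (.add (reg c) (.lit 1)))))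
        s t s' ∧ t ≤ ∑ l ∈ Finset.range d, (κ (i + l) + (B.cost + 14)) + (B.cost + 6) ∧ I M s' := by
    intro d
    induction d with
    | zero =>
      intro i s hi hI
      have hi : i = M := by omega
      subst hi
      refine ⟨_, s, .loopDone ?_, ?_, hI⟩
      · simp [Test.Holds, hB _ _ hI, eval_reg, hc _ _ hI]
      · simp [Test.cost, reg, NatExpr.cost]
    | succ d ih =>
      intro i s hi hI
      obtain ⟨t, s', hr, ht, hq, hI'⟩ := hp i (by omega) s hI
      obtain ⟨t', s'', hr', ht', hI''⟩ := ih (i + 1) _ (by omega) hI'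
      have hset : Runs (setReg c (.add (reg c) (.lit 1))) s' 8 (s'.writeNat 4 c 0 (i + 1)) := by
        have := Runs.setNat s' 4 (.lit c) (.lit 0) (.add (reg c) (.lit 1))
        simpa [NatExpr.eval, NatExpr.cost, reg, setReg, hq] using this
      refine ⟨_, s'', .loopStep ?_ (.seq hr hset) hr', ?_, hI''⟩
      · simp [Test.Holds, hB _ _ hI, eval_reg, hc _ _ hI]
        omega
      · rw [Finset.sum_range_succ']
        have e : ∀ l, i + 1 + l = i + (l + 1) := fun l => by omega
        simp only [e] at ht'
        simp only [Test.cost, reg, NatExpr.cost, Nat.add_zero]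
        omega
  obtain ⟨t, s', hr, ht, hI⟩ := key M 0 _ (by omega) h0
  refine ⟨_, s', .seq (.setNat s 4 (.lit c) (.lit 0) (.lit 0)) hr, ?_, hI⟩
  simp only [NatExpr.cost]
  simp only [Nat.zero_add] at ht
  omega

theorem Reaches.forLoop_const {c : ℕ} {B : NatExpr} {p : Program} {M : ℕ} (κ : ℕ)
    (I : ℕ → MachineState → Prop) (hB : ∀ i s, I i s → B.eval s = M)
    (hc : ∀ i s, I i s → s.nat 4 c 0 = i)
    (hp : ∀ i < M, ∀ s, I i s →
      Reaches p s κ fun s' => s'.nat 4 c 0 = i ∧ I (i + 1) (s'.writeNat 4 c 0 (i + 1)))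
    {s : MachineState} (h0 : I 0 (s.writeNat 4 c 0 0)) :
    Reaches (_root_.forLoop c B p) s (M * (κ + (B.cost + 14)) + (B.cost + 14)) (I M) := by
  refine (Reaches.forLoop (fun _ => κ) I hB hc hp h0).mono (le_of_eq ?_) fun _ h => h
  simp

/-! ### Programs without sampling -/

/-- The program draws no samples. -/
def Program.SampleFree : Program → Prop
  | .skip => True
  | .setNat _ _ _ _ => True
  | .setReal _ _ _ _ => True
  | .sample _ _ _ => False
  | .seq p q => p.SampleFree ∧ q.SampleFree
  | .branch _ p q => p.SampleFree ∧ q.SampleFree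
  | .loop _ p => p.SampleFree

/-- The configuration with other samples. -/
def MachineState.withTape (s : MachineState) (ω : ℕ → unitInterval) : MachineState :=
  { s with tape := ω }

theorem NatExpr.eval_withTape (e : NatExpr) (s : MachineState) (ω : ℕ → unitInterval) :
    e.eval (s.withTape ω) = e.eval s := by
  induction e with
  | lit c => rfl
  | read a i j hi hj => simp only [NatExpr.eval, hi, hj]; rfl
  | add e f he hf => simp only [NatExpr.eval, he, hf]
  | sub e f he hf => simp only [NatExpr.eval, he, hf]

theorem RealExpr.eval_withTape (e : RealExpr) (s : MachineState) (ω : ℕ → unitInterval) :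
    e.eval (s.withTape ω) = e.eval s := by
  induction e with
  | ofNat e => simp only [RealExpr.eval, NatExpr.eval_withTape]
  | read a i j => simp only [RealExpr.eval, NatExpr.eval_withTape]; rfl
  | add e f he hf => simp only [RealExpr.eval, he, hf]
  | sub e f he hf => simp only [RealExpr.eval, he, hf]
  | mul e f he hf => simp only [RealExpr.eval, he, hf]
  | div e f he hf => simp only [RealExpr.eval, he, hf]
  | sqrt e he => simp only [RealExpr.eval, he]

theorem Test.holds_withTape (b : Test) (s : MachineState) (ω : ℕ → unitInterval) :
    b.Holds (s.withTape ω) ↔ b.Holds s := by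
  induction b with
  | natLe e f => simp only [Test.Holds, NatExpr.eval_withTape]
  | realLe e f => simp only [Test.Holds, RealExpr.eval_withTape]
  | not b hb => simp only [Test.Holds, hb]
  | and b c hb hc => simp only [Test.Holds, hb, hc]

/-- The run of a program that draws no samples does not depend on them. -/
theorem Runs.withTape {p : Program} {s s' : MachineState} {t : ℕ} (h : Runs p s t s')
    (hp : p.SampleFree) (ω : ℕ → unitInterval) : Runs p (s.withTape ω) t (s'.withTape ω) := by
  induction h with
  | skip => exact .skip _
  | setNat s a i j e =>
    have := Runs.setNat (s.withTape ω) a i j e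
    simp only [NatExpr.eval_withTape] at this
    exact this
  | setReal s a i j e =>
    have := Runs.setReal (s.withTape ω) a i j e
    simp only [NatExpr.eval_withTape, RealExpr.eval_withTape] at this
    exact this
  | sample => exact hp.elim
  | seq _ _ ih ih' => exact .seq (ih hp.1) (ih' hp.2)
  | branchTrue hb _ ih => exact .branchTrue ((Test.holds_withTape _ _ ω).2 hb) (ih hp.1)
  | branchFalse hb _ ih =>
    exact .branchFalse (fun h => hb ((Test.holds_withTape _ _ ω).1 h)) (ih hp.2)
  | loopDone hb => exact .loopDone fun h => hb ((Test.holds_withTape _ _ ω).1 h)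
  | loopStep hb _ _ ih ih' =>
    exact .loopStep ((Test.holds_withTape _ _ ω).2 hb) (ih hp) (ih' hp)

/-! ### The trie in the memory of the machine -/

/-- The memory holds a trie: register `4` holds the number of nodes; cell `(p, j)` of array `5` holds
the child of `p` with symbol `j`, or `0`; arrays `6` and `7` hold the parents and the roots; row `j`
of array `8` lists the nodes with symbol `j`, and array `9` holds the lengths of these lists; the
real array `5` holds the weights of the nodes. -/
structure TrieMem (N C : ℕ) (par sym own : ℕ → ℕ) (lab : ℕ → Finset ℕ) (s : MachineState) :
    Prop where
  trie : IsTrie N C par sym own lab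
  count : s.nat 4 4 0 = C
  child_node : ∀ x, N ≤ x → x < C → s.nat 5 (par x) (sym x) = x
  child_inv : ∀ p j, s.nat 5 p j ≠ 0 → N ≤ s.nat 5 p j ∧ s.nat 5 p j < C ∧
    par (s.nat 5 p j) = p ∧ sym (s.nat 5 p j) = j
  par_eq : ∀ x, N ≤ x → x < C → s.nat 6 x 0 = par x
  own_eq : ∀ x, N ≤ x → x < C → s.nat 7 x 0 = own x
  weight_eq : ∀ x, N ≤ x → x < C → s.real 5 x 0 = parWeight par lab x
  level : ∀ j < N, Set.BijOn (s.nat 8 j) (Set.Iio (s.nat 9 j 0)) {x | N ≤ x ∧ x < C ∧ sym x = j}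
  total : ∑ j ∈ Finset.range N, s.nat 9 j 0 + N = C

section TrieMem

variable {N C : ℕ} {par sym own : ℕ → ℕ} {lab : ℕ → Finset ℕ}

theorem TrieMem.congr {s s' : MachineState} (h : TrieMem N C par sym own lab s)
    (h4 : s'.nat 4 4 0 = s.nat 4 4 0) (h5 : s'.nat 5 = s.nat 5) (h6 : s'.nat 6 = s.nat 6)
    (h7 : s'.nat 7 = s.nat 7) (h8 : s'.nat 8 = s.nat 8) (h9 : s'.nat 9 = s.nat 9)
    (r5 : s'.real 5 = s.real 5) : TrieMem N C par sym own lab s' where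
  trie := h.trie
  count := h4 ▸ h.count
  child_node := h5 ▸ h.child_node
  child_inv := h5 ▸ h.child_inv
  par_eq := h6 ▸ h.par_eq
  own_eq := h7 ▸ h.own_eq
  weight_eq := r5 ▸ h.weight_eq
  level := h8 ▸ h9 ▸ h.level
  total := h9 ▸ h.total

/-- Adding the node `C` as a child of `p` with symbol `j`. -/
theorem IsTrie.insertNode (h : IsTrie N C par sym own lab) {p j : ℕ} (hp : p < C) (hj : j < N)
    (hjp : j < sym p) (hnew : ∀ x, N ≤ x → x < C → par x = p → sym x ≠ j) :
    IsTrie N (C + 1) (Function.update par C p) (Function.update sym C j)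
      (Function.update own C (own p)) (Function.update lab C (insert j (lab p))) := by
  have hu : ∀ {β : Type} (f : ℕ → β) (b : β) {x : ℕ}, x < C → Function.update f C b x = f x :=
    fun f b x hx => Function.update_of_ne hx.ne _ _
  have hle := h.le
  have hlt : ∀ {x}, x < C + 1 → x < C ∨ x = C := fun hx => by omega
  refine ⟨by omega, ?_, ?_, ?_, ?_, ?_, ?_, ?_, ?_, ?_⟩
  · intro x hx; rw [hu _ _ (by omega)]; exact h.sym_root x hx
  · intro x hx; rw [hu _ _ (by omega)]; exact h.own_root x hx
  · intro x hx; rw [hu _ _ (by omega)]; exact h.lab_root x hx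
  · intro x hN hx
    rcases hlt hx with hx | rfl
    · rw [hu _ _ hx]; exact h.par_lt x hN hx
    · simpa using hp
  · intro x hN hx
    rcases hlt hx with hx | rfl
    · rw [hu _ _ hx]; exact h.sym_lt x hN hx
    · simpa using hj
  · intro x hN hx
    rcases hlt hx with hx | rfl
    · rw [hu _ _ hx, hu _ _ hx, hu _ _ ((h.par_lt x hN hx).trans hx)]
      exact h.sym_lt_par x hN hx
    · rw [Function.update_self, Function.update_self, hu _ _ hp]
      exact hjp
  · intro x hN hx
    rcases hlt hx with hx | rfl
    · rw [hu _ _ hx, hu _ _ hx, hu _ _ ((h.par_lt x hN hx).trans hx)]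
      exact h.own_par x hN hx
    · rw [Function.update_self, Function.update_self, hu _ _ hp]
  · intro x hN hx
    rcases hlt hx with hx | rfl
    · rw [hu _ _ hx, hu _ _ hx, hu _ _ hx, hu _ _ ((h.par_lt x hN hx).trans hx)]
      exact h.lab_par x hN hx
    · rw [Function.update_self, Function.update_self, Function.update_self, hu _ _ hp]
  · intro x x' hN hx hN' hx' e1 e2
    rcases hlt hx with hx | rfl <;> rcases hlt hx' with hx' | rfl
    · rw [hu _ _ hx, hu _ _ hx'] at e1 e2
      exact h.inj x x' hN hx hN' hx' e1 e2
    · rw [hu _ _ hx, Function.update_self] at e1 e2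
      exact absurd e2 (hnew x hN hx e1)
    · rw [hu _ _ hx', Function.update_self] at e1 e2
      exact absurd e2.symm (hnew x' hN' hx' e1.symm)
    · rfl

/-- The memory of the enlarged trie. -/
theorem TrieMem.insertNode {s s' : MachineState} (h : TrieMem N C par sym own lab s) {p j : ℕ}
    (hN0 : 0 < N) (hp : p < C) (hj : j < N) (hjp : j < sym p) (h0 : s.nat 5 p j = 0)
    (h4 : s'.nat 4 4 0 = C + 1) (h5 : s'.nat 5 = setEntry (s.nat 5) p j C)
    (h6 : s'.nat 6 = setEntry (s.nat 6) C 0 p) (h7 : s'.nat 7 = setEntry (s.nat 7) C 0 (own p))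
    (h8 : s'.nat 8 = setEntry (s.nat 8) j (s.nat 9 j 0) C)
    (h9 : s'.nat 9 = setEntry (s.nat 9) j 0 (s.nat 9 j 0 + 1))
    (r5 : s'.real 5 = setEntry (s.real 5) C 0 (3 ^ (lab p).card)) :
    TrieMem N (C + 1) (Function.update par C p) (Function.update sym C j)
      (Function.update own C (own p)) (Function.update lab C (insert j (lab p))) s' := by
  have hle := h.trie.le
  have hu : ∀ {β : Type} (f : ℕ → β) (b : β) {x : ℕ}, x < C → Function.update f C b x = f x :=
    fun f b x hx => Function.update_of_ne hx.ne _ _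
  have hlt : ∀ {x}, x < C + 1 → x < C ∨ x = C := fun hx => by omega
  have hnew : ∀ x, N ≤ x → x < C → par x = p → sym x ≠ j := by
    rintro x hN hx rfl rfl
    rw [h.child_node x hN hx] at h0
    omega
  refine ⟨h.trie.insertNode hp hj hjp hnew, h4, ?_, ?_, ?_, ?_, ?_, ?_, ?_⟩
  · intro x hN hx
    rw [h5]
    rcases hlt hx with hx | rfl
    · rw [hu _ _ hx, hu _ _ hx, setEntry_apply, if_neg fun e => hnew x hN hx e.1 e.2]
      exact h.child_node x hN hx
    · simp [setEntry_apply]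
  · intro p' j'
    rw [h5, setEntry_apply]
    split_ifs with e
    · intro _
      rw [Function.update_self, Function.update_self]
      exact ⟨hle, by omega, e.1.symm, e.2.symm⟩
    · intro hne
      obtain ⟨a, b, c, d⟩ := h.child_inv p' j' hne
      rw [hu _ _ b, hu _ _ b]
      exact ⟨a, by omega, c, d⟩
  · intro x hN hx
    rw [h6, setEntry_apply]
    rcases hlt hx with hx | rfl
    · rw [if_neg (by omega), hu _ _ hx]; exact h.par_eq x hN hx
    · simp
  · intro x hN hx
    rw [h7, setEntry_apply]
    rcases hlt hx with hx | rfl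
    · rw [if_neg (by omega), hu _ _ hx]; exact h.own_eq x hN hx
    · simp
  · intro x hN hx
    rw [r5, setEntry_apply]
    unfold parWeight
    rcases hlt hx with hx | rfl
    · rw [if_neg (by omega), hu _ _ hx, hu _ _ ((h.trie.par_lt x hN hx).trans hx)]
      exact h.weight_eq x hN hx
    · rw [Function.update_self, hu _ _ hp]; simp
  · intro j' hj'
    have hB := h.level j' hj'
    rw [h8, h9]
    by_cases e : j' = j
    · subst e
      have e1 : setEntry (s.nat 9) j' 0 (s.nat 9 j' 0 + 1) j' 0 = s.nat 9 j' 0 + 1 := by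
        simp [setEntry_apply]
      have e2 : (Set.Iio (s.nat 9 j' 0 + 1) : Set ℕ) =
          insert (s.nat 9 j' 0) (Set.Iio (s.nat 9 j' 0)) := by
        ext c; simp only [Set.mem_Iio, Set.mem_insert_iff]; omega
      have e3 : {x | N ≤ x ∧ x < C + 1 ∧ Function.update sym C j' x = j'} =
          insert C {x | N ≤ x ∧ x < C ∧ sym x = j'} := by
        ext x
        simp only [Set.mem_ofPred_eq, Set.mem_insert_iff]
        constructor
        · rintro ⟨a, b, c⟩
          rcases hlt b with hx | rfl
          · rw [hu _ _ hx] at c; exact Or.inr ⟨a, hx, c⟩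
          · exact Or.inl rfl
        · rintro (rfl | ⟨a, b, c⟩)
          · exact ⟨hle, by omega, by simp⟩
          · exact ⟨a, by omega, by rw [hu _ _ b]; exact c⟩
      rw [e1, e2, e3]
      have hB' : Set.BijOn (setEntry (s.nat 8) j' (s.nat 9 j' 0) C j') (Set.Iio (s.nat 9 j' 0))
          {x | N ≤ x ∧ x < C ∧ sym x = j'} := by
        refine hB.congr fun c hc => ?_
        rw [setEntry_apply, if_neg]
        have : c < s.nat 9 j' 0 := hc
        omega
      have hval : setEntry (s.nat 8) j' (s.nat 9 j' 0) C j' (s.nat 9 j' 0) = C := by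
        simp [setEntry_apply]
      have := hB'.insert (a := s.nat 9 j' 0) (by
        rw [hval]
        intro hc
        exact absurd hc.2.1 (lt_irrefl _))
      rwa [hval] at this
    · have e1 : setEntry (s.nat 9) j 0 (s.nat 9 j 0 + 1) j' 0 = s.nat 9 j' 0 := by
        simp [setEntry_apply, e]
      have e2 : setEntry (s.nat 8) j (s.nat 9 j 0) C j' = s.nat 8 j' := by
        funext c; simp [setEntry_apply, e]
      have e3 : {x | N ≤ x ∧ x < C + 1 ∧ Function.update sym C j x = j'} =
          {x | N ≤ x ∧ x < C ∧ sym x = j'} := by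
        ext x
        simp only [Set.mem_ofPred_eq]
        constructor
        · rintro ⟨a, b, c⟩
          rcases hlt b with hx | rfl
          · rw [hu _ _ hx] at c; exact ⟨a, hx, c⟩
          · rw [Function.update_self] at c; exact absurd c.symm e
        · rintro ⟨a, b, c⟩
          exact ⟨a, by omega, by rw [hu _ _ b]; exact c⟩
      rw [e1, e2, e3]
      exact hB
  · have e : ∀ j', s'.nat 9 j' 0 = s.nat 9 j' 0 + if j' = j then 1 else 0 := fun j' => by
      rw [h9, setEntry_apply]
      by_cases e : j' = j
      · subst e; simp
      · simp [e]
    simp only [e]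
    rw [Finset.sum_add_distrib, Finset.sum_ite_eq' (Finset.range N) j, if_pos (by simpa using hj)]
    have := h.total
    omega

/-- The new node represents no monomial yet: all the monomials of the derivatives taken so far have
nodes already. -/
theorem StoresDerivatives.insertNode {m : ℕ} {D S : ℕ → Finset ℕ} {g τ : ℕ → ℝ}
    (hs : StoresDerivatives C own lab m D S g τ) {p j : ℕ}
    (h' : IsTrie N (C + 1) (Function.update par C p) (Function.update sym C j)
      (Function.update own C (own p)) (Function.update lab C (insert j (lab p))))
    (hτ : τ C = 0) :
    StoresDerivatives (C + 1) (Function.update own C (own p))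
      (Function.update lab C (insert j (lab p))) m D S g τ := by
  have hu : ∀ {β : Type} (f : ℕ → β) (b : β) {x : ℕ}, x < C → Function.update f C b x = f x :=
    fun f b x hx => Function.update_of_ne hx.ne _ _
  have hcover : ∀ i < m, ∀ v ∈ D i, ∃ x < C, Function.update own C (own p) x = v ∧
      Function.update lab C (insert j (lab p)) x = (S i).erase v := by
    intro i hi v hv
    obtain ⟨x, hx, h1, h2⟩ := hs.cover i hi v hv
    exact ⟨x, hx, by rw [hu _ _ hx, h1], by rw [hu _ _ hx, h2]⟩
  refine ⟨fun i hi v hv => ?_, fun x hx => ?_⟩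
  · obtain ⟨x, hx, h1⟩ := hcover i hi v hv
    exact ⟨x, by omega, h1⟩
  · rcases (by omega : x < C ∨ x = C) with hx | rfl
    · rw [hu _ _ hx, hu _ _ hx]; exact hs.val x hx
    · rw [hτ, Finset.sum_eq_zero]
      intro i hi
      simp only [Finset.mem_filter, Finset.mem_range] at hi
      obtain ⟨x', hx', h1, h2⟩ := hcover i hi.1 _ hi.2.1
      exact absurd (h'.ext_node (by omega) (by omega) h1 (h2.trans hi.2.2)) hx'.ne

/-- Differentiating the term `i` with respect to a further variable `v` adds `g i` at one node. -/
theorem StoresDerivatives.add {m : ℕ} {D S : ℕ → Finset ℕ} {g τ : ℕ → ℝ}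
    (hs : StoresDerivatives C own lab m D S g τ) (h : IsTrie N C par sym own lab) {i v x : ℕ}
    (hi : i < m) (hv : v ∉ D i) (hx : x < C) (ho : own x = v)
    (hl : lab x = (S i).erase v) {τ' : ℕ → ℝ} (hτ : ∀ x', τ' x' = τ x' + if x' = x then g i else 0) :
    StoresDerivatives C own lab m (Function.update D i (insert v (D i))) S g τ' := by
  refine ⟨fun i' hi' v' hv' => ?_, fun x' hx' => ?_⟩
  · by_cases e : i' = i
    · subst e
      rw [Function.update_self, Finset.mem_insert] at hv'
      rcases hv' with rfl | hv'
      · exact ⟨x, hx, ho, hl⟩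
      · exact hs.cover i' hi' v' hv'
    · rw [Function.update_of_ne e] at hv'
      exact hs.cover i' hi' v' hv'
  · rw [hτ, hs.val x' hx', Finset.sum_filter, Finset.sum_filter]
    have e2 : (if x' = x then g i else 0) =
        ∑ i' ∈ Finset.range m, if i' = i then (if x' = x then g i else 0) else 0 := by
      rw [Finset.sum_ite_eq' (Finset.range m) i]; simp [hi]
    rw [e2, ← Finset.sum_add_distrib]
    refine Finset.sum_congr rfl fun i' _ => ?_
    by_cases e : i' = i
    · subst e
      rw [Function.update_self, if_pos rfl]
      by_cases ex : x' = x
      · subst ex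
        simp [ho, hv, hl]
      · rw [if_neg ex, add_zero]
        congr 1
        rw [Finset.mem_insert]
        refine propext ⟨fun hh => ⟨Or.inr hh.1, hh.2⟩, fun hh => ⟨?_, hh.2⟩⟩
        rcases hh.1 with h1 | h1
        · exfalso
          apply ex
          refine h.ext_node hx' hx (h1.trans ho.symm) ?_
          rw [← hh.2, h1, hl]
        · exact h1
    · rw [Function.update_of_ne e, if_neg e, add_zero]

end TrieMem

/-! ### The input -/

/-- The set of variables of the term `i`. -/
def termSet (len : ℕ → ℕ) (vr : ℕ → ℕ → ℕ) (i : ℕ) : Finset ℕ :=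
  (Finset.range (len i)).image (vr i)

/-- The `m` terms are distinct sets of at most `k` variables below `N`; the `i`-th one consists of
`vr i 0 < vr i 1 < ⋯ < vr i (len i - 1)`. -/
structure TermData (N k m : ℕ) (len : ℕ → ℕ) (vr : ℕ → ℕ → ℕ) : Prop where
  lt : ∀ i < m, ∀ a < len i, vr i a < N
  mono : ∀ i < m, ∀ a a', a < a' → a' < len i → vr i a < vr i a'
  len_le : ∀ i < m, len i ≤ k
  inj : ∀ i < m, ∀ i' < m, termSet len vr i = termSet len vr i' → i = i'

theorem TermData.injOn {N k m : ℕ} {len : ℕ → ℕ} {vr : ℕ → ℕ → ℕ} (h : TermData N k m len vr)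
    {i : ℕ} (hi : i < m) {a a' : ℕ} (ha : a < len i) (ha' : a' < len i) (e : vr i a = vr i a') :
    a = a' := by
  rcases lt_trichotomy a a' with hl | hl | hl
  · exact absurd e (h.mono i hi a a' hl ha').ne
  · exact hl
  · exact absurd e.symm (h.mono i hi a' a hl ha).ne

theorem TermData.card {N k m : ℕ} {len : ℕ → ℕ} {vr : ℕ → ℕ → ℕ} (h : TermData N k m len vr)
    {i : ℕ} (hi : i < m) : (termSet len vr i).card = len i := by
  rw [termSet, Finset.card_image_of_injOn, Finset.card_range]
  intro a ha a' ha' e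
  exact h.injOn hi (by simpa using ha) (by simpa using ha') e

/-- The number of the variable at position `a` of the term `i`. -/
def varExpr (i a : NatExpr) : NatExpr :=
  .add (.add (.add (.read 2 i a) (.read 2 i a)) (.add (.read 2 i a) (.read 2 i a))) (.read 3 i a)

/-- The length of the term `i`. -/
def lenExpr (i : NatExpr) : NatExpr := .read 1 i (.lit 0)

/-- The number of terms. -/
def countExpr : NatExpr := .read 0 (.lit 2) (.lit 0)

/-- The number of variables. -/
def boundExpr : NatExpr :=
  .add (.add (.read 0 (.lit 0) (.lit 0)) (.read 0 (.lit 0) (.lit 0)))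
    (.add (.read 0 (.lit 0) (.lit 0)) (.read 0 (.lit 0) (.lit 0)))

/-- The memory holds the input. -/
structure Input (N k m : ℕ) (len : ℕ → ℕ) (vr : ℕ → ℕ → ℕ) (cf : ℕ → ℝ) (s : MachineState) :
    Prop where
  bound : boundExpr.eval s = N
  loc : s.nat 0 1 0 = k
  count : countExpr.eval s = m
  len_eq : ∀ i < m, s.nat 1 i 0 = len i
  var_eq : ∀ i < m, ∀ a < len i,
    s.nat 2 i a + s.nat 2 i a + (s.nat 2 i a + s.nat 2 i a) + s.nat 3 i a = vr i a
  coef_eq : ∀ i < m, s.real 0 i 0 = cf i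

theorem Input.congr {N k m : ℕ} {len : ℕ → ℕ} {vr : ℕ → ℕ → ℕ} {cf : ℕ → ℝ} {s s' : MachineState}
    (h : Input N k m len vr cf s) (h0 : s'.nat 0 = s.nat 0) (h1 : s'.nat 1 = s.nat 1)
    (h2 : s'.nat 2 = s.nat 2) (h3 : s'.nat 3 = s.nat 3) (r0 : s'.real 0 = s.real 0) :
    Input N k m len vr cf s' where
  bound := by rw [← h.bound]; simp only [boundExpr, NatExpr.eval, h0]
  loc := h0 ▸ h.loc
  count := by rw [← h.count]; simp only [countExpr, NatExpr.eval, h0]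
  len_eq := h1 ▸ h.len_eq
  var_eq := h2 ▸ h3 ▸ h.var_eq
  coef_eq := r0 ▸ h.coef_eq

/-- The arrays that are not part of the input are zero, except for those that are used by the first
part of the program. -/
def Fresh (s : MachineState) : Prop :=
  (∀ a, 5 ≤ a → s.nat a = fun _ _ => 0) ∧ ∀ a, 4 ≤ a → s.real a = fun _ _ => 0

/-! ### Rescaling the coefficients -/

/-- The rescaled coefficient of the term `i`. The factor `1 / √12` for each variable is the product of
the length `1 / √3` of the Bloch components and the factor `1 / 2` in the means `(y + t σ) / 2`. The
identity does not contribute to the advantage, so it gets the coefficient `0`. -/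
def scaledCoef (len : ℕ → ℕ) (cf : ℕ → ℝ) (i : ℕ) : ℝ :=
  if len i = 0 then 0 else cf i / √12 ^ len i

/-- Store the rescaled coefficients in the real array `3`. -/
def coefProgram : Program :=
  forLoop 0 countExpr
    (.seq (.setReal 3 (reg 0) (.lit 0) (.read 0 (reg 0) (.lit 0)))
    (.seq (forLoop 1 (lenExpr (reg 0)) (.setReal 3 (reg 0) (.lit 0)
        (.div (.read 3 (reg 0) (.lit 0)) (.sqrt (.ofNat (.lit 12))))))
      (.branch (.natLe (lenExpr (reg 0)) (.lit 0))
        (.setReal 3 (reg 0) (.lit 0) (.ofNat (.lit 0))) .skip)))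

section

variable {N k m : ℕ} {len : ℕ → ℕ} {vr : ℕ → ℕ → ℕ} {cf : ℕ → ℝ}

theorem coefProgram_reaches (ht : TermData N k m len vr) {s : MachineState}
    (hI : Input N k m len vr cf s) (hF : Fresh s) :
    Reaches coefProgram s (m * (k * 50 + 100) + 50) fun s' => Input N k m len vr cf s' ∧ Fresh s' ∧
      ∀ i < m, s'.real 3 i 0 = scaledCoef len cf i := by
  have step : ∀ i < m, ∀ s, Input N k m len vr cf s → Fresh s → s.nat 4 0 0 = i →
      (∀ i' < i, s.real 3 i' 0 = scaledCoef len cf i') →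
      Reaches (.seq (.setReal 3 (reg 0) (.lit 0) (.read 0 (reg 0) (.lit 0)))
        (.seq (forLoop 1 (lenExpr (reg 0)) (.setReal 3 (reg 0) (.lit 0)
        (.div (.read 3 (reg 0) (.lit 0)) (.sqrt (.ofNat (.lit 12))))))
      (.branch (.natLe (lenExpr (reg 0)) (.lit 0))
        (.setReal 3 (reg 0) (.lit 0) (.ofNat (.lit 0))) .skip))) s (k * 50 + 80)
        fun s' => s'.nat 4 0 0 = i ∧ Input N k m len vr cf s' ∧ Fresh s' ∧
          ∀ i' < i + 1, s'.real 3 i' 0 = scaledCoef len cf i' := by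
    intro i hi s hI hF h0 hg
    refine ((Program.reaches _ (Q := fun s => s.nat 4 0 0 = i ∧ Input N k m len vr cf s ∧ Fresh s ∧
      (∀ i' < i, s.real 3 i' 0 = scaledCoef len cf i') ∧ s.real 3 i 0 = cf i) ?_).seq fun s' hs' =>
      ((Reaches.forLoop_const (M := len i) (Program.bound (.setReal 3 (reg 0) (.lit 0)
        (.div (.read 3 (reg 0) (.lit 0)) (.sqrt (.ofNat (.lit 12))))))
        (fun a s => s.nat 4 0 0 = i ∧ s.nat 4 1 0 = a ∧ Input N k m len vr cf s ∧ Fresh s ∧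
        (∀ i' < i, s.real 3 i' 0 = scaledCoef len cf i') ∧ s.real 3 i 0 = cf i / √12 ^ a)
        ?_ ?_ ?_ ?_).seq fun s'' hs'' => Program.reaches _ ?_)).mono
      (T := _ + ((len i * _ + _) + _)) ?_ fun _ h => h
    · simp only [Program.pre, NatExpr.eval, RealExpr.eval, reg, h0]
      refine ⟨by simpa using h0, hI.congr (by simp) (by simp) (by simp) (by simp) (by simp),
        ⟨fun a ha => by simpa using hF.1 a ha, fun a ha => ?_⟩, fun i' hi' => ?_, ?_⟩
      · simpa [show a ≠ 3 by omega] using hF.2 a ha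
      · simpa [setEntry_apply, hi'.ne] using hg i' hi'
      · simpa [setEntry_apply] using hI.coef_eq i hi
    · rintro a s ⟨h0, -, hI, -⟩
      simpa [lenExpr, NatExpr.eval, reg, h0] using hI.len_eq i hi
    · rintro a s ⟨-, h1, -⟩
      exact h1
    · rintro a ha s ⟨h0, h1, hI, hF, hg, hgi⟩
      refine Program.reaches _ ?_
      simp only [Program.pre, NatExpr.eval, RealExpr.eval, reg, h0]
      refine ⟨by simpa using h1, by simpa [setEntry_apply] using h0, by simp [setEntry_apply],
        hI.congr (by simp) (by simp) (by simp) (by simp) (by simp),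
        ⟨fun a ha => ?_, fun a ha => ?_⟩, fun i' hi' => ?_, ?_⟩
      · simpa [show a ≠ 4 by omega] using hF.1 a ha
      · simpa [show a ≠ 3 by omega] using hF.2 a ha
      · simpa [setEntry_apply, hi'.ne] using hg i' hi'
      · simp [setEntry_apply, hgi, pow_succ, div_div]
    · obtain ⟨h0, hI, hF, hg, hgi⟩ := hs'
      refine ⟨by simpa [setEntry_apply] using h0, by simp [setEntry_apply],
        hI.congr (by simp) (by simp) (by simp) (by simp) (by simp),
        ⟨fun a ha => ?_, fun a ha => by simpa using hF.2 a ha⟩, fun i' hi' => ?_, ?_⟩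
      · simpa [show a ≠ 4 by omega] using hF.1 a ha
      · simpa using hg i' hi'
      · simpa using hgi
    · obtain ⟨h0, -, hI, hF, hg, hgi⟩ := hs''
      have hlt : ∀ {i'}, i' < i + 1 → i' < i ∨ i' = i := fun h => by omega
      simp only [Program.pre, NatExpr.eval, RealExpr.eval, Test.Holds, lenExpr, reg, h0,
        hI.len_eq i hi]
      refine ⟨fun hl => ⟨by simpa using h0, hI.congr (by simp) (by simp) (by simp) (by simp) (by simp),
        ⟨fun a ha => by simpa using hF.1 a ha, fun a ha => ?_⟩, fun i' hi' => ?_⟩,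
        fun hl => ⟨trivial, hI, hF, fun i' hi' => ?_⟩⟩
      · simpa [show a ≠ 3 by omega] using hF.2 a ha
      · rcases hlt hi' with h | rfl
        · simpa [setEntry_apply, h.ne] using hg i' h
        · simp [setEntry_apply, scaledCoef, Nat.le_zero.1 hl]
      · rcases hlt hi' with h | rfl
        · exact hg i' h
        · rw [hgi, scaledCoef, if_neg (by omega)]
    · have := ht.len_le i hi
      simp only [Program.bound, NatExpr.cost, RealExpr.cost, Test.cost, reg, lenExpr]
      have := Nat.mul_le_mul_right 50 this
      omega
  refine (Reaches.forLoop_const (M := m) (k * 50 + 80) (fun i s => s.nat 4 0 0 = i ∧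
    Input N k m len vr cf s ∧ Fresh s ∧ ∀ i' < i, s.real 3 i' 0 = scaledCoef len cf i')
    ?_ ?_ ?_ ?_).mono ?_ fun s h => h.2
  · exact fun i s h => h.2.1.count
  · exact fun i s h => h.1
  · rintro i hi s ⟨h0, hI, hF, hg⟩
    refine (step i hi s hI hF h0 hg).mono le_rfl ?_
    rintro s' ⟨h0, hI, hF, hg⟩
    refine ⟨h0, by simp [setEntry_apply], hI.congr (by simp) (by simp) (by simp) (by simp) (by simp),
      ⟨fun a ha => ?_, fun a ha => by simpa using hF.2 a ha⟩, fun i' hi' => ?_⟩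
    · simpa [show a ≠ 4 by omega] using hF.1 a ha
    · simpa using hg i' hi'
  · refine ⟨by simp [setEntry_apply], hI.congr (by simp) (by simp) (by simp) (by simp) (by simp),
      ⟨fun a ha => ?_, fun a ha => by simpa using hF.2 a ha⟩, fun i' hi' => by omega⟩
    simpa [show a ≠ 4 by omega] using hF.1 a ha
  · simp only [countExpr, NatExpr.cost]
    have : m * (k * 50 + 80 + (1 + 1 + 1 + 14)) ≤ m * (k * 50 + 100) :=
      Nat.mul_le_mul_left _ (by omega)
    omega

end

/-! ### Building the trie -/

section

variable {N k m : ℕ} {len : ℕ → ℕ} {vr : ℕ → ℕ → ℕ} {cf : ℕ → ℝ}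

/-- The memory holds the input, a trie, and on its nodes the coefficients of the derivatives of the
polynomial with respect to the variables in `D`; the real arrays `6` and `7` hold the squared norms
of these derivatives, without and with weights. -/
structure TrieState (N k m : ℕ) (len : ℕ → ℕ) (vr : ℕ → ℕ → ℕ) (cf : ℕ → ℝ) (D : ℕ → Finset ℕ)
    (C : ℕ) (par sym own : ℕ → ℕ) (lab : ℕ → Finset ℕ) (s : MachineState) : Prop where
  input : Input N k m len vr cf s
  coef : ∀ i < m, s.real 3 i 0 = scaledCoef len cf i
  mem : TrieMem N C par sym own lab s
  der : StoresDerivatives C own lab m D (termSet len vr) (scaledCoef len cf) fun x => s.real 4 x 0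
  zero : ∀ x, C ≤ x → s.real 4 x 0 = 0
  sq : ∀ v, s.real 6 v 0 = ∑ i ∈ Finset.range m with v ∈ D i, scaledCoef len cf i ^ 2
  wsq : ∀ v, s.real 7 v 0 =
    ∑ i ∈ Finset.range m with v ∈ D i,
      3 ^ ((termSet len vr i).card - 1) * scaledCoef len cf i ^ 2
  cross : ∀ v, s.real 8 v 0 = 0

variable {D : ℕ → Finset ℕ} {C : ℕ} {par sym own : ℕ → ℕ} {lab : ℕ → Finset ℕ}

theorem TrieState.congr {s s' : MachineState} (h : TrieState N k m len vr cf D C par sym own lab s)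
    (hn : ∀ a, a ≠ 4 → s'.nat a = s.nat a) (h4 : s'.nat 4 4 0 = s.nat 4 4 0)
    (hr : ∀ a, a ≠ 2 → s'.real a = s.real a) :
    TrieState N k m len vr cf D C par sym own lab s' where
  input := h.input.congr (hn _ (by simp)) (hn _ (by simp)) (hn _ (by simp)) (hn _ (by simp))
    (hr _ (by simp))
  coef := by rw [hr 3 (by simp)]; exact h.coef
  mem := h.mem.congr h4 (hn _ (by simp)) (hn _ (by simp)) (hn _ (by simp)) (hn _ (by simp))
    (hn _ (by simp)) (hr _ (by simp))
  der := by rw [hr 4 (by simp)]; exact h.der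
  zero := by rw [hr 4 (by simp)]; exact h.zero
  sq := by rw [hr 6 (by simp)]; exact h.sq
  wsq := by rw [hr 7 (by simp)]; exact h.wsq
  cross := by rw [hr 8 (by simp)]; exact h.cross

/-- Add the child of the node in register `3` with the symbol in register `7`. -/
def insertProgram : Program :=
  .seq (.setNat 5 (reg 3) (reg 7) (reg 4))
  (.seq (.setNat 6 (reg 4) (.lit 0) (reg 3))
  (.seq (.setNat 7 (reg 4) (.lit 0) (reg 5))
  (.seq (.setReal 5 (reg 4) (.lit 0) (scalar 0))
  (.seq (.setNat 8 (reg 7) (.read 9 (reg 7) (.lit 0)) (reg 4))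
  (.seq (.setNat 9 (reg 7) (.lit 0) (.add (.read 9 (reg 7) (.lit 0)) (.lit 1)))
  (setReg 4 (.add (reg 4) (.lit 1))))))))

/-- The effect of `insertProgram`, given that the registers `3`, `5`, `7` and the scalar `0` hold the
node `p`, its root, the symbol `j` and the weight of the new node. -/
theorem insertProgram_pre {s : MachineState} (h : TrieState N k m len vr cf D C par sym own lab s)
    (hN0 : 0 < N) {p j : ℕ} (e3 : s.nat 4 3 0 = p) (e7 : s.nat 4 7 0 = j)
    (e5 : s.nat 4 5 0 = own p) (w0 : s.real 2 0 0 = 3 ^ (lab p).card)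
    (hp : p < C) (hj : j < N) (hjp : j < sym p) (h0 : s.nat 5 p j = 0)
    {Q : MachineState → Prop} (hQ : ∀ s', (∀ r, r ≠ 4 → s'.nat 4 r 0 = s.nat 4 r 0) →
      s'.real 2 = s.real 2 → s'.nat 5 p j = C →
      TrieState N k m len vr cf D (C + 1) (Function.update par C p) (Function.update sym C j)
        (Function.update own C (own p)) (Function.update lab C (insert j (lab p))) s' → Q s') :
    insertProgram.pre Q s := by
  have e4 := h.mem.count
  simp only [insertProgram, Program.pre, setReg, NatExpr.eval, RealExpr.eval, reg, scalar,
    MachineState.nat_writeNat, MachineState.nat_writeReal, MachineState.real_writeNat, Nat.reduceEqDiff, if_false, e3, e4, e7, e5, w0]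
  refine hQ _ ?_ ?_ ?_ ⟨h.input.congr ?_ ?_ ?_ ?_ ?_, ?_,
    h.mem.insertNode hN0 hp hj hjp h0 ?_ ?_ ?_ ?_ ?_ ?_ ?_, ?_, ?_, ?_, ?_, ?_⟩
  · intro r hr
    simp [setEntry_apply, hr]
  · simp
  · simp [setEntry_apply]
  · simp
  · simp
  · simp
  · simp
  · simp
  · simpa using h.coef
  · simp [setEntry_apply]
  · simp
  · simp
  · simp
  · simp
  · simp
  · simp
  · simp only [MachineState.real_writeNat, MachineState.real_writeReal]
    refine h.der.insertNode (h.mem.trie.insertNode hp hj hjp ?_) (h.zero C le_rfl)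
    rintro x hN hx rfl rfl
    rw [h.mem.child_node x hN hx] at h0
    omega
  · intro x hx
    simpa using h.zero x (by omega)
  · simpa using h.sq
  · simpa using h.wsq
  · simpa using h.cross

/-- On the way from the root `vr i b` down to the node of the term `i` without the variable `vr i b`:
the last `c` variables of the term have been read. Register `3` holds the current node, the
scalar `0` the weight of its children, and there are at most `M` nodes. -/
structure PathState (N k m : ℕ) (len : ℕ → ℕ) (vr : ℕ → ℕ → ℕ) (cf : ℕ → ℝ) (D : ℕ → Finset ℕ)
    (i b c M : ℕ) (s : MachineState) : Prop where
  r0 : s.nat 4 0 0 = i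
  r1 : s.nat 4 1 0 = b
  r2 : s.nat 4 2 0 = c
  r5 : s.nat 4 5 0 = vr i b
  r6 : s.nat 4 6 0 = len i - c
  node : ∃ C par sym own lab, TrieState N k m len vr cf D C par sym own lab s ∧ C ≤ M ∧
    s.nat 4 3 0 < C ∧ own (s.nat 4 3 0) = vr i b ∧
    lab (s.nat 4 3 0) = ((Finset.Ico (len i - c) (len i)).image (vr i)).erase (vr i b) ∧
    (∀ a < len i - c, vr i a < sym (s.nat 4 3 0)) ∧
    s.real 2 0 0 = 3 ^ (lab (s.nat 4 3 0)).card

/-- One step down: skip the variable in register `5`, and for any other one go to the child, which is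
created if it does not exist. -/
def descendProgram : Program :=
  .seq (setReg 6 (.sub (reg 6) (.lit 1)))
  (.branch (.and (.natLe (reg 6) (reg 1)) (.natLe (reg 1) (reg 6))) .skip
    (.seq (setReg 7 (varExpr (reg 0) (reg 6)))
    (.seq (.branch (.natLe (.read 5 (reg 3) (reg 7)) (.lit 0)) insertProgram .skip)
    (.seq (setReg 3 (.read 5 (reg 3) (reg 7)))
      (setScalar 0 (.mul (scalar 0) (.ofNat (.lit 3))))))))

/-- One step reads one more variable and creates at most one node. -/
theorem descendProgram_reaches (ht : TermData N k m len vr) (hN0 : 0 < N) {i b c M : ℕ}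
    (hi : i < m) (hb : b < len i) (hc : c < len i) {s : MachineState}
    (h : PathState N k m len vr cf D i b c M s) :
    Reaches descendProgram s descendProgram.bound fun s' => s'.nat 4 2 0 = c ∧
      PathState N k m len vr cf D i b (c + 1) (M + 1) (s'.writeNat 4 2 0 (c + 1)) := by
  obtain ⟨r0, r1, r2, r5, r6, C, par, sym, own, lab, hT, hCM, hx, ho, hl, hs, hw⟩ := h
  refine Program.reaches _ ?_
  obtain ⟨a, ha⟩ : ∃ a, a = len i - (c + 1) := ⟨_, rfl⟩
  have ha1 : len i - c - 1 = a := by omega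
  have ha2 : a < len i := by omega
  have hIco : Finset.Ico (len i - (c + 1)) (len i) =
      insert a (Finset.Ico (len i - c) (len i)) := by
    ext x; simp only [Finset.mem_Ico, Finset.mem_insert]; omega
  have hvar : s.nat 2 i a + s.nat 2 i a + (s.nat 2 i a + s.nat 2 i a) + s.nat 3 i a = vr i a :=
    hT.input.var_eq i hi a ha2
  have hjN := ht.lt i hi a ha2
  generalize hp : s.nat 4 3 0 = p at *
  have hjp : vr i a < sym p := hs a (by omega)
  simp only [descendProgram, Program.pre, setReg, NatExpr.eval, RealExpr.eval, reg, Test.Holds,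
    MachineState.nat_writeNat, MachineState.nat_writeReal, MachineState.real_writeNat,
    setEntry_apply, Nat.reduceEqDiff, if_true, if_false, and_true, and_self, varExpr, setScalar, scalar, r6, r1, ha1, r0, hvar, hp]
  constructor
  · rintro ⟨h1, h2⟩
    have hab : b = a := by omega
    refine ⟨r2, ?_⟩
    refine ⟨by simpa [setEntry_apply] using r0, by simpa [setEntry_apply] using r1,
      by simp [setEntry_apply], by simpa [setEntry_apply] using r5,
      by simp [setEntry_apply, ha], C, par, sym, own, lab, ?_, by omega, ?_⟩
    · exact hT.congr (fun a ha => by simp [ha]) (by simp [setEntry_apply]) (fun a ha => by simp)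
    · have : ((s.writeNat 4 6 0 a).writeNat 4 2 0 (c + 1)).nat 4 3 0 = p := by
        simpa [setEntry_apply] using hp
      rw [this]
      refine ⟨hx, ho, ?_, fun a' ha' => hs a' (by omega), by simpa using hw⟩
      rw [hl, hIco, Finset.image_insert, hab, Finset.erase_insert_eq_erase]
  · intro hne
    have hab : a ≠ b := fun e => hne ⟨e.le, e.ge⟩
    have hne' : vr i b ≠ vr i a := fun e => hab (ht.injOn hi hb ha2 e).symm
    have hfin : insert (vr i a) (lab p) =
        ((Finset.Ico (len i - (c + 1)) (len i)).image (vr i)).erase (vr i b) := by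
      rw [hl, hIco, Finset.image_insert, Finset.erase_insert_of_ne hne'.symm]
    have hnot : vr i a ∉ lab p := fun hm => absurd (hT.mem.trie.sym_le_of_mem hx _ hm) hjp.not_ge
    have fin : ∀ {C' : ℕ} {par' sym' own' : ℕ → ℕ} {lab' : ℕ → Finset ℕ} {s' : MachineState} {x : ℕ},
        TrieState N k m len vr cf D C' par' sym' own' lab' s' → C' ≤ M + 1 →
        (∀ r, r ≠ 4 → s'.nat 4 r 0 = ((s.writeNat 4 6 0 a).writeNat 4 7 0 (vr i a)).nat 4 r 0) →
        s'.real 2 = s.real 2 → x < C' → own' x = own p → lab' x = insert (vr i a) (lab p) →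
        sym' x = vr i a →
        ((s'.writeNat 4 3 0 x).writeReal 2 0 0 (s'.real 2 0 0 * ((3 : ℕ) : ℝ))).nat 4 2 0 = c ∧
        PathState N k m len vr cf D i b (c + 1) (M + 1)
          (((s'.writeNat 4 3 0 x).writeReal 2 0 0
            (s'.real 2 0 0 * ((3 : ℕ) : ℝ))).writeNat 4 2 0 (c + 1)) := by
      intro C' par' sym' own' lab' s' x hT' hC' hn hr hx' ho' hl' hs'
      have n0 : s'.nat 4 0 0 = i := by rw [hn 0 (by simp)]; simpa [setEntry_apply] using r0
      have n1 : s'.nat 4 1 0 = b := by rw [hn 1 (by simp)]; simpa [setEntry_apply] using r1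
      have n2 : s'.nat 4 2 0 = c := by rw [hn 2 (by simp)]; simpa [setEntry_apply] using r2
      have n5 : s'.nat 4 5 0 = vr i b := by rw [hn 5 (by simp)]; simpa [setEntry_apply] using r5
      have n6 : s'.nat 4 6 0 = a := by rw [hn 6 (by simp)]; simp [setEntry_apply]
      refine ⟨by simpa [setEntry_apply] using n2, by simpa [setEntry_apply] using n0,
        by simpa [setEntry_apply] using n1, by simp [setEntry_apply],
        by simpa [setEntry_apply] using n5, by simpa [setEntry_apply, ha] using n6,
        C', par', sym', own', lab', ?_, hC', ?_⟩
      · exact hT'.congr (fun a ha => by simp [ha]) (by simp [setEntry_apply])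
          (fun a ha => by simp [ha])
      · have : (((s'.writeNat 4 3 0 x).writeReal 2 0 0
            (s'.real 2 0 0 * ((3 : ℕ) : ℝ))).writeNat 4 2 0 (c + 1)).nat 4 3 0 = x := by
          simp [setEntry_apply]
        rw [this]
        refine ⟨hx', ho'.trans ho, hl'.trans hfin, fun a' ha' => ?_, ?_⟩
        · rw [hs']; exact ht.mono i hi _ _ (by omega) ha2
        · rw [hl', Finset.card_insert_of_notMem hnot, pow_succ, ← hw, ← hr]
          simp [setEntry_apply]
    have hT2 : TrieState N k m len vr cf D C par sym own lab
        ((s.writeNat 4 6 0 a).writeNat 4 7 0 (vr i a)) :=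
      hT.congr (fun a ha => by simp [ha]) (by simp [setEntry_apply]) (fun a ha => by simp)
    constructor
    · intro h0
      have hle := hT.mem.trie.le
      refine insertProgram_pre hT2 hN0 (p := p) (j := vr i a) (by simpa [setEntry_apply] using hp)
        (by simp [setEntry_apply]) (by simpa [setEntry_apply, ho] using r5)
        (by simpa using hw) hx hjN hjp (by simpa using Nat.le_zero.1 h0) ?_
      intro s' hn hr h5 hT'
      have n7 : s'.nat 4 7 0 = vr i a := by rw [hn 7 (by simp)]; simp [setEntry_apply]
      have n3 : s'.nat 4 3 0 = p := by rw [hn 3 (by simp)]; simpa [setEntry_apply] using hp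
      rw [n7, n3, h5]
      exact fin hT' (by omega) hn hr (Nat.lt_succ_self C) (by simp) (by simp) (by simp)
    · intro h0
      obtain ⟨h1, h2, h3, h4⟩ := hT.mem.child_inv p (vr i a) (by omega)
      exact fin hT2 (by omega) (fun _ _ => rfl) rfl h2
        (by rw [hT.mem.trie.own_par _ h1 h2, h3])
        (by rw [hT.mem.trie.lab_par _ h1 h2, h3, h4]) h4

/-- The variables of the term `i'` that have been treated before the position `b` of the term `i`. -/
def doneVars (len : ℕ → ℕ) (vr : ℕ → ℕ → ℕ) (i b i' : ℕ) : Finset ℕ :=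
  if i' < i then termSet len vr i' else if i' = i then (Finset.range b).image (vr i) else ∅

theorem doneVars_succ (len : ℕ → ℕ) (vr : ℕ → ℕ → ℕ) (i b : ℕ) :
    doneVars len vr i (b + 1) =
      Function.update (doneVars len vr i b) i (insert (vr i b) (doneVars len vr i b i)) := by
  funext i'
  rcases lt_trichotomy i' i with h | rfl | h
  · simp [doneVars, h, h.ne]
  · simp [doneVars, Finset.range_add_one]
  · simp [doneVars, h.ne', h.not_gt]

theorem doneVars_len (len : ℕ → ℕ) (vr : ℕ → ℕ → ℕ) (i : ℕ) :
    doneVars len vr i (len i) = doneVars len vr (i + 1) 0 := by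
  funext i'
  rcases lt_trichotomy i' i with h | rfl | h
  · simp [doneVars, h, h.trans (Nat.lt_succ_self i)]
  · simp [doneVars, termSet]
  · simp [doneVars, h.ne', h.not_gt, show ¬ i' < i + 1 by omega]

/-- Differentiate the term in register `0` with respect to the variable at the position in
register `1`. -/
def derivativeProgram : Program :=
  .seq (.seq (setReg 5 (varExpr (reg 0) (reg 1)))
    (.seq (setReg 3 (reg 5)) (.seq (setReg 6 (lenExpr (reg 0))) (setScalar 0 (.ofNat (.lit 1))))))
  (.seq (forLoop 2 (lenExpr (reg 0)) descendProgram)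
  (.seq (.setReal 4 (reg 3) (.lit 0)
      (.add (.read 4 (reg 3) (.lit 0)) (.read 3 (reg 0) (.lit 0))))
    (.seq (.setReal 6 (reg 5) (.lit 0) (.add (.read 6 (reg 5) (.lit 0))
        (.mul (.read 3 (reg 0) (.lit 0)) (.read 3 (reg 0) (.lit 0)))))
      (.setReal 7 (reg 5) (.lit 0) (.add (.read 7 (reg 5) (.lit 0))
        (.mul (scalar 0) (.mul (.read 3 (reg 0) (.lit 0)) (.read 3 (reg 0) (.lit 0)))))))))

/-- The memory after the coefficient of the term `i` has been added at the node of its derivative with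
respect to `vr i b`. -/
theorem TrieState.add (ht : TermData N k m len vr) {i b x : ℕ} (hi : i < m) (hb : b < len i)
    {s s' : MachineState}
    (h : TrieState N k m len vr cf (doneVars len vr i b) C par sym own lab s) (hx : x < C)
    (ho : own x = vr i b) (hl : lab x = (termSet len vr i).erase (vr i b))
    (hn : s'.nat = s.nat)
    (hr : ∀ a, a ≠ 4 → a ≠ 6 → a ≠ 7 → s'.real a = s.real a)
    (r4 : s'.real 4 = setEntry (s.real 4) x 0 (s.real 4 x 0 + scaledCoef len cf i))
    (r6 : s'.real 6 = setEntry (s.real 6) (vr i b) 0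
      (s.real 6 (vr i b) 0 + scaledCoef len cf i * scaledCoef len cf i))
    (r7 : s'.real 7 = setEntry (s.real 7) (vr i b) 0 (s.real 7 (vr i b) 0 +
      3 ^ (lab x).card * (scaledCoef len cf i * scaledCoef len cf i))) :
    TrieState N k m len vr cf (doneVars len vr i (b + 1)) C par sym own lab s' := by
  have hv : vr i b ∉ doneVars len vr i b i := by
    simp only [doneVars, lt_irrefl, if_false, if_true, Finset.mem_image, Finset.mem_range, not_exists,
      not_and]
    intro a ha e
    exact ha.ne (ht.injOn hi (by omega) hb e)
  have hmem : vr i b ∈ termSet len vr i := Finset.mem_image_of_mem _ (by simpa using hb)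
  have hsum : ∀ (φ : ℕ → ℝ) (v : ℕ),
      ∑ i' ∈ Finset.range m with v ∈ doneVars len vr i (b + 1) i', φ i' =
      (∑ i' ∈ Finset.range m with v ∈ doneVars len vr i b i', φ i') +
        if v = vr i b then φ i else 0 := by
    intro φ v
    rw [doneVars_succ, Finset.sum_filter, Finset.sum_filter]
    have e2 : (if v = vr i b then φ i else 0) =
        ∑ i' ∈ Finset.range m, if i' = i then (if v = vr i b then φ i else 0) else 0 := by
      rw [Finset.sum_ite_eq' (Finset.range m) i]; simp [hi]
    rw [e2, ← Finset.sum_add_distrib]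
    refine Finset.sum_congr rfl fun i' _ => ?_
    by_cases e : i' = i
    · subst e
      rw [Function.update_self, if_pos rfl]
      by_cases ev : v = vr i' b
      · subst ev; simp [hv]
      · simp [ev]
    · rw [Function.update_of_ne e, if_neg e, add_zero]
  refine ⟨h.input.congr (by rw [hn]) (by rw [hn]) (by rw [hn]) (by rw [hn])
      (hr _ (by simp) (by simp) (by simp)), ?_,
    h.mem.congr (by rw [hn]) (by rw [hn]) (by rw [hn]) (by rw [hn]) (by rw [hn]) (by rw [hn])
      (hr _ (by simp) (by simp) (by simp)), ?_, ?_, ?_, ?_, ?_⟩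
  · rw [hr 3 (by simp) (by simp) (by simp)]; exact h.coef
  · rw [doneVars_succ]
    refine h.der.add h.mem.trie hi hv hx ho hl fun x' => ?_
    rw [r4, setEntry_apply]
    by_cases e : x' = x
    · subst e; simp
    · simp [e]
  · intro x' hx'
    rw [r4, setEntry_apply, if_neg (by omega)]
    exact h.zero x' hx'
  · intro v
    rw [hsum, ← h.sq, r6, setEntry_apply]
    by_cases e : v = vr i b
    · subst e; simp [pow_two]
    · simp [e]
  · intro v
    rw [hsum, ← h.wsq, r7, setEntry_apply, hl, Finset.card_erase_of_mem hmem]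
    by_cases e : v = vr i b
    · subst e; simp [pow_two]
    · simp [e]
  · rw [hr 8 (by simp) (by simp) (by simp)]; exact h.cross

theorem derivativeProgram_reaches (ht : TermData N k m len vr) (hN0 : 0 < N) {i b M : ℕ}
    (hi : i < m) (hb : b < len i) {s : MachineState} (r0 : s.nat 4 0 0 = i) (r1 : s.nat 4 1 0 = b)
    (hT : TrieState N k m len vr cf (doneVars len vr i b) C par sym own lab s) (hM : C ≤ M) :
    Reaches derivativeProgram s (k * 300 + 200) fun s' => s'.nat 4 0 0 = i ∧ s'.nat 4 1 0 = b ∧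
      ∃ C par sym own lab,
        TrieState N k m len vr cf (doneVars len vr i (b + 1)) C par sym own lab s' ∧
        C ≤ M + k := by
  have hvar : s.nat 2 i b + s.nat 2 i b + (s.nat 2 i b + s.nat 2 i b) + s.nat 3 i b = vr i b :=
    hT.input.var_eq i hi b hb
  have hlen : s.nat 1 i 0 = len i := hT.input.len_eq i hi
  have hlk := ht.len_le i hi
  refine ((Program.reaches _ (Q := fun s => PathState N k m len vr cf (doneVars len vr i b) i b 0 M
    (s.writeNat 4 2 0 0)) ?_).seq
    fun s₁ h₁ => (Reaches.forLoop_const (M := len i) descendProgram.bound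
      (fun c s => PathState N k m len vr cf (doneVars len vr i b) i b c (M + c) s) ?_
      (fun c s h => h.r2)
      (fun c hc s h => descendProgram_reaches ht hN0 hi hb hc h) h₁).seq
    fun s₂ h₂ => Program.reaches _ ?_).mono (T := _ + ((len i * _ + _) + _)) ?_ fun _ h => h
  · simp only [Program.pre, setReg, setScalar, NatExpr.eval, RealExpr.eval, reg, varExpr, lenExpr,
      MachineState.nat_writeNat, setEntry_apply, Nat.reduceEqDiff, if_true, if_false, and_true, r0, r1, hvar, hlen]
    have hle := hT.mem.trie.le
    have hv := ht.lt i hi b hb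
    refine ⟨by simpa [setEntry_apply] using r0, by simpa [setEntry_apply] using r1,
      by simp [setEntry_apply], by simp [setEntry_apply], by simp [setEntry_apply],
      C, par, sym, own, lab, hT.congr (fun a ha => by simp [ha]) (by simp [setEntry_apply])
        (fun a ha => by simp [ha]), hM, ?_⟩
    have : (((((s.writeNat 4 5 0 (vr i b)).writeNat 4 3 0 (vr i b)).writeNat 4 6 0
        (len i)).writeReal 2 0 0 ((1 : ℕ) : ℝ)).writeNat 4 2 0 0).nat 4 3 0 = vr i b := by
      simp [setEntry_apply]
    rw [this, hT.mem.trie.own_root _ hv, hT.mem.trie.lab_root _ hv, hT.mem.trie.sym_root _ hv]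
    refine ⟨by omega, rfl, by simp, fun a ha => ht.lt i hi a (by omega), ?_⟩
    simp [setEntry_apply]
  · intro c s h
    obtain ⟨C, par, sym, own, lab, hT, -⟩ := h.node
    have := hT.input.len_eq i hi
    simpa [lenExpr, NatExpr.eval, reg, h.r0] using this
  · obtain ⟨r0, r1, r2, r5, r6, C, par, sym, own, lab, hT, hCM, hx, ho, hl, hs, hw⟩ := h₂
    generalize hp : s₂.nat 4 3 0 = p at *
    have hg := hT.coef i hi
    simp only [Program.pre, NatExpr.eval, RealExpr.eval, reg, scalar,
      MachineState.nat_writeReal, MachineState.real_writeReal, Nat.reduceEqDiff, if_false, r0, r5, hp, hg, hw]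
    refine ⟨trivial, r1, C, par, sym, own, lab, ?_, by omega⟩
    refine hT.add ht hi hb hx ho ?_ (by simp) (fun a h4 h6 h7 => by simp [h4, h6, h7]) (by simp)
      (by simp) (by simp)
    rw [hl, termSet, Finset.range_eq_Ico, Nat.sub_self]
  · simp only [descendProgram, insertProgram, Program.bound, NatExpr.cost, RealExpr.cost, Test.cost,
      reg, scalar, lenExpr, setReg, setScalar, varExpr]
    have := Nat.mul_le_mul_right 300 hlk
    omega

/-- Build the trie. -/
def buildProgram : Program :=
  .seq (setReg 4 boundExpr) (forLoop 0 countExpr (forLoop 1 (lenExpr (reg 0)) derivativeProgram))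

theorem buildProgram_reaches (ht : TermData N k m len vr) (hN0 : 0 < N) {s : MachineState}
    (hI : Input N k m len vr cf s) (hF : Fresh s)
    (hg : ∀ i < m, s.real 3 i 0 = scaledCoef len cf i) :
    Reaches buildProgram s (m * (k * (k * 300 + 230) + 50) + 50) fun s' =>
      ∃ C par sym own lab, TrieState N k m len vr cf (doneVars len vr m 0) C par sym own lab s' ∧
        C ≤ N + m * (k * k) := by
  have hinv : ∀ {i b M r : ℕ} {s : MachineState}, (∃ C par sym own lab,
      TrieState N k m len vr cf (doneVars len vr i b) C par sym own lab s ∧ C ≤ M) → r ≠ 4 →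
      ∀ c, ∃ C par sym own lab, TrieState N k m len vr cf (doneVars len vr i b) C par sym own lab
        (s.writeNat 4 r 0 c) ∧ C ≤ M := by
    rintro i b M r s ⟨C, par, sym, own, lab, h, hM⟩ hr c
    exact ⟨C, par, sym, own, lab, h.congr (fun a ha => by simp [ha])
      (by simp [setEntry_apply, hr.symm]) (fun a ha => by simp), hM⟩
  have inner : ∀ i < m, ∀ s : MachineState, s.nat 4 0 0 = i → (∃ C par sym own lab,
      TrieState N k m len vr cf (doneVars len vr i 0) C par sym own lab s ∧ C ≤ N + i * (k * k)) →
      Reaches (forLoop 1 (lenExpr (reg 0)) derivativeProgram) s (k * (k * 300 + 230) + 30)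
        fun s' => s'.nat 4 0 0 = i ∧ ∃ C par sym own lab,
          TrieState N k m len vr cf (doneVars len vr (i + 1) 0) C par sym own lab s' ∧
          C ≤ N + (i + 1) * (k * k) := by
    intro i hi s h0 hs
    refine (Reaches.forLoop_const (M := len i) (k * 300 + 200) (fun b s => s.nat 4 0 0 = i ∧
      s.nat 4 1 0 = b ∧ ∃ C par sym own lab,
      TrieState N k m len vr cf (doneVars len vr i b) C par sym own lab s ∧
        C ≤ N + i * (k * k) + b * k) ?_ ?_ ?_ ?_).mono ?_ ?_
    · rintro b s ⟨h0, -, C, par, sym, own, lab, hT, -⟩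
      simpa [lenExpr, NatExpr.eval, reg, h0] using hT.input.len_eq i hi
    · exact fun b s h => h.2.1
    · rintro b hb s ⟨h0, h1, C, par, sym, own, lab, hT, hC⟩
      refine (derivativeProgram_reaches ht hN0 hi hb h0 h1 hT hC).mono le_rfl ?_
      rintro s' ⟨h0, h1, h⟩
      refine ⟨h1, by simpa [setEntry_apply] using h0, by simp [setEntry_apply], ?_⟩
      have := hinv h (r := 1) (by simp) (b + 1)
      rwa [Nat.add_assoc, ← Nat.succ_mul] at this
    · refine ⟨by simpa [setEntry_apply] using h0, by simp [setEntry_apply], ?_⟩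
      simpa using hinv hs (r := 1) (by simp) 0
    · have hk := ht.len_le i hi
      simp only [NatExpr.cost, reg, lenExpr]
      have := Nat.mul_le_mul_right (k * 300 + 230) hk
      have h2 : len i * (k * 300 + 200 + (1 + 1 + 1 + 1 + 1 + 14)) ≤ len i * (k * 300 + 230) :=
        Nat.mul_le_mul_left _ (by omega)
      exact (Nat.add_le_add_right (h2.trans this) _).trans (Nat.add_le_add_left (by norm_num) _)
    · rintro s ⟨h0, -, C, par, sym, own, lab, hT, hC⟩
      refine ⟨h0, C, par, sym, own, lab, doneVars_len len vr i ▸ hT, ?_⟩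
      have := Nat.mul_le_mul_right k (ht.len_le i hi)
      rw [Nat.succ_mul]
      omega
  refine ((Program.reaches _ (Q := fun s => ∃ C par sym own lab,
    TrieState N k m len vr cf (doneVars len vr 0 0) C par sym own lab s ∧ C ≤ N) ?_).seq
    fun s₁ h₁ => Reaches.forLoop_const (M := m) (k * (k * 300 + 230) + 30)
      (fun i s => s.nat 4 0 0 = i ∧ ∃ C par sym own lab,
        TrieState N k m len vr cf (doneVars len vr i 0) C par sym own lab s ∧
          C ≤ N + i * (k * k)) ?_ ?_ ?_ ?_).mono ?_ fun s h => h.2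
  · have hN : boundExpr.eval s = N := hI.bound
    have hz : ∀ v, doneVars len vr 0 0 v = ∅ := fun v => by simp [doneVars]
    simp only [Program.pre, setReg, NatExpr.eval, hN]
    refine ⟨N, fun _ => 0, fun _ => N, fun x => x, fun _ => ∅, ⟨hI.congr (by simp) (by simp)
      (by simp) (by simp) (by simp), by simpa using hg, ⟨⟨le_rfl, by simp, by simp, by simp, ?_, ?_,
        ?_, ?_, ?_, ?_⟩, by simp [setEntry_apply], ?_, ?_, ?_, ?_, ?_, ?_, ?_⟩, ⟨?_, ?_⟩, ?_, ?_, ?_,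
        ?_⟩, le_rfl⟩
    · intro x a b; omega
    · intro x a b; omega
    · intro x a b; omega
    · intro x a b; omega
    · intro x a b; omega
    · intro x x' a b; omega
    · intro x a b; omega
    · simp [hF.1 5 le_rfl]
    · intro x a b; omega
    · intro x a b; omega
    · intro x a b; omega
    · intro j hj
      have e : {x | N ≤ x ∧ x < N ∧ N = j} = (∅ : Set ℕ) := by
        ext x; simp only [Set.mem_ofPred_eq, Set.mem_empty_iff_false, iff_false]; omega
      rw [e]
      simp [hF.1 9 (by simp)]
    · simp [hF.1 9 (by simp)]
    · simp [hz]
    · simp [hz, hF.2 4 (by simp)]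
    · simp [hF.2 4 (by simp)]
    · simp [hz, hF.2 6 (by simp)]
    · simp [hz, hF.2 7 (by simp)]
    · simp [hF.2 8 (by simp)]
  · rintro i s ⟨-, C, par, sym, own, lab, hT, -⟩
    exact hT.input.count
  · exact fun i s h => h.1
  · rintro i hi s ⟨h0, h⟩
    refine (inner i hi s h0 h).mono le_rfl ?_
    rintro s' ⟨h0, h⟩
    exact ⟨h0, by simp [setEntry_apply], hinv h (by simp) _⟩
  · refine ⟨by simp [setEntry_apply], ?_⟩
    simpa using hinv h₁ (r := 0) (by simp) 0
  · simp only [Program.bound, setReg, NatExpr.cost, countExpr, boundExpr]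
    generalize k * (k * 300 + 230) = κ
    have : m * (κ + 30 + (1 + 1 + 1 + 14)) ≤ m * (κ + 50) :=
      Nat.mul_le_mul_left _ (by omega)
    omega

end

/-! ### Choosing the signs one after the other -/

/-- What does not change while the signs are chosen: the input and the trie, with the lists `ent` of
the nodes with a given symbol and their lengths `cnt`, the norms `b` and the constant `μ`. -/
structure SweepData (N k m : ℕ) (len : ℕ → ℕ) (vr : ℕ → ℕ → ℕ) (cf : ℕ → ℝ) (C : ℕ)
    (par sym own : ℕ → ℕ) (lab : ℕ → Finset ℕ) (ent cnt : ℕ → ℕ → ℕ) (b : ℕ → ℝ) (μ : ℝ)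
    (s : MachineState) : Prop where
  input : Input N k m len vr cf s
  coef : ∀ i < m, s.real 3 i 0 = scaledCoef len cf i
  mem : TrieMem N C par sym own lab s
  ent_eq : s.nat 8 = ent
  cnt_eq : s.nat 9 = cnt
  norm : ∀ v, √(s.real 6 v 0) = b v
  mu : s.real 2 1 0 = μ

/-- The first `c` nodes with symbol `j`. -/
def processed (ent : ℕ → ℕ → ℕ) (j c : ℕ) : Finset ℕ := (Finset.range c).image (ent j)

section

variable {N k m : ℕ} {len : ℕ → ℕ} {vr : ℕ → ℕ → ℕ} {cf : ℕ → ℝ} {C : ℕ} {par sym own : ℕ → ℕ}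
  {lab : ℕ → Finset ℕ} {ent cnt : ℕ → ℕ → ℕ} {b : ℕ → ℝ} {μ : ℝ}

theorem SweepData.congr {s s' : MachineState}
    (h : SweepData N k m len vr cf C par sym own lab ent cnt b μ s)
    (hn : ∀ a, a ≠ 4 → s'.nat a = s.nat a) (h4 : s'.nat 4 4 0 = s.nat 4 4 0)
    (r0 : s'.real 0 = s.real 0) (r3 : s'.real 3 = s.real 3) (r5 : s'.real 5 = s.real 5)
    (r6 : s'.real 6 = s.real 6) (r2 : s'.real 2 1 0 = s.real 2 1 0) :
    SweepData N k m len vr cf C par sym own lab ent cnt b μ s' where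
  input := h.input.congr (hn _ (by simp)) (hn _ (by simp)) (hn _ (by simp)) (hn _ (by simp)) r0
  coef := r3 ▸ h.coef
  mem := h.mem.congr h4 (hn _ (by simp)) (hn _ (by simp)) (hn _ (by simp)) (hn _ (by simp))
    (hn _ (by simp)) r5
  ent_eq := (hn 8 (by simp)).trans h.ent_eq
  cnt_eq := (hn 9 (by simp)).trans h.cnt_eq
  norm := r6 ▸ h.norm
  mu := r2.trans h.mu

theorem SweepData.level {s : MachineState}
    (h : SweepData N k m len vr cf C par sym own lab ent cnt b μ s) {j : ℕ} (hj : j < N) :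
    Set.BijOn (ent j) (Set.Iio (cnt j 0)) {x | N ≤ x ∧ x < C ∧ sym x = j} := by
  have := h.mem.level j hj
  rwa [h.ent_eq, h.cnt_eq] at this

theorem SweepData.ent_notMem {s : MachineState}
    (h : SweepData N k m len vr cf C par sym own lab ent cnt b μ s) {j c : ℕ} (hj : j < N)
    (hc : c < cnt j 0) : ent j c ∉ processed ent j c := by
  simp only [processed, Finset.mem_image, Finset.mem_range, not_exists, not_and]
  intro c' hc' e
  exact hc'.ne ((h.level hj).injOn (hc'.trans hc) hc e)

theorem SweepData.processed_eq {s : MachineState}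
    (h : SweepData N k m len vr cf C par sym own lab ent cnt b μ s) {j : ℕ} (hj : j < N) :
    processed ent j (cnt j 0) = levelNodes C sym j := by
  ext x
  have hB := h.level hj
  simp only [processed, levelNodes, Finset.mem_image, Finset.mem_range, Finset.mem_filter]
  constructor
  · rintro ⟨c, hc, rfl⟩
    exact (hB.mapsTo hc).2
  · rintro ⟨hx, hs⟩
    have hN : N ≤ x := by
      by_contra hN
      have := h.mem.trie.sym_root x (not_le.1 hN)
      omega
    obtain ⟨c, hc, e⟩ := hB.surjOn ⟨hN, hx, hs⟩
    exact ⟨c, hc, e⟩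

theorem processed_succ (ent : ℕ → ℕ → ℕ) (j c : ℕ) :
    processed ent j (c + 1) = insert (ent j c) (processed ent j c) := by
  rw [processed, Finset.range_add_one, Finset.image_insert, processed]

theorem sum_filter_insert {A : Finset ℕ} {x : ℕ} (hx : x ∉ A) (f : ℕ → ℕ) (F : ℕ → ℝ) (v : ℕ) :
    ∑ x' ∈ insert x A with f x' = v, F x' =
      (∑ x' ∈ A with f x' = v, F x') + if v = f x then F x else 0 := by
  rw [Finset.filter_insert]
  by_cases e : f x = v
  · rw [if_pos e, if_pos e.symm, Finset.sum_insert (by simp [hx]), add_comm]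
  · rw [if_neg e, if_neg fun e' => e e'.symm, add_zero]

theorem filter_levelNodes (C : ℕ) (sym own : ℕ → ℕ) (j v : ℕ) :
    (levelNodes C sym j).filter (fun x => own x = v) = symNodes C sym own j v := by
  rw [levelNodes, symNodes, Finset.filter_filter]

/-- Load the current node, its parent and its root into the registers `3`, `6` and `5`. -/
def loadProgram : Program :=
  .seq (setReg 3 (.read 8 (reg 0) (reg 1)))
    (.seq (setReg 6 (.read 6 (reg 3) (.lit 0))) (setReg 5 (.read 7 (reg 3) (.lit 0))))

theorem loadProgram_pre {s : MachineState}
    (h : SweepData N k m len vr cf C par sym own lab ent cnt b μ s) {j c : ℕ} (hj : j < N)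
    (hc : c < cnt j 0) (r0 : s.nat 4 0 0 = j) (r1 : s.nat 4 1 0 = c) {Q : MachineState → Prop}
    (hQ : ∀ s' x, x = ent j c → N ≤ x → x < C → sym x = j → s'.real = s.real →
      s'.nat 4 0 0 = j → s'.nat 4 1 0 = c → s'.nat 4 3 0 = x → s'.nat 4 6 0 = par x →
      s'.nat 4 5 0 = own x → SweepData N k m len vr cf C par sym own lab ent cnt b μ s' → Q s') :
    loadProgram.pre Q s := by
  obtain ⟨hN, hC, hs⟩ := (h.level hj).mapsTo hc
  have e := h.ent_eq
  have hp := h.mem.par_eq _ hN hC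
  have ho := h.mem.own_eq _ hN hC
  simp only [loadProgram, Program.pre, setReg, NatExpr.eval, reg, MachineState.nat_writeNat,
    setEntry_apply, Nat.reduceEqDiff, if_true, if_false, and_true, r0, r1, e, hp, ho]
  refine hQ _ (ent j c) rfl hN hC hs ?_ ?_ ?_ ?_ ?_ ?_ (h.congr ?_ ?_ ?_ ?_ ?_ ?_ ?_)
  · simp
  · simpa [setEntry_apply] using r0
  · simpa [setEntry_apply] using r1
  · simp [setEntry_apply]
  · simp [setEntry_apply]
  · simp [setEntry_apply]
  · intro a ha
    simp [ha]
  · simp [setEntry_apply]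
  · simp
  · simp
  · simp
  · simp
  · simp

/-- The first pass over the nodes with symbol `j` computes the slope of the potential. -/
structure SlopeState (N k m : ℕ) (len : ℕ → ℕ) (vr : ℕ → ℕ → ℕ) (cf : ℕ → ℝ) (C : ℕ)
    (par sym own : ℕ → ℕ) (lab : ℕ → Finset ℕ) (ent cnt : ℕ → ℕ → ℕ) (b : ℕ → ℝ) (μ : ℝ)
    (τ M y : ℕ → ℝ) (j c : ℕ) (s : MachineState) : Prop where
  data : SweepData N k m len vr cf C par sym own lab ent cnt b μ s
  r0 : s.nat 4 0 0 = j
  r1 : s.nat 4 1 0 = c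
  coeff : ∀ x, s.real 4 x 0 = τ x
  signs : ∀ w, s.real 9 w 0 = y w
  norms : ∀ v, s.real 7 v 0 =
    M v - 2 * ∑ x ∈ processed ent j c with own x = v, parWeight par lab x * τ x ^ 2
  cross : ∀ v, s.real 8 v 0 =
    ∑ x ∈ processed ent j c with own x = v, parWeight par lab x * τ (par x) * τ x
  slope : s.real 2 0 0 = ∑ v ∈ Finset.range N,
    ((∑ x ∈ processed ent j c with own x = v, τ (par x) * τ x) / b v -
      2 * μ * (M v - 2 * ∑ x ∈ processed ent j c with own x = v, parWeight par lab x * τ x ^ 2) *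
      (∑ x ∈ processed ent j c with own x = v, parWeight par lab x * τ (par x) * τ x) / b v ^ 3)

/-- Read the coefficient of the node in a register. -/
def coeffExpr (r : ℕ) : RealExpr := .read 4 (reg r) (.lit 0)

/-- Read the `a`-th array at the root in register `5`. -/
def rootExpr (a : ℕ) : RealExpr := .read a (reg 5) (.lit 0)

/-- Treat one node in the first pass. The increment of the slope is the difference of the new and the
old summand of the tree, so that a tree is charged only for its nodes with the current symbol. -/
def slopeProgram : Program :=
  .seq loadProgram
  (.seq (setScalar 2 (.mul (coeffExpr 6) (coeffExpr 3)))
  (.seq (setScalar 3 (.mul (.read 5 (reg 3) (.lit 0)) (.mul (coeffExpr 3) (coeffExpr 3))))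
  (.seq (setScalar 4 (.sqrt (rootExpr 6)))
  (.seq (setScalar 5 (.mul (.read 5 (reg 3) (.lit 0)) (scalar 2)))
  (.seq (setScalar 0 (.sub (.add (scalar 0) (.div (scalar 2) (scalar 4)))
      (.div (.mul (.mul (.ofNat (.lit 2)) (scalar 1))
        (.sub (.mul (.sub (rootExpr 7) (.mul (.ofNat (.lit 2)) (scalar 3)))
            (.add (rootExpr 8) (scalar 5)))
          (.mul (rootExpr 7) (rootExpr 8))))
        (.mul (.mul (scalar 4) (scalar 4)) (scalar 4)))))
  (.seq (.setReal 7 (reg 5) (.lit 0) (.sub (rootExpr 7) (.mul (.ofNat (.lit 2)) (scalar 3))))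
    (.setReal 8 (reg 5) (.lit 0) (.add (rootExpr 8) (scalar 5)))))))))

theorem slopeProgram_reaches {τ M y : ℕ → ℝ} {j c : ℕ} (hj : j < N) (hc : c < cnt j 0)
    {s : MachineState}
    (h : SlopeState N k m len vr cf C par sym own lab ent cnt b μ τ M y j c s) :
    Reaches slopeProgram s slopeProgram.bound fun s' => s'.nat 4 1 0 = c ∧
      SlopeState N k m len vr cf C par sym own lab ent cnt b μ τ M y j (c + 1)
        (s'.writeNat 4 1 0 (c + 1)) := by
  refine Program.reaches _ ?_
  have hx := h.data.ent_notMem hj hc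
  unfold slopeProgram
  rw [Program.pre]
  refine loadProgram_pre h.data hj hc h.r0 h.r1 ?_
  intro s' x hxe hN hC hs hr r0 r1 r3 r6 r5 hd
  rw [← hxe] at hx
  have ho : own x < N := h.data.mem.trie.own_lt hC
  have hw := hd.mem.weight_eq x hN hC
  have hb := hd.norm (own x)
  have hmu := hd.mu
  have e4 : ∀ x, s'.real 4 x 0 = τ x := hr ▸ h.coeff
  have e7 := hr ▸ h.norms
  have e8 := hr ▸ h.cross
  have e2 := hr ▸ h.slope
  simp only [Program.pre, setScalar, NatExpr.eval, RealExpr.eval, reg, scalar, coeffExpr, rootExpr,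
    MachineState.nat_writeReal, MachineState.real_writeReal, setEntry_apply, Nat.reduceEqDiff,
    if_true, if_false, and_true, r3, r6, r5, hw, hb, hmu, e4]
  refine ⟨r1, hd.congr ?_ ?_ ?_ ?_ ?_ ?_ ?_, ?_, ?_, ?_, ?_, ?_, ?_, ?_⟩
  · intro a ha
    simp [ha]
  · simp [setEntry_apply]
  · simp
  · simp
  · simp
  · simp
  · simp [setEntry_apply]
  · simpa [setEntry_apply] using r0
  · simp [setEntry_apply]
  · simpa [setEntry_apply] using e4
  · simpa [setEntry_apply, hr] using h.signs
  · intro v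
    rw [processed_succ, ← hxe, sum_filter_insert hx]
    by_cases e : v = own x
    · subst e
      simp [setEntry_apply, e7]
      ring
    · simp [setEntry_apply, e, e7]
  · intro v
    rw [processed_succ, ← hxe, sum_filter_insert hx]
    by_cases e : v = own x
    · subst e
      simp [setEntry_apply, e8]
      ring
    · simp [setEntry_apply, e, e8]
  · rw [processed_succ, ← hxe]
    simp only [sum_filter_insert hx]
    simp only [MachineState.real_writeNat, MachineState.real_writeReal, setEntry_apply,
      Nat.reduceEqDiff, if_true, if_false, and_true, e2, e7, e8]
    have key : ∀ v, ((∑ x' ∈ processed ent j c with own x' = v, τ (par x') * τ x') +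
          (if v = own x then τ (par x) * τ x else 0)) / b v -
        2 * μ * (M v - 2 * ((∑ x' ∈ processed ent j c with own x' = v, parWeight par lab x' * τ x' ^ 2) +
          if v = own x then parWeight par lab x * τ x ^ 2 else 0)) *
        ((∑ x' ∈ processed ent j c with own x' = v, parWeight par lab x' * τ (par x') * τ x') +
          if v = own x then parWeight par lab x * τ (par x) * τ x else 0) / b v ^ 3 =
        ((∑ x' ∈ processed ent j c with own x' = v, τ (par x') * τ x') / b v -
        2 * μ * (M v - 2 * ∑ x' ∈ processed ent j c with own x' = v, parWeight par lab x' * τ x' ^ 2) *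
        (∑ x' ∈ processed ent j c with own x' = v, parWeight par lab x' * τ (par x') * τ x') /
          b v ^ 3) +
        if v = own x then τ (par x) * τ x / b v - 2 * μ *
          ((M v - 2 * (∑ x' ∈ processed ent j c with own x' = v, parWeight par lab x' * τ x' ^ 2) -
            2 * (parWeight par lab x * τ x ^ 2)) *
          ((∑ x' ∈ processed ent j c with own x' = v, parWeight par lab x' * τ (par x') * τ x') +
            parWeight par lab x * τ (par x) * τ x) -
          (M v - 2 * ∑ x' ∈ processed ent j c with own x' = v, parWeight par lab x' * τ x' ^ 2) *
          ∑ x' ∈ processed ent j c with own x' = v, parWeight par lab x' * τ (par x') * τ x') /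
          b v ^ 3 else 0 := by
      intro v
      by_cases e : v = own x
      · simp only [e, if_true]; ring
      · simp [e]
    rw [Finset.sum_congr rfl fun v _ => key v, Finset.sum_add_distrib, Finset.sum_ite_eq',
      if_pos (by simpa using ho)]
    push_cast
    ring

/-- The second pass over the nodes with symbol `j` gives the value `y j` to the variable `j`. A tree may
be met several times; its norm is updated at the first time only, because its auxiliary sum is then
set to zero. -/
structure MoveState (N k m : ℕ) (len : ℕ → ℕ) (vr : ℕ → ℕ → ℕ) (cf : ℕ → ℝ) (C : ℕ)
    (par sym own : ℕ → ℕ) (lab : ℕ → Finset ℕ) (ent cnt : ℕ → ℕ → ℕ) (b : ℕ → ℝ) (μ : ℝ)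
    (τ M y : ℕ → ℝ) (j c : ℕ) (s : MachineState) : Prop where
  data : SweepData N k m len vr cf C par sym own lab ent cnt b μ s
  r0 : s.nat 4 0 0 = j
  r1 : s.nat 4 1 0 = c
  coeff : ∀ p, s.real 4 p 0 = τ p + y j * ∑ x ∈ processed ent j c with par x = p, τ x
  signs : ∀ w, s.real 9 w 0 = y w
  norms : ∀ v, s.real 7 v 0 + 2 * y j * s.real 8 v 0 = M v
  cross : ∀ x ∈ processed ent j c, s.real 8 (own x) 0 = 0
  cross_or : ∀ v, s.real 8 v 0 = 0 ∨ ∃ x ∈ levelNodes C sym j, own x = v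

/-- Treat one node in the second pass. -/
def moveProgram : Program :=
  .seq loadProgram
  (.seq (.setReal 7 (reg 5) (.lit 0) (.add (rootExpr 7)
      (.mul (.mul (.ofNat (.lit 2)) (.read 9 (reg 0) (.lit 0))) (rootExpr 8))))
  (.seq (.setReal 8 (reg 5) (.lit 0) (.ofNat (.lit 0)))
    (.setReal 4 (reg 6) (.lit 0)
      (.add (coeffExpr 6) (.mul (.read 9 (reg 0) (.lit 0)) (coeffExpr 3))))))

theorem moveProgram_reaches {τ M y : ℕ → ℝ} {j c : ℕ} (hj : j < N) (hc : c < cnt j 0)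
    {s : MachineState}
    (h : MoveState N k m len vr cf C par sym own lab ent cnt b μ τ M y j c s) :
    Reaches moveProgram s moveProgram.bound fun s' => s'.nat 4 1 0 = c ∧
      MoveState N k m len vr cf C par sym own lab ent cnt b μ τ M y j (c + 1)
        (s'.writeNat 4 1 0 (c + 1)) := by
  refine Program.reaches _ ?_
  have hx := h.data.ent_notMem hj hc
  have hx0 : s.real 4 (ent j c) 0 = τ (ent j c) := by
    rw [h.coeff, Finset.sum_eq_zero, mul_zero, add_zero]
    intro x' hx'
    exfalso
    -- The symbol of a parent is larger than `j`, so no coefficient of the level has been changed.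
    simp only [processed, Finset.mem_filter, Finset.mem_image, Finset.mem_range] at hx'
    obtain ⟨⟨c', hc', rfl⟩, he⟩ := hx'
    obtain ⟨h1, h2, h3⟩ := (h.data.level hj).mapsTo (Set.mem_Iio.2 (hc'.trans hc))
    obtain ⟨h1', h2', h3'⟩ := (h.data.level hj).mapsTo (Set.mem_Iio.2 hc)
    have := h.data.mem.trie.sym_lt_par _ h1 h2
    rw [he] at this
    omega
  unfold moveProgram
  rw [Program.pre]
  refine loadProgram_pre h.data hj hc h.r0 h.r1 ?_
  intro s' x hxe hN hC hs hr r0 r1 r3 r6 r5 hd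
  rw [← hxe] at hx hx0
  have e4 := hr ▸ h.coeff
  have e7 := hr ▸ h.norms
  have e8 := hr ▸ h.cross
  have e8' := hr ▸ h.cross_or
  have e9 : ∀ w, s'.real 9 w 0 = y w := hr ▸ h.signs
  rw [← hr] at hx0
  simp only [Program.pre, NatExpr.eval, RealExpr.eval, reg, coeffExpr, rootExpr,
    MachineState.nat_writeReal, MachineState.real_writeReal, Nat.reduceEqDiff,
    if_false, r0, r3, r6, r5, e9, hx0]
  refine ⟨r1, hd.congr ?_ ?_ ?_ ?_ ?_ ?_ ?_, ?_, ?_, ?_, ?_, ?_, ?_, ?_⟩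
  · intro a ha
    simp [ha]
  · simp [setEntry_apply]
  · simp
  · simp
  · simp
  · simp
  · simp
  · simpa [setEntry_apply] using r0
  · simp [setEntry_apply]
  · intro p
    rw [processed_succ, ← hxe, sum_filter_insert hx]
    by_cases e : p = par x
    · subst e
      simp [setEntry_apply, e4]
      ring
    · simp [setEntry_apply, e, e4]
  · simpa [setEntry_apply] using e9
  · intro v
    rw [← e7 v]
    by_cases e : v = own x
    · subst e
      simp [setEntry_apply]
    · simp [setEntry_apply, e]
  · intro x' hx'
    rw [processed_succ, ← hxe, Finset.mem_insert] at hx'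
    by_cases e : own x' = own x
    · simp [setEntry_apply, e]
    · rcases hx' with rfl | hx'
      · exact absurd rfl e
      · simpa [setEntry_apply, e] using e8 x' hx'
  · intro v
    by_cases e : v = own x
    · simp [setEntry_apply, e]
    · simpa [setEntry_apply, e] using e8' v

/-- The variables below `j` have been given the values in the real array `9`, starting from the
coefficients `τ₀`, and the potential has not decreased. -/
structure SweepState (N k m : ℕ) (len : ℕ → ℕ) (vr : ℕ → ℕ → ℕ) (cf : ℕ → ℝ) (C : ℕ)
    (par sym own : ℕ → ℕ) (lab : ℕ → Finset ℕ) (ent cnt : ℕ → ℕ → ℕ) (b : ℕ → ℝ) (μ : ℝ)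
    (τ₀ : ℕ → ℝ) (j : ℕ) (s : MachineState) : Prop where
  data : SweepData N k m len vr cf C par sym own lab ent cnt b μ s
  r0 : s.nat 4 0 0 = j
  cross : ∀ v, s.real 8 v 0 = 0
  norms : ∀ v, s.real 7 v 0 = weightedNormSq C sym own lab j (fun x => s.real 4 x 0) v
  pot : potential N C sym own lab b μ 0 τ₀ ≤ potential N C sym own lab b μ j fun x => s.real 4 x 0
  value : ∀ z : ℕ → ℝ, (∀ w < j, z w = s.real 9 w 0) → ∀ v,
    treeValue C sym own lab 0 τ₀ z v = treeValue C sym own lab j (fun x => s.real 4 x 0) z v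
  sign : ∀ w < j, s.real 9 w 0 = 1 ∨ s.real 9 w 0 = -1

/-- Choose the sign of the variable in register `0`. -/
def levelProgram : Program :=
  .seq (setScalar 0 (.ofNat (.lit 0)))
  (.seq (forLoop 1 (.read 9 (reg 0) (.lit 0)) slopeProgram)
  (.seq (.branch (.realLe (.ofNat (.lit 0)) (scalar 0))
      (.setReal 9 (reg 0) (.lit 0) (.ofNat (.lit 1)))
      (.setReal 9 (reg 0) (.lit 0) (.sub (.ofNat (.lit 0)) (.ofNat (.lit 1)))))
    (forLoop 1 (.read 9 (reg 0) (.lit 0)) moveProgram)))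

theorem levelProgram_reaches (hb : ∀ v, 0 ≤ b v) (hμ : 0 ≤ μ) {τ₀ : ℕ → ℝ} {j : ℕ} (hj : j < N)
    {s : MachineState}
    (h : SweepState N k m len vr cf C par sym own lab ent cnt b μ τ₀ j s) :
    Reaches levelProgram s (cnt j 0 * 300 + 130) fun s' => s'.nat 4 0 0 = j ∧
      SweepState N k m len vr cf C par sym own lab ent cnt b μ τ₀ (j + 1)
        (s'.writeNat 4 0 0 (j + 1)) := by
  obtain ⟨τ, hτ⟩ : ∃ τ : ℕ → ℝ, τ = fun x => s.real 4 x 0 := ⟨_, rfl⟩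
  obtain ⟨y, hy⟩ : ∃ y : ℕ → ℝ, y = fun w => s.real 9 w 0 := ⟨_, rfl⟩
  obtain ⟨M, hM⟩ : ∃ M : ℕ → ℝ, M = weightedNormSq C sym own lab j τ := ⟨_, rfl⟩
  have hp0 : processed ent j 0 = ∅ := by simp [processed]
  have hpl := h.data.processed_eq hj
  have htr := h.data.mem.trie
  have hcnt : ∀ s : MachineState, SweepData N k m len vr cf C par sym own lab ent cnt b μ s →
      s.nat 4 0 0 = j → (NatExpr.read 9 (reg 0) (.lit 0)).eval s = cnt j 0 := by
    intro s hd r0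
    simp only [NatExpr.eval, reg, r0, hd.cnt_eq]
  refine ((Program.reaches _ (Q := fun s => SlopeState N k m len vr cf C par sym own lab ent cnt b μ
      τ M y j 0 (s.writeNat 4 1 0 0)) ?_).seq
    fun s₁ h₁ => (Reaches.forLoop_const (M := cnt j 0) slopeProgram.bound
      (fun c s => SlopeState N k m len vr cf C par sym own lab ent cnt b μ τ M y j c s)
      (fun c s h => hcnt s h.data h.r0) (fun c s h => h.r1)
      (fun c hc s h => slopeProgram_reaches hj hc h) h₁).seq
    fun s₂ h₂ => (Program.reaches _ (Q := fun s => ∃ y' : ℕ → ℝ, (∀ w, w ≠ j → y' w = y w) ∧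
      (y' j = 1 ∨ y' j = -1) ∧ 0 ≤ y' j * potentialSlope N C par sym own lab b μ j τ ∧
      MoveState N k m len vr cf C par sym own lab ent cnt b μ τ
        (weightedNormSq C sym own lab (j + 1) (substitute C par sym j (y' j) τ)) y' j 0
        (s.writeNat 4 1 0 0)) ?_).seq
    fun s₃ h₃ => ?_).mono
      (T := _ + ((cnt j 0 * _ + _) + (_ + (cnt j 0 * (moveProgram.bound +
        ((NatExpr.read 9 (reg 0) (.lit 0)).cost + 14)) +
        ((NatExpr.read 9 (reg 0) (.lit 0)).cost + 14))))) ?_ fun _ h => h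
  · simp only [Program.pre, setScalar, NatExpr.eval, RealExpr.eval]
    refine ⟨h.data.congr ?_ ?_ ?_ ?_ ?_ ?_ ?_, ?_, ?_, ?_, ?_, ?_, ?_, ?_⟩
    · intro a ha
      simp [ha]
    · simp [setEntry_apply]
    · simp
    · simp
    · simp
    · simp
    · simp [setEntry_apply]
    · simpa [setEntry_apply] using h.r0
    · simp [setEntry_apply]
    · simp [hτ]
    · simp [hy]
    · simp [hp0, h.norms, hM, hτ]
    · simp [hp0, h.cross]
    · simp [hp0, setEntry_apply]
  · have hslope : s₂.real 2 0 0 = potentialSlope N C par sym own lab b μ j τ := by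
      rw [h₂.slope, hpl]
      simp only [filter_levelNodes, hM, potentialSlope]
    have aux : ∀ (y₀ : ℝ), y₀ = 1 ∨ y₀ = -1 →
        0 ≤ y₀ * potentialSlope N C par sym own lab b μ j τ →
        ∃ y' : ℕ → ℝ, (∀ w, w ≠ j → y' w = y w) ∧
        (y' j = 1 ∨ y' j = -1) ∧ 0 ≤ y' j * potentialSlope N C par sym own lab b μ j τ ∧
        MoveState N k m len vr cf C par sym own lab ent cnt b μ τ
          (weightedNormSq C sym own lab (j + 1) (substitute C par sym j (y' j) τ)) y' j 0
          ((s₂.writeReal 9 j 0 y₀).writeNat 4 1 0 0) := by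
      intro y₀ hy₀ hpos
      refine ⟨Function.update y j y₀, fun w hw => Function.update_of_ne hw _ _, by simpa using hy₀,
        by simpa using hpos, h₂.data.congr ?_ ?_ ?_ ?_ ?_ ?_ ?_, ?_, ?_, ?_, ?_, ?_, ?_, ?_⟩
      · intro a ha
        simp [ha]
      · simp [setEntry_apply]
      · simp
      · simp
      · simp
      · simp
      · simp
      · simpa [setEntry_apply] using h₂.r0
      · simp [setEntry_apply]
      · simpa [hp0] using h₂.coeff
      · intro w
        by_cases e : w = j
        · subst e; simp [setEntry_apply]
        · simpa [setEntry_apply, e] using h₂.signs w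
      · intro v
        rw [Function.update_self, htr.weightedNormSq_substitute hj τ (by
          rcases hy₀ with rfl | rfl <;> norm_num)]
        simp only [MachineState.real_writeNat, MachineState.real_writeReal, Nat.reduceEqDiff,
          if_false, h₂.norms, h₂.cross, hpl, filter_levelNodes, hM]
      · simp [hp0]
      · intro v
        simp only [MachineState.real_writeNat, MachineState.real_writeReal, Nat.reduceEqDiff,
          if_false, h₂.cross, hpl]
        by_cases hv : ∃ x ∈ levelNodes C sym j, own x = v
        · exact Or.inr hv
        · left
          rw [Finset.filter_false_of_mem fun x hx e => hv ⟨x, hx, e⟩, Finset.sum_empty]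
    simp only [Program.pre, NatExpr.eval, RealExpr.eval, Test.Holds, scalar, reg, h₂.r0, hslope]
    refine ⟨fun hpos => aux _ (Or.inl (by simp)) ?_, fun hneg => aux _ (Or.inr (by simp)) ?_⟩
    · simpa using hpos
    · simp only [Nat.cast_zero, not_le] at hneg
      push_cast
      linarith
  · obtain ⟨y', hy', hsign, hpos, hmove⟩ := h₃
    refine (Reaches.forLoop_const (M := cnt j 0) moveProgram.bound
      (fun c s => MoveState N k m len vr cf C par sym own lab ent cnt b μ τ
        (weightedNormSq C sym own lab (j + 1) (substitute C par sym j (y' j) τ)) y' j c s)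
      (fun c s h => hcnt s h.data h.r0) (fun c s h => h.r1)
      (fun c hc s h => moveProgram_reaches hj hc h) hmove).mono le_rfl ?_
    intro s' h'
    have hsq : y' j ^ 2 = 1 := by rcases hsign with e | e <;> rw [e] <;> norm_num
    have hT : (fun x => s'.real 4 x 0) = substitute C par sym j (y' j) τ := by
      funext p
      rw [h'.coeff, hpl, substitute]
    have hcross : ∀ v, s'.real 8 v 0 = 0 := by
      intro v
      rcases h'.cross_or v with e | ⟨x, hx, rfl⟩
      · exact e
      · exact h'.cross x (hpl ▸ hx)
    refine ⟨h'.r0, h'.data.congr ?_ ?_ ?_ ?_ ?_ ?_ ?_, ?_, ?_, ?_, ?_, ?_, ?_⟩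
    · intro a ha
      simp [ha]
    · simp [setEntry_apply]
    · simp
    · simp
    · simp
    · simp
    · simp
    · simp [setEntry_apply]
    · simpa using hcross
    · intro v
      simp only [MachineState.real_writeNat, hT]
      rw [← h'.norms v, hcross]
      ring
    · simp only [MachineState.real_writeNat, hT]
      refine h.pot.trans ?_
      rw [← hτ]
      exact htr.potential_le hj hb hμ τ hsq hpos
    · intro z hz v
      simp only [MachineState.real_writeNat, hT] at hz ⊢
      have hzj : z j = y' j := by rw [hz j (by omega), h'.signs]
      rw [← hzj, htr.treeValue_substitute hj τ z, h.value z _ v, ← hτ]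
      intro w hw
      rw [hz w (by omega), h'.signs, hy' w hw.ne, hy]
    · intro w hw
      simp only [MachineState.real_writeNat, h'.signs]
      by_cases e : w = j
      · subst e; exact hsign
      · rw [hy' w e, hy]
        exact h.sign w (by omega)
  · simp only [Program.bound, NatExpr.cost, RealExpr.cost, Test.cost, slopeProgram, moveProgram,
      loadProgram, setReg, setScalar, reg, scalar, coeffExpr, rootExpr]
    omega

/-- Choose the signs of all variables. -/
def sweepProgram : Program := forLoop 0 boundExpr levelProgram

theorem sweepProgram_reaches (hb : ∀ v, 0 ≤ b v) (hμ : 0 ≤ μ) {τ₀ : ℕ → ℝ} {s : MachineState}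
    (h : SweepState N k m len vr cf C par sym own lab ent cnt b μ τ₀ 0 (s.writeNat 4 0 0 0)) :
    Reaches sweepProgram s (C * 300 + N * 200 + 50) fun s' =>
      SweepState N k m len vr cf C par sym own lab ent cnt b μ τ₀ N s' := by
  refine (Reaches.forLoop (M := N) (fun j => cnt j 0 * 300 + 130)
    (fun j s => SweepState N k m len vr cf C par sym own lab ent cnt b μ τ₀ j s)
    (fun j s h => h.data.input.bound) (fun j s h => h.r0)
    (fun j hj s h => levelProgram_reaches hb hμ hj h) h).mono ?_ fun _ h => h
  have ht := h.data.mem.total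
  rw [h.data.cnt_eq] at ht
  simp only [boundExpr, NatExpr.cost]
  rw [Finset.sum_add_distrib, Finset.sum_add_distrib, ← Finset.sum_mul]
  simp only [Finset.sum_const, Finset.card_range, smul_eq_mul]
  omega

end

section

variable {N k m : ℕ} {len : ℕ → ℕ} {vr : ℕ → ℕ → ℕ} {cf : ℕ → ℝ}

/-- Compute the constant `μ = 1 / (3 r ^ 2) = 3 / 9 ^ k` of the potential, where `r = 3 ^ (k - 1)`. -/
def scaleProgram : Program :=
  .seq (setScalar 1 (.ofNat (.lit 3)))
    (forLoop 0 (.read 0 (.lit 1) (.lit 0)) (setScalar 1 (.div (scalar 1) (.ofNat (.lit 9)))))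

theorem scaleProgram_reaches {D : ℕ → Finset ℕ} {C : ℕ} {par sym own : ℕ → ℕ}
    {lab : ℕ → Finset ℕ} {s : MachineState}
    (h : TrieState N k m len vr cf D C par sym own lab s) :
    Reaches scaleProgram s (k * 40 + 40) fun s' =>
      TrieState N k m len vr cf D C par sym own lab s' ∧ s'.real 2 1 0 = 3 / 9 ^ k := by
  refine ((Program.reaches _ (Q := fun s => TrieState N k m len vr cf D C par sym own lab s ∧
    s.real 2 1 0 = 3) ?_).seq fun s₁ h₁ => Reaches.forLoop_const (M := k) (Program.bound
    (setScalar 1 (.div (scalar 1) (.ofNat (.lit 9)))))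
    (fun a s => s.nat 4 0 0 = a ∧ TrieState N k m len vr cf D C par sym own lab s ∧
      s.real 2 1 0 = 3 / 9 ^ a) ?_ ?_ ?_ ?_).mono ?_ fun s h => h.2
  · simp only [Program.pre, setScalar, NatExpr.eval, RealExpr.eval]
    exact ⟨h.congr (fun a ha => by simp) (by simp) (fun a ha => by simp [ha]),
      by simp [setEntry_apply]⟩
  · exact fun a s h => h.2.1.input.loc
  · exact fun a s h => h.1
  · rintro a - s ⟨h0, hT, h1⟩
    refine Program.reaches _ ?_
    simp only [Program.pre, setScalar, NatExpr.eval, RealExpr.eval, scalar, h1]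
    refine ⟨by simpa using h0, by simp [setEntry_apply], hT.congr (fun a ha => by simp [ha])
      (by simp [setEntry_apply]) (fun a ha => by simp [ha]), ?_⟩
    simp [setEntry_apply, pow_succ, div_div]
  · exact ⟨by simp [setEntry_apply], h₁.1.congr (fun a ha => by simp [ha])
      (by simp [setEntry_apply]) (fun a ha => by simp), by simpa using h₁.2⟩
  · simp only [Program.bound, setScalar, scalar, NatExpr.cost, RealExpr.cost]
    omega

theorem StoresDerivatives.congr {C : ℕ} {own : ℕ → ℕ} {lab : ℕ → Finset ℕ} {D D' S : ℕ → Finset ℕ}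
    {g τ : ℕ → ℝ} (h : StoresDerivatives C own lab m D S g τ) (hD : ∀ i < m, D' i = D i) :
    StoresDerivatives C own lab m D' S g τ := by
  refine ⟨fun i hi v hv => h.cover i hi v (hD i hi ▸ hv), fun x hx => ?_⟩
  rw [h.val x hx]
  refine Finset.sum_congr (Finset.filter_congr fun i hi => ?_) fun _ _ => rfl
  rw [hD i (by simpa using hi)]

/-- The signs in the real array `9` make the sum of the absolute values of the derivatives at this
point, which are in the real array `4`, large. -/
structure SignsState (N k m : ℕ) (len : ℕ → ℕ) (vr : ℕ → ℕ → ℕ) (cf : ℕ → ℝ) (s : MachineState) :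
    Prop where
  input : Input N k m len vr cf s
  coef : ∀ i < m, s.real 3 i 0 = scaledCoef len cf i
  sign : ∀ w < N, s.real 9 w 0 = 1 ∨ s.real 9 w 0 = -1
  deriv : ∀ v < N, s.real 4 v 0 = ∑ i ∈ Finset.range m with v ∈ termSet len vr i,
    scaledCoef len cf i * ∏ w ∈ (termSet len vr i).erase v, s.real 9 w 0
  large : ∑ v ∈ Finset.range N,
      √(∑ i ∈ Finset.range m with v ∈ termSet len vr i, scaledCoef len cf i ^ 2) ≤
    3 ^ (k - 1) * ∑ v ∈ Finset.range N, |s.real 4 v 0|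

/-- Find the signs. -/
def signsProgram : Program := .seq buildProgram (.seq scaleProgram sweepProgram)

theorem signsProgram_reaches (ht : TermData N k m len vr) (hN0 : 0 < N) (hk : 1 ≤ k)
    {s : MachineState} (hI : Input N k m len vr cf s) (hF : Fresh s)
    (hg : ∀ i < m, s.real 3 i 0 = scaledCoef len cf i) :
    Reaches signsProgram s (m * (k * (k * 300 + 230) + 50) + 50 + (k * 40 + 40 +
      ((N + m * (k * k)) * 300 + N * 200 + 50))) (SignsState N k m len vr cf) := by
  refine (buildProgram_reaches ht hN0 hI hF hg).seq ?_
  rintro s₁ ⟨C, par, sym, own, lab, hT, hC⟩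
  refine (scaleProgram_reaches hT).seq ?_
  rintro s₂ ⟨hT, hμ⟩
  have hS : ∀ i < m, termSet len vr i = doneVars len vr m 0 i := fun i hi => by simp [doneVars, hi]
  have hder := hT.der.congr hS
  have htr := hT.mem.trie
  obtain ⟨b, hb⟩ : ∃ b : ℕ → ℝ, b = fun v => √(s₂.real 6 v 0) := ⟨_, rfl⟩
  have hb0 : ∀ v, 0 ≤ b v := fun v => by rw [hb]; exact Real.sqrt_nonneg _
  have hfilt : ∀ (φ : ℕ → ℝ) v, ∑ i ∈ Finset.range m with v ∈ doneVars len vr m 0 i, φ i =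
      ∑ i ∈ Finset.range m with v ∈ termSet len vr i, φ i := fun φ v =>
    Finset.sum_congr (Finset.filter_congr fun i hi => by rw [hS i (by simpa using hi)])
      fun _ _ => rfl
  have hbv : ∀ v, b v = √(∑ i ∈ Finset.range m with v ∈ termSet len vr i,
      scaledCoef len cf i ^ 2) := fun v => by rw [hb]; simp only [hT.sq, hfilt]
  have hbsq : ∀ v, normSq C sym own 0 (fun x => s₂.real 4 x 0) v = b v ^ 2 := fun v => by
    rw [hder.normSq_eq htr ht.inj, hbv, Real.sq_sqrt (Finset.sum_nonneg fun i _ => sq_nonneg _)]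
  have hμ' : s₂.real 2 1 0 = 1 / (3 * (3 ^ (k - 1)) ^ 2) := by
    obtain ⟨k, rfl⟩ : ∃ l, k = l + 1 := ⟨k - 1, by omega⟩
    rw [hμ, Nat.add_sub_cancel, ← pow_mul, mul_comm k 2, pow_mul, pow_succ]
    norm_num
    field_simp
    norm_num
  refine (sweepProgram_reaches (N := N) (τ₀ := fun x => s₂.real 4 x 0) (ent := s₂.nat 8)
    (cnt := s₂.nat 9) hb0 (μ := 1 / (3 * (3 ^ (k - 1)) ^ 2)) (by positivity)
    ⟨⟨hT.input.congr ?_ ?_ ?_ ?_ ?_, ?_, hT.mem.congr ?_ ?_ ?_ ?_ ?_ ?_ ?_, ?_, ?_, ?_, ?_⟩,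
      ?_, ?_, ?_, ?_, ?_, ?_⟩).mono ?_ ?_
  · simp
  · simp
  · simp
  · simp
  · simp
  · simpa using hT.coef
  · simp [setEntry_apply]
  · simp
  · simp
  · simp
  · simp
  · simp
  · simp
  · simp
  · simp
  · simp [hb]
  · simpa using hμ'
  · simp [setEntry_apply]
  · simpa using hT.cross
  · intro v
    simp only [MachineState.real_writeNat]
    rw [hT.wsq, hfilt, hder.weightedNormSq_eq htr ht.inj]
  · exact le_rfl
  · intro z _ v
    rfl
  · intro w hw
    omega
  · omega
  · intro s₃ h
    have hval : ∀ v < N, s₃.real 4 v 0 = ∑ i ∈ Finset.range m with v ∈ termSet len vr i,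
        scaledCoef len cf i * ∏ w ∈ (termSet len vr i).erase v, s₃.real 9 w 0 := fun v hv => by
      have := h.value (fun w => s₃.real 9 w 0) (fun w _ => rfl) v
      rw [hder.treeValue_eq htr ht.inj, treeValue, htr.liveNodes_last hv, Finset.sum_singleton,
        htr.lab_root v hv, Finset.prod_empty, mul_one] at this
      exact this.symm
    refine ⟨h.data.input, h.data.coef, h.sign, hval, ?_⟩
    simp only [← hbv]
    refine htr.sum_abs_ge hb0 (by positivity) (fun v _ => hbsq v) (fun v _ => ?_) h.pot
      fun v hv h0 => ?_
    · rw [hder.weightedNormSq_eq htr ht.inj, ← hbsq, hder.normSq_eq htr ht.inj, Finset.mul_sum]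
      refine Finset.sum_le_sum fun i hi => mul_le_mul_of_nonneg_right ?_ (sq_nonneg _)
      refine pow_le_pow_right₀ (by norm_num) (Nat.sub_le_sub_right ?_ 1)
      exact (ht.card (by simpa using (Finset.mem_filter.1 hi).1)).le.trans
        (ht.len_le i (by simpa using (Finset.mem_filter.1 hi).1))
    · have hz : ∀ i ∈ (Finset.range m).filter (fun i => v ∈ termSet len vr i),
          scaledCoef len cf i ^ 2 = 0 := by
        rw [hbv, Real.sqrt_eq_zero (Finset.sum_nonneg fun i _ => sq_nonneg _)] at h0
        exact (Finset.sum_eq_zero_iff_of_nonneg fun i _ => sq_nonneg _).1 h0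
      change s₃.real 4 v 0 = 0
      rw [hval v hv]
      refine Finset.sum_eq_zero fun i hi => ?_
      rw [pow_eq_zero_iff (two_ne_zero) |>.1 (hz i hi), zero_mul]

end

/-! ### Choosing a point on a line -/

section

variable {N k m : ℕ} {len : ℕ → ℕ} {vr : ℕ → ℕ → ℕ} {cf : ℕ → ℝ} {y σ : ℕ → ℝ}

/-- The value at the point `y + t * σ` of the polynomial with the rescaled coefficients. -/
def lineValue (m : ℕ) (len : ℕ → ℕ) (vr : ℕ → ℕ → ℕ) (cf : ℕ → ℝ) (y σ : ℕ → ℝ) (t : ℝ) : ℝ :=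
  ∑ i ∈ Finset.range m, scaledCoef len cf i * ∏ w ∈ termSet len vr i, (y w + t * σ w)

/-- The memory holds the input, the rescaled coefficients and a line. -/
structure LineState (N k m : ℕ) (len : ℕ → ℕ) (vr : ℕ → ℕ → ℕ) (cf : ℕ → ℝ) (y σ : ℕ → ℝ)
    (s : MachineState) : Prop where
  input : Input N k m len vr cf s
  coef : ∀ i < m, s.real 3 i 0 = scaledCoef len cf i
  base : ∀ w, s.real 9 w 0 = y w
  direction : ∀ w, s.real 10 w 0 = σ w

theorem LineState.congr {s s' : MachineState} (h : LineState N k m len vr cf y σ s)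
    (hn : ∀ a, a ≠ 4 → s'.nat a = s.nat a) (hr : ∀ a, a ≠ 2 → s'.real a = s.real a) :
    LineState N k m len vr cf y σ s' where
  input := h.input.congr (hn _ (by simp)) (hn _ (by simp)) (hn _ (by simp)) (hn _ (by simp))
    (hr _ (by simp))
  coef := hr 3 (by simp) ▸ h.coef
  base := hr 9 (by simp) ▸ h.base
  direction := hr 10 (by simp) ▸ h.direction

/-- Store the signs of the derivatives. -/
def directionProgram : Program :=
  forLoop 0 boundExpr (.branch (.realLe (.ofNat (.lit 0)) (.read 4 (reg 0) (.lit 0)))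
    (.setReal 10 (reg 0) (.lit 0) (.ofNat (.lit 1)))
    (.setReal 10 (reg 0) (.lit 0) (.sub (.ofNat (.lit 0)) (.ofNat (.lit 1)))))

theorem directionProgram_reaches {s : MachineState} (h : SignsState N k m len vr cf s) :
    Reaches directionProgram s (N * 100 + 50) fun s' => ∃ y σ,
      LineState N k m len vr cf y σ s' ∧ (∀ w < N, y w = 1 ∨ y w = -1) ∧
      (∀ w < N, σ w = 1 ∨ σ w = -1) ∧
      ∑ v ∈ Finset.range N, √(∑ i ∈ Finset.range m with v ∈ termSet len vr i,
          scaledCoef len cf i ^ 2) ≤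
        3 ^ (k - 1) * ∑ v ∈ Finset.range N, σ v *
          ∑ i ∈ Finset.range m with v ∈ termSet len vr i,
            scaledCoef len cf i * ∏ w ∈ (termSet len vr i).erase v, y w := by
  refine (Reaches.forLoop_const (M := N) (Program.bound (.branch (.realLe (.ofNat (.lit 0))
    (.read 4 (reg 0) (.lit 0))) (.setReal 10 (reg 0) (.lit 0) (.ofNat (.lit 1)))
    (.setReal 10 (reg 0) (.lit 0) (.sub (.ofNat (.lit 0)) (.ofNat (.lit 1))))))
    (fun j s => s.nat 4 0 0 = j ∧ SignsState N k m len vr cf s ∧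
      ∀ w < j, (s.real 10 w 0 = 1 ∨ s.real 10 w 0 = -1) ∧ |s.real 4 w 0| =
        s.real 10 w 0 * s.real 4 w 0) ?_ ?_ ?_ ?_).mono ?_ ?_
  · exact fun j s h => h.2.1.input.bound
  · exact fun j s h => h.1
  · rintro j hj s ⟨h0, hS, h⟩
    refine Program.reaches _ ?_
    have aux : ∀ x : ℝ, x = 1 ∨ x = -1 → |s.real 4 j 0| = x * s.real 4 j 0 →
        (s.writeReal 10 j 0 x).nat 4 0 0 = j ∧
        ((s.writeReal 10 j 0 x).writeNat 4 0 0 (j + 1)).nat 4 0 0 = j + 1 ∧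
        SignsState N k m len vr cf ((s.writeReal 10 j 0 x).writeNat 4 0 0 (j + 1)) ∧
        ∀ w < j + 1, (((s.writeReal 10 j 0 x).writeNat 4 0 0 (j + 1)).real 10 w 0 = 1 ∨
          ((s.writeReal 10 j 0 x).writeNat 4 0 0 (j + 1)).real 10 w 0 = -1) ∧
          |((s.writeReal 10 j 0 x).writeNat 4 0 0 (j + 1)).real 4 w 0| =
          ((s.writeReal 10 j 0 x).writeNat 4 0 0 (j + 1)).real 10 w 0 *
          ((s.writeReal 10 j 0 x).writeNat 4 0 0 (j + 1)).real 4 w 0 := by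
      intro x hx hx'
      refine ⟨by simpa using h0, by simp [setEntry_apply], ⟨hS.input.congr (by simp) (by simp)
        (by simp) (by simp) (by simp), by simpa using hS.coef, by simpa using hS.sign,
        by simpa using hS.deriv, by simpa using hS.large⟩, fun w hw => ?_⟩
      by_cases e : w = j
      · subst e
        simpa [setEntry_apply] using ⟨hx, hx'⟩
      · simpa [setEntry_apply, e] using h w (by omega)
    simp only [Program.pre, NatExpr.eval, RealExpr.eval, Test.Holds, reg, h0]
    refine ⟨fun hp => aux _ (Or.inl (by simp)) ?_, fun hp => aux _ (Or.inr (by simp)) ?_⟩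
    · rw [abs_of_nonneg (by simpa using hp)]; simp
    · rw [abs_of_neg (by simpa using hp)]; simp
  · refine ⟨by simp [setEntry_apply], ⟨h.input.congr (by simp) (by simp)
        (by simp) (by simp) (by simp), by simpa using h.coef, by simpa using h.sign,
        by simpa using h.deriv, by simpa using h.large⟩, fun w hw => by omega⟩
  · simp only [Program.bound, NatExpr.cost, RealExpr.cost, Test.cost, boundExpr, reg]
    omega
  · rintro s ⟨-, hS, h⟩
    refine ⟨fun w => s.real 9 w 0, fun w => s.real 10 w 0, ⟨hS.input, hS.coef, fun _ => rfl,
      fun _ => rfl⟩, hS.sign, fun w hw => (h w hw).1, hS.large.trans_eq ?_⟩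
    congr 1
    refine Finset.sum_congr rfl fun v hv => ?_
    have hv := Finset.mem_range.1 hv
    rw [(h v hv).2, hS.deriv v hv]

/-- Add the value of the term in register `1` to the scalar `0`. -/
def termProgram : Program :=
  .seq (setScalar 4 (.read 3 (reg 1) (.lit 0)))
  (.seq (forLoop 2 (lenExpr (reg 1)) (.seq (setReg 5 (varExpr (reg 1) (reg 2)))
      (setScalar 4 (.mul (scalar 4) (.add (.read 9 (reg 5) (.lit 0))
        (.mul (scalar 1) (.read 10 (reg 5) (.lit 0))))))))
    (setScalar 0 (.add (scalar 0) (scalar 4))))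

/-- What stays fixed while the polynomial is evaluated: the line, the number of the current node
and the scalars `1`, `2`, `3`. -/
structure EvalState (N k m : ℕ) (len : ℕ → ℕ) (vr : ℕ → ℕ → ℕ) (cf : ℕ → ℝ) (y σ : ℕ → ℝ)
    (c : ℕ) (t best tb : ℝ) (s : MachineState) : Prop where
  line : LineState N k m len vr cf y σ s
  r0 : s.nat 4 0 0 = c
  node : s.real 2 1 0 = t
  best_eq : s.real 2 2 0 = best
  arg_eq : s.real 2 3 0 = tb

theorem EvalState.congr {c : ℕ} {t best tb : ℝ} {s s' : MachineState}
    (h : EvalState N k m len vr cf y σ c t best tb s)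
    (hn : ∀ a, a ≠ 4 → s'.nat a = s.nat a) (hr : ∀ a, a ≠ 2 → s'.real a = s.real a)
    (n0 : s'.nat 4 0 0 = s.nat 4 0 0) (r1 : s'.real 2 1 0 = s.real 2 1 0)
    (r2 : s'.real 2 2 0 = s.real 2 2 0) (r3 : s'.real 2 3 0 = s.real 2 3 0) :
    EvalState N k m len vr cf y σ c t best tb s' where
  line := h.line.congr hn hr
  r0 := n0.trans h.r0
  node := r1.trans h.node
  best_eq := r2.trans h.best_eq
  arg_eq := r3.trans h.arg_eq

theorem termProgram_reaches (ht : TermData N k m len vr) {c i : ℕ} {t best tb v : ℝ} (hi : i < m)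
    {s : MachineState} (h : EvalState N k m len vr cf y σ c t best tb s) (r1 : s.nat 4 1 0 = i)
    (hv : s.real 2 0 0 = v) :
    Reaches termProgram s (k * 100 + 60) fun s' =>
      EvalState N k m len vr cf y σ c t best tb s' ∧ s'.nat 4 1 0 = i ∧
      s'.real 2 0 0 = v + scaledCoef len cf i * ∏ w ∈ termSet len vr i, (y w + t * σ w) := by
  refine ((Program.reaches _ (Q := fun s => EvalState N k m len vr cf y σ c t best tb s ∧
      s.nat 4 1 0 = i ∧ s.real 2 0 0 = v ∧ s.real 2 4 0 = scaledCoef len cf i) ?_).seq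
    fun s₁ h₁ => (Reaches.forLoop_const (M := len i) (Program.bound
      (.seq (setReg 5 (varExpr (reg 1) (reg 2)))
        (setScalar 4 (.mul (scalar 4) (.add (.read 9 (reg 5) (.lit 0))
        (.mul (scalar 1) (.read 10 (reg 5) (.lit 0))))))))
      (fun a s => s.nat 4 2 0 = a ∧ EvalState N k m len vr cf y σ c t best tb s ∧
        s.nat 4 1 0 = i ∧ s.real 2 0 0 = v ∧ s.real 2 4 0 = scaledCoef len cf i *
          ∏ a ∈ Finset.range a, (y (vr i a) + t * σ (vr i a))) ?_ (fun a s h => h.1) ?_ ?_).seq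
    fun s₂ h₂ => Program.reaches _ ?_).mono (T := _ + ((len i * _ + _) + _)) ?_ fun _ h => h
  · have := h.line.coef i hi
    simp only [Program.pre, setScalar, NatExpr.eval, RealExpr.eval, reg, r1, this]
    exact ⟨h.congr (by simp) (fun a ha => by simp [ha]) (by simp) (by simp [setEntry_apply])
      (by simp [setEntry_apply]) (by simp [setEntry_apply]), by simpa using r1,
      by simpa [setEntry_apply] using hv, by simp [setEntry_apply]⟩
  · rintro a s ⟨-, hE, r1, -⟩
    simpa [lenExpr, NatExpr.eval, reg, r1] using hE.line.input.len_eq i hi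
  · rintro a ha s ⟨r2, hE, r1, hv, hp⟩
    have hvar : s.nat 2 i a + s.nat 2 i a + (s.nat 2 i a + s.nat 2 i a) + s.nat 3 i a = vr i a :=
      hE.line.input.var_eq i hi a ha
    refine Program.reaches _ ?_
    simp only [Program.pre, setReg, setScalar, NatExpr.eval, RealExpr.eval, reg, scalar, varExpr,
      MachineState.nat_writeNat, MachineState.real_writeNat, setEntry_apply, if_true, and_self, r1,
      r2, hvar, hp, hE.line.base, hE.line.direction, hE.node]
    refine ⟨by simpa [setEntry_apply] using r2, by simp,
      hE.congr (fun a ha => by simp [ha]) (fun a ha => by simp [ha]) (by simp [setEntry_apply])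
      (by simp [setEntry_apply]) (by simp [setEntry_apply]) (by simp [setEntry_apply]),
      by simpa [setEntry_apply] using r1, by simpa [setEntry_apply] using hv, ?_⟩
    rw [Finset.prod_range_succ]
    simp [setEntry_apply, mul_assoc]
  · obtain ⟨hE, r1, hv, hp⟩ := h₁
    exact ⟨by simp [setEntry_apply], hE.congr (fun a ha => by simp [ha]) (fun a ha => by simp)
      (by simp [setEntry_apply]) (by simp) (by simp) (by simp),
      by simpa [setEntry_apply] using r1, by simpa using hv, by simpa using hp⟩
  · obtain ⟨-, hE, r1, hv, hp⟩ := h₂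
    simp only [Program.pre, setScalar, NatExpr.eval, RealExpr.eval, scalar, hv, hp]
    refine ⟨hE.congr (by simp) (fun a ha => by simp [ha]) (by simp) (by simp [setEntry_apply])
      (by simp [setEntry_apply]) (by simp [setEntry_apply]), by simpa using r1, ?_⟩
    rw [termSet, Finset.prod_image fun a ha a' ha' e =>
      ht.injOn hi (by simpa using ha) (by simpa using ha') e]
    simp [setEntry_apply]
  · have := Nat.mul_le_mul_right 100 (ht.len_le i hi)
    simp only [Program.bound, NatExpr.cost, RealExpr.cost, reg, scalar, lenExpr, setReg, setScalar,
      varExpr]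
    omega

/-- Evaluate the polynomial at the current node and go to the next node. -/
def nodeProgram : Program :=
  .seq (setScalar 0 (.ofNat (.lit 0)))
  (.seq (forLoop 1 countExpr termProgram)
  (.seq (.branch (.realLe (scalar 2) (.mul (scalar 0) (scalar 0)))
      (.seq (setScalar 2 (.mul (scalar 0) (scalar 0))) (setScalar 3 (scalar 1))) .skip)
    (.branch (.realLe (.ofNat (.lit 0)) (scalar 1))
      (setScalar 1 (.sub (.ofNat (.lit 0)) (scalar 1)))
      (setScalar 1 (.div (.sub (.ofNat (.lit 0)) (scalar 1)) (.ofNat (.lit 2)))))))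

/-- Among the first `c` nodes, the value of the polynomial is largest at the node in the
scalar `3`. -/
structure NodeState (N k m : ℕ) (len : ℕ → ℕ) (vr : ℕ → ℕ → ℕ) (cf : ℕ → ℝ) (y σ : ℕ → ℝ)
    (c : ℕ) (s : MachineState) : Prop where
  line : LineState N k m len vr cf y σ s
  r0 : s.nat 4 0 0 = c
  node : s.real 2 1 0 = scaleNode c
  best : s.real 2 2 0 = if c = 0 then 0 else lineValue m len vr cf y σ (s.real 2 3 0) ^ 2
  le_best : ∀ c' < c, lineValue m len vr cf y σ (scaleNode c') ^ 2 ≤ s.real 2 2 0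
  arg : |s.real 2 3 0| ≤ 1

theorem nodeProgram_reaches (ht : TermData N k m len vr) {c : ℕ} {s : MachineState}
    (h : NodeState N k m len vr cf y σ c s) :
    Reaches nodeProgram s (m * (k * 100 + 80) + 100) fun s' => s'.nat 4 0 0 = c ∧
      NodeState N k m len vr cf y σ (c + 1) (s'.writeNat 4 0 0 (c + 1)) := by
  obtain ⟨best, hb⟩ : ∃ x, s.real 2 2 0 = x := ⟨_, rfl⟩
  obtain ⟨tb, htb⟩ : ∃ x, s.real 2 3 0 = x := ⟨_, rfl⟩
  have hbest := h.best
  have hle := h.le_best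
  have harg := h.arg
  rw [hb] at hbest hle
  rw [htb] at hbest harg
  refine ((Program.reaches _ (Q := fun s => EvalState N k m len vr cf y σ c (scaleNode c) best tb s ∧
      s.real 2 0 0 = 0) ?_).seq
    fun s₁ h₁ => (Reaches.forLoop_const (M := m) (k * 100 + 60)
      (fun i s => EvalState N k m len vr cf y σ c (scaleNode c) best tb s ∧ s.nat 4 1 0 = i ∧
        s.real 2 0 0 = ∑ i ∈ Finset.range i, scaledCoef len cf i *
          ∏ w ∈ termSet len vr i, (y w + scaleNode c * σ w)) ?_ (fun i s h => h.2.1) ?_ ?_).seq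
    fun s₂ h₂ => (Program.reaches _ (Q := fun s => LineState N k m len vr cf y σ s ∧
      s.nat 4 0 0 = c ∧ s.real 2 1 0 = scaleNode c ∧
      s.real 2 2 0 = lineValue m len vr cf y σ (s.real 2 3 0) ^ 2 ∧
      (∀ c' < c + 1, lineValue m len vr cf y σ (scaleNode c') ^ 2 ≤ s.real 2 2 0) ∧
      |s.real 2 3 0| ≤ 1) ?_).seq fun s₃ h₃ => Program.reaches _ ?_).mono
      (T := _ + ((m * _ + _) + (_ + _))) ?_ fun _ h => h
  · simp only [Program.pre, setScalar, NatExpr.eval, RealExpr.eval]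
    exact ⟨⟨h.line.congr (by simp) (fun a ha => by simp [ha]), by simpa using h.r0,
      by simpa [setEntry_apply] using h.node, by simpa [setEntry_apply] using hb,
      by simpa [setEntry_apply] using htb⟩, by simp [setEntry_apply]⟩
  · exact fun i s h => h.1.line.input.count
  · rintro i hi s ⟨hE, r1, hv⟩
    refine (termProgram_reaches ht hi hE r1 hv).mono le_rfl ?_
    rintro s' ⟨hE, r1, hv⟩
    exact ⟨r1, hE.congr (fun a ha => by simp [ha]) (fun a ha => by simp)
      (by simp [setEntry_apply]) (by simp) (by simp) (by simp), by simp [setEntry_apply],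
      by rw [Finset.sum_range_succ]; simpa using hv⟩
  · exact ⟨h₁.1.congr (fun a ha => by simp [ha]) (fun a ha => by simp)
      (by simp [setEntry_apply]) (by simp) (by simp) (by simp), by simp [setEntry_apply],
      by simpa using h₁.2⟩
  · obtain ⟨hE, -, hv⟩ := h₂
    change _ = lineValue m len vr cf y σ (scaleNode c) at hv
    have hlt : ∀ {c'}, c' < c + 1 → c' < c ∨ c' = c := fun h => by omega
    simp only [Program.pre, setScalar, NatExpr.eval, RealExpr.eval, Test.Holds, scalar,
      MachineState.real_writeReal, setEntry_apply, if_true, and_true, hv, hE.best_eq, hE.node]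
    constructor
    · intro hl
      refine ⟨hE.line.congr (by simp) (fun a ha => by simp [ha]), by simpa using hE.r0,
        by simp, by simp [pow_two],
        fun c' hc' => ?_, by simpa [setEntry_apply] using abs_scaleNode_le c⟩
      rcases hlt hc' with h | rfl
      · simpa [setEntry_apply] using (hle c' h).trans hl
      · simp [pow_two]
    · intro hl
      have hc : c ≠ 0 := by
        rintro rfl
        rw [if_pos rfl] at hbest
        exact hl (hbest ▸ mul_self_nonneg _)
      rw [if_neg hc] at hbest
      refine ⟨hE.line, hE.r0, trivial, by rw [hE.arg_eq]; exact hbest, fun c' hc' => ?_,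
        by rw [hE.arg_eq]; exact harg⟩
      rcases hlt hc' with h | rfl
      · exact hle c' h
      · rw [pow_two]; exact (not_le.1 hl).le
  · obtain ⟨hL, r0, hn, hb, hle, ha⟩ := h₃
    have aux : ∀ x, x = scaleNode (c + 1) → (s₃.writeReal 2 1 0 x).nat 4 0 0 = c ∧
        NodeState N k m len vr cf y σ (c + 1)
          ((s₃.writeReal 2 1 0 x).writeNat 4 0 0 (c + 1)) := by
      rintro x rfl
      exact ⟨by simpa using r0, hL.congr (fun a ha => by simp [ha]) (fun a ha => by simp [ha]),
        by simp [setEntry_apply], by simp [setEntry_apply], by simpa [setEntry_apply] using hb,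
        by simpa [setEntry_apply] using hle, by simpa [setEntry_apply] using ha⟩
    simp only [Program.pre, setScalar, NatExpr.eval, RealExpr.eval, Test.Holds, scalar, hn]
    refine ⟨fun hp => aux _ ?_, fun hp => aux _ ?_⟩
    · rw [scaleNode, if_pos (by simpa using hp)]; simp
    · rw [scaleNode, if_neg (by simpa using hp)]; simp
  · have : m * (k * 100 + 60 + (countExpr.cost + 14)) ≤ m * (k * 100 + 80) :=
      Nat.mul_le_mul_left _ (by simp only [countExpr, NatExpr.cost]; omega)
    refine (Nat.add_le_add_left (Nat.add_le_add_right (Nat.add_le_add_right this _) _) _).trans ?_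
    simp only [Program.bound, NatExpr.cost, RealExpr.cost, Test.cost, scalar, setScalar, countExpr]
    omega

/-- Find the best node. -/
def lineProgram : Program :=
  .seq (.seq (setScalar 1 (.ofNat (.lit 1)))
    (.seq (setScalar 2 (.ofNat (.lit 0))) (setScalar 3 (.ofNat (.lit 1)))))
    (forLoop 0 (.add (.read 0 (.lit 1) (.lit 0)) (.read 0 (.lit 1) (.lit 0))) nodeProgram)

theorem lineProgram_reaches (ht : TermData N k m len vr) {s : MachineState}
    (h : LineState N k m len vr cf y σ s) :
    Reaches lineProgram s (2 * k * (m * (k * 100 + 80) + 130) + 50) fun s' =>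
      NodeState N k m len vr cf y σ (2 * k) s' := by
  refine ((Program.reaches _ (Q := fun s => LineState N k m len vr cf y σ s ∧ s.real 2 1 0 = 1 ∧
      s.real 2 2 0 = 0 ∧ s.real 2 3 0 = 1) ?_).seq
    fun s₁ h₁ => Reaches.forLoop_const (M := 2 * k) (m * (k * 100 + 80) + 100)
      (fun c s => NodeState N k m len vr cf y σ c s) (fun c s h => ?_) (fun c s h => h.r0)
      (fun c hc s h => nodeProgram_reaches ht h) ?_).mono ?_ fun _ h => h
  · simp only [Program.pre, setScalar, NatExpr.eval, RealExpr.eval]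
    exact ⟨h.congr (by simp) (fun a ha => by simp [ha]), by simp [setEntry_apply],
      by simp [setEntry_apply], by simp [setEntry_apply]⟩
  · have := h.line.input.loc
    simp only [NatExpr.eval, this]
    omega
  · obtain ⟨hL, h1, h2, h3⟩ := h₁
    exact ⟨hL.congr (fun a ha => by simp [ha]) (fun a ha => by simp), by simp [setEntry_apply],
      by simpa [scaleNode] using h1, by simpa using h2, by simp, by simp [h3]⟩
  · simp only [Program.bound, NatExpr.cost, RealExpr.cost, setScalar]
    generalize m * (k * 100 + 80) = κ
    have : 2 * k * (κ + 100 + (1 + 1 + 1 + (1 + 1 + 1) + 1 + 14)) ≤ 2 * k * (κ + 130) :=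
      Nat.mul_le_mul_left _ (by omega)
    omega

/-- Find the means of the random signs. -/
def meansProgram : Program :=
  .seq coefProgram (.seq signsProgram (.seq directionProgram lineProgram))

theorem meansProgram_sampleFree : meansProgram.SampleFree := by
  simp [meansProgram, coefProgram, signsProgram, buildProgram, scaleProgram, sweepProgram,
    derivativeProgram, descendProgram, insertProgram, levelProgram, slopeProgram, moveProgram,
    loadProgram, directionProgram, lineProgram, nodeProgram, termProgram, forLoop, setReg,
    setScalar, Program.SampleFree]

/-- The means `(y + t * σ) / 2` of the random signs: `y` and `σ` are sign vectors, `|t| ≤ 1`, and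
the value of the polynomial at `y + t * σ` is large. -/
structure MeansState (N k m : ℕ) (len : ℕ → ℕ) (vr : ℕ → ℕ → ℕ) (cf : ℕ → ℝ) (y σ : ℕ → ℝ)
    (t : ℝ) (s : MachineState) : Prop where
  line : LineState N k m len vr cf y σ s
  node : s.real 2 3 0 = t
  sign_y : ∀ w < N, y w = 1 ∨ y w = -1
  sign_σ : ∀ w < N, σ w = 1 ∨ σ w = -1
  abs_le : |t| ≤ 1
  large : ∑ v ∈ Finset.range N, √(∑ i ∈ Finset.range m with v ∈ termSet len vr i,
      scaledCoef len cf i ^ 2) ≤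
    3 ^ (k - 1) * (√3 ^ (k - 1) * |lineValue m len vr cf y σ t|)

theorem meansProgram_reaches (ht : TermData N k m len vr) (hN0 : 0 < N) (hk : 1 ≤ k)
    {s : MachineState} (hI : Input N k m len vr cf s) (hF : Fresh s) :
    Reaches meansProgram s (m * (k * 50 + 100) + 50 +
      (m * (k * (k * 300 + 230) + 50) + 50 + (k * 40 + 40 +
        ((N + m * (k * k)) * 300 + N * 200 + 50)) +
      (N * 100 + 50 + (2 * k * (m * (k * 100 + 80) + 130) + 50))))
      fun s' => ∃ y σ t, MeansState N k m len vr cf y σ t s' := by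
  refine (coefProgram_reaches ht hI hF).seq fun s₁ ⟨hI, hF, hg⟩ =>
    (signsProgram_reaches ht hN0 hk hI hF hg).seq fun s₂ hS =>
    (directionProgram_reaches hS).seq ?_
  rintro s₃ ⟨y, σ, hL, hy, hσ, hlarge⟩
  refine (lineProgram_reaches ht hL).mono le_rfl fun s₄ h => ?_
  refine ⟨y, σ, s₄.real 2 3 0, h.line, rfl, hy, hσ, h.arg, hlarge.trans ?_⟩
  refine mul_le_mul_of_nonneg_left ?_ (by positivity)
  obtain ⟨c, hc, hcv⟩ := exists_scaleNode_multilinear (Finset.range m) (termSet len vr)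
    (scaledCoef len cf) hk (fun i hi => (ht.card (Finset.mem_range.1 hi)).le.trans
      (ht.len_le i (Finset.mem_range.1 hi))) y σ
  -- The linear coefficient along `σ` is the sum of the absolute values of the derivatives.
  have hswap : ∑ v ∈ Finset.range N, σ v * ∑ i ∈ Finset.range m with v ∈ termSet len vr i,
      scaledCoef len cf i * ∏ w ∈ (termSet len vr i).erase v, y w =
      ∑ i ∈ Finset.range m, scaledCoef len cf i * ∑ w ∈ termSet len vr i,
        σ w * ∏ v ∈ (termSet len vr i).erase w, y v := by
    simp only [Finset.mul_sum, Finset.sum_filter]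
    rw [Finset.sum_comm]
    refine Finset.sum_congr rfl fun i hi => ?_
    have hsub : termSet len vr i ⊆ Finset.range N := by
      intro w hw
      obtain ⟨a, ha, rfl⟩ := Finset.mem_image.1 hw
      exact Finset.mem_range.2 (ht.lt i (Finset.mem_range.1 hi) a (Finset.mem_range.1 ha))
    simp only [mul_ite, mul_zero]
    rw [← Finset.sum_filter, Finset.filter_mem_eq_inter, Finset.inter_eq_right.2 hsub]
    exact Finset.sum_congr rfl fun w _ => by ring
  have hle := h.le_best c hc
  rw [h.best, if_neg (by omega), sq_le_sq] at hle
  rw [hswap]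
  exact (le_abs_self _).trans (hcv.trans (mul_le_mul_of_nonneg_left hle (by positivity)))

/-! ### Rounding and output -/

/-- Draw the random signs. -/
def roundProgram : Program :=
  forLoop 0 boundExpr (.seq (.sample 11 (reg 0) (.lit 0))
    (.branch (.realLe (.sub (.mul (.ofNat (.lit 2)) (.read 11 (reg 0) (.lit 0))) (.ofNat (.lit 1)))
        (.div (.add (.read 9 (reg 0) (.lit 0)) (.mul (scalar 3) (.read 10 (reg 0) (.lit 0))))
          (.ofNat (.lit 2))))
      (.setReal 11 (reg 0) (.lit 0) (.ofNat (.lit 1)))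
      (.setReal 11 (reg 0) (.lit 0) (.sub (.ofNat (.lit 0)) (.ofNat (.lit 1))))))

theorem roundProgram_reaches {t : ℝ} {s : MachineState} (h : LineState N k m len vr cf y σ s)
    (hn : s.real 2 3 0 = t) :
    Reaches roundProgram s (N * 100 + 50) fun s' => Input N k m len vr cf s' ∧
      ∀ w < N, s'.real 11 w 0 = roundSign ((y w + t * σ w) / 2) (s.tape w) := by
  refine (Reaches.forLoop_const (M := N) 70 (fun j s' => s'.nat 4 0 0 = j ∧
    LineState N k m len vr cf y σ s' ∧ s'.real 2 3 0 = t ∧ s'.tape = (fun l => s.tape (l + j)) ∧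
    ∀ w < j, s'.real 11 w 0 = roundSign ((y w + t * σ w) / 2) (s.tape w)) ?_ ?_ ?_ ?_).mono ?_ ?_
  · exact fun j s h => h.2.1.input.bound
  · exact fun j s h => h.1
  · rintro j hj s' ⟨h0, hL, hn, htape, h⟩
    refine (Program.reaches _ ?_).mono (T := Program.bound _) ?_ fun _ h => h
    · have hlt : ∀ {w}, w < j + 1 → w < j ∨ w = j := fun h => by omega
      have e0 : s'.tape 0 = s.tape j := by simp [htape]
      have et : (fun l => s'.tape (l + 1)) = fun l => s.tape (l + (j + 1)) := by
        funext l
        rw [htape]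
        exact congrArg s.tape (by omega)
      have aux : ∀ x, x = roundSign ((y j + t * σ j) / 2) (s.tape j) →
          ((s'.draw 11 j 0).writeReal 11 j 0 x).nat 4 0 0 = j ∧
          (((s'.draw 11 j 0).writeReal 11 j 0 x).writeNat 4 0 0 (j + 1)).nat 4 0 0 = j + 1 ∧
          LineState N k m len vr cf y σ
            (((s'.draw 11 j 0).writeReal 11 j 0 x).writeNat 4 0 0 (j + 1)) ∧
          (((s'.draw 11 j 0).writeReal 11 j 0 x).writeNat 4 0 0 (j + 1)).real 2 3 0 = t ∧
          (((s'.draw 11 j 0).writeReal 11 j 0 x).writeNat 4 0 0 (j + 1)).tape =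
            (fun l => s.tape (l + (j + 1))) ∧
          ∀ w < j + 1, (((s'.draw 11 j 0).writeReal 11 j 0 x).writeNat 4 0 0 (j + 1)).real 11 w 0 =
            roundSign ((y w + t * σ w) / 2) (s.tape w) := by
        rintro x rfl
        refine ⟨by simpa using h0, by simp [setEntry_apply],
          ⟨hL.input.congr (by simp) (by simp) (by simp) (by simp) (by simp),
            by simpa using hL.coef, by simpa using hL.base, by simpa using hL.direction⟩,
          by simpa using hn, by simpa using et, fun w hw => ?_⟩
        rcases hlt hw with hw | rfl
        · simpa [setEntry_apply, hw.ne] using h w hw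
        · simp [setEntry_apply]
      simp only [Program.pre, NatExpr.eval, RealExpr.eval, Test.Holds, reg, scalar,
        MachineState.nat_draw, MachineState.real_draw, setEntry_apply, Nat.reduceEqDiff, if_true,
        if_false, and_self, h0, hL.base, hL.direction, hn, e0]
      refine ⟨fun hp => aux _ ?_, fun hp => aux _ ?_⟩
      · rw [roundSign, if_pos (by simpa using hp)]; simp
      · rw [roundSign, if_neg (by simpa using hp)]; simp
    · simp only [Program.bound, NatExpr.cost, RealExpr.cost, Test.cost, reg, scalar]
      omega
  · exact ⟨by simp [setEntry_apply], ⟨h.input.congr (by simp) (by simp) (by simp) (by simp)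
      (by simp), by simpa using h.coef, by simpa using h.base, by simpa using h.direction⟩,
      by simpa using hn, by simp, by simp⟩
  · simp only [boundExpr, NatExpr.cost]
    omega
  · exact fun s h => ⟨h.2.1.input, h.2.2.2.2⟩

/-- Read the coordinate `c` of the Bloch vector of the qubit in register `0`. -/
def blochExpr (c : ℕ) : RealExpr :=
  .div (.read 11 (.add (.add (.add (reg 0) (reg 0)) (.add (reg 0) (reg 0))) (.lit c)) (.lit 0))
    (.sqrt (.ofNat (.lit 3)))

/-- Write the one-qubit vectors. -/
def outputProgram : Program :=
  forLoop 0 (.read 0 (.lit 0) (.lit 0))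
    (.seq (.setReal 1 (reg 0) (.lit 0)
      (.sqrt (.div (.add (.ofNat (.lit 1)) (blochExpr 3)) (.ofNat (.lit 2)))))
    (.seq (.setReal 1 (reg 0) (.lit 1) (.ofNat (.lit 0)))
    (.seq (.setReal 1 (reg 0) (.lit 2) (.div (blochExpr 1)
      (.mul (.ofNat (.lit 2)) (.read 1 (reg 0) (.lit 0)))))
    (.setReal 1 (reg 0) (.lit 3) (.div (blochExpr 2)
      (.mul (.ofNat (.lit 2)) (.read 1 (reg 0) (.lit 0))))))))

theorem outputProgram_reaches {n : ℕ} {Z : ℕ → ℝ} {s : MachineState} (hn : s.nat 0 0 0 = n)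
    (hZ : ∀ w < 4 * n, s.real 11 w 0 = Z w) :
    Reaches outputProgram s (n * 150 + 50) fun s' => outputVectors n s' = signState n Z := by
  refine (Reaches.forLoop_const (M := n) 120 (fun q s => s.nat 4 0 0 = q ∧ s.nat 0 0 0 = n ∧
    (∀ w < 4 * n, s.real 11 w 0 = Z w) ∧ ∀ q' : Fin n, q'.val < q → ∀ b : Fin 2,
      (⟨s.real 1 q' (2 * b), s.real 1 q' (2 * b + 1)⟩ : ℂ) = signState n Z q' b)
    ?_ ?_ ?_ ?_).mono ?_ ?_
  · exact fun q s h => h.2.1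
  · exact fun q s h => h.1
  · rintro q hq s ⟨h0, hn, hZ, h⟩
    refine (Program.reaches _ ?_).mono (T := Program.bound _) ?_ fun _ h => h
    · have e4 : ∀ c, q + q + (q + q) + c = 4 * q + c := fun c => by omega
      simp only [Program.pre, NatExpr.eval, RealExpr.eval, reg, blochExpr,
        MachineState.nat_writeReal, MachineState.real_writeReal, Nat.reduceEqDiff, if_true,
        if_false, setEntry_apply, true_and, and_true, h0, e4, hZ (4 * q + 3) (by omega),
        hZ (4 * q + 2) (by omega), hZ (4 * q + 1) (by omega)]
      refine ⟨by simp [setEntry_apply], by simpa using hn, by simpa using hZ,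
        fun q' hq' b => ?_⟩
      rcases (by omega : q'.val < q ∨ q'.val = q) with hlt | rfl
      · simpa [setEntry_apply, hlt.ne] using h q' hlt b
      · fin_cases b <;> simp [setEntry_apply, signState, blochState]
    · simp only [Program.bound, NatExpr.cost, RealExpr.cost, reg, blochExpr]
      omega
  · exact ⟨by simp [setEntry_apply], by simpa using hn, by simpa using hZ,
      fun q' h => absurd h (by omega)⟩
  · simp only [NatExpr.cost]
    omega
  · intro s h
    funext q b
    exact h.2.2.2 q q.2 b

end

/-! ### The polynomial of a Hamiltonian -/

section

variable {n k : ℕ} {α : PauliString n → ℝ} {L : List (PauliString n)}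

/-- The `i`-th term of the list. -/
def termString (L : List (PauliString n)) (i : ℕ) : PauliString n := L.getD i (identityString n)

/-- The variable at position `a` of the term `i`. -/
def termVar (k : ℕ) (L : List (PauliString n)) (i a : ℕ) : ℕ :=
  4 * inputNat k L 2 i a + inputNat k L 3 i a

theorem termString_eq {i : ℕ} (hi : i < L.length) : termString L i = L[i] :=
  List.getD_eq_getElem _ _ hi

theorem termVar_eq {i a : ℕ} (hi : i < L.length) (ha : a < (termString L i).weight) :
    termVar k L i a =
      (termString L i).code ((termString L i).dom.orderEmbOfFin rfl ⟨a, ha⟩) := by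
  have ha' : a < (L[i]).dom.sort.length := by
    rw [Finset.length_sort]
    rwa [termString_eq hi] at ha
  simp only [termString_eq hi, Finset.orderEmbOfFin_apply, PauliString.code, termVar, inputNat,
    List.getElem?_eq_getElem hi, Option.bind_some, List.getElem?_eq_getElem ha', Option.map_some,
    Option.getD_some]
  rfl

/-- The variables of the term `i` as read from the input. -/
theorem termSet_termVar {i : ℕ} (hi : i < L.length) :
    termSet (fun i => (termString L i).weight) (termVar k L) i = (termString L i).vars := by
  ext w
  simp only [termSet, PauliString.vars, Finset.mem_image, Finset.mem_range]
  constructor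
  · rintro ⟨a, ha, rfl⟩
    exact ⟨_, Finset.orderEmbOfFin_mem _ _ ⟨a, ha⟩, (termVar_eq hi ha).symm⟩
  · rintro ⟨q, hq, rfl⟩
    have : q ∈ Set.range ((termString L i).dom.orderEmbOfFin rfl) := by
      rw [Finset.range_orderEmbOfFin]
      exact hq
    obtain ⟨⟨a, ha⟩, rfl⟩ := this
    exact ⟨a, ha, termVar_eq hi ha⟩

theorem termData (hloc : IsLocalHamiltonian k α) (hL : ListsTerms α L) :
    TermData (4 * n) k L.length (fun i => (termString L i).weight) (termVar k L) where
  lt i hi a ha := by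
    refine PauliString.lt_of_mem_vars (P := termString L i) ?_
    rw [← termSet_termVar (k := k) hi]
    exact Finset.mem_image_of_mem _ (Finset.mem_range.2 ha)
  mono i hi a a' h ha' := by
    rw [termVar_eq hi ha', termVar_eq hi (h.trans ha')]
    have h1 : (termString L i).dom.orderEmbOfFin rfl ⟨a, h.trans ha'⟩ <
        (termString L i).dom.orderEmbOfFin rfl ⟨a', ha'⟩ :=
      ((termString L i).dom.orderEmbOfFin rfl).strictMono h
    have h2 := (termString L i ((termString L i).dom.orderEmbOfFin rfl ⟨a, h.trans ha'⟩)).isLt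
    have h3 : _ < _ := Fin.lt_def.1 h1
    unfold PauliString.code
    omega
  len_le i hi := hloc _ ((hL.2 _).1 (by rw [termString_eq hi]; exact List.getElem_mem hi))
  inj i hi i' hi' h := by
    rw [termSet_termVar hi, termSet_termVar hi'] at h
    have := PauliString.vars_injective h
    rw [termString_eq hi, termString_eq hi'] at this
    exact (hL.1.getElem_inj_iff).1 this

theorem input_inputState (ω : ℕ → unitInterval) :
    Input (4 * n) k L.length (fun i => (termString L i).weight) (termVar k L)
      (fun i => α (termString L i)) (inputState k α L ω) where
  bound := by
    simp only [boundExpr, NatExpr.eval, inputState, inputNat, if_true, List.getD_cons_zero]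
    omega
  loc := by simp [inputState, inputNat]
  count := by simp [countExpr, NatExpr.eval, inputState, inputNat]
  len_eq i hi := by simp [inputState, inputNat, termString_eq hi, hi]
  var_eq i _ a _ := by
    simp only [inputState, termVar]
    omega
  coef_eq i hi := by simp [inputState, inputReal, termString_eq hi, hi]

theorem fresh_inputState (ω : ℕ → unitInterval) : Fresh (inputState k α L ω) := by
  refine ⟨fun a ha => ?_, fun a ha => ?_⟩
  · obtain ⟨a, rfl⟩ := Nat.exists_eq_add_of_le' ha
    rfl
  · funext i j
    simp [inputState, inputReal, show a ≠ 0 by omega]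

theorem sum_termString (hL : ListsTerms α L) {f : PauliString n → ℝ}
    (hf : ∀ P, α P = 0 → f P = 0) :
    ∑ i ∈ Finset.range L.length, f (termString L i) = ∑ P, f P := by
  rw [Finset.sum_range]
  have h1 : ∀ i : Fin L.length, f (termString L i) = f L[i.val] := fun i => by
    rw [termString_eq i.2]
  simp only [h1]
  rw [Fin.sum_univ_fun_getElem, ← List.sum_toFinset f hL.1]
  refine Finset.sum_subset (Finset.subset_univ _) fun P _ hP => hf P ?_
  by_contra h
  exact hP (List.mem_toFinset.2 ((hL.2 P).2 h))

theorem nnz_eq (hL : ListsTerms α L) : nnz α = L.length := by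
  have : {P | α P ≠ 0} = (L.toFinset : Set (PauliString n)) := by
    ext P
    simp [hL.2 P]
  rw [nnz, this, Set.ncard_coe_finset, List.toFinset_card_of_nodup hL.1]

theorem weight_eq_zero_iff {P : PauliString n} : P.weight = 0 ↔ P = identityString n := by
  rw [PauliString.weight, Finset.card_eq_zero]
  constructor
  · intro h
    by_contra hP
    exact (PauliString.dom_nonempty hP).ne_empty h
  · rintro rfl
    simp [PauliString.dom, identityString]

/-- The mean energy of the rounded state is `α_I` plus the value of the polynomial. -/
theorem sum_means_eq (hL : ListsTerms α L) {X y σ : ℕ → ℝ} {t : ℝ}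
    (hX : ∀ w < 4 * n, X w = (y w + t * σ w) / 2) :
    ∑ P : PauliString n, α P * ((1 / √3) ^ P.weight * ∏ w ∈ P.vars, X w) =
      α (identityString n) + lineValue L.length (fun i => (termString L i).weight) (termVar k L)
        (fun i => α (termString L i)) y σ t := by
  classical
  have h12 : √12 = 2 * √3 := by
    rw [show (12 : ℝ) = 2 ^ 2 * 3 by norm_num, Real.sqrt_mul (by norm_num),
      Real.sqrt_sq (by norm_num)]
  have h1 : lineValue L.length (fun i => (termString L i).weight) (termVar k L)
      (fun i => α (termString L i)) y σ t = ∑ i ∈ Finset.range L.length,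
        (fun P : PauliString n => (if P.weight = 0 then 0 else α P / √12 ^ P.weight) *
          ∏ w ∈ P.vars, (y w + t * σ w)) (termString L i) := by
    refine Finset.sum_congr rfl fun i hi => ?_
    rw [termSet_termVar (Finset.mem_range.1 hi), scaledCoef]
  rw [h1, sum_termString hL (f := fun P : PauliString n =>
    (if P.weight = 0 then 0 else α P / √12 ^ P.weight) * ∏ w ∈ P.vars, (y w + t * σ w)) fun P hP => by
      simp [hP]]
  have h2 : α (identityString n) =
      ∑ P : PauliString n, if P = identityString n then α P else 0 := by simp
  rw [h2, ← Finset.sum_add_distrib]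
  refine Finset.sum_congr rfl fun P _ => ?_
  by_cases hP : P = identityString n
  · have hw := weight_eq_zero_iff.2 hP
    have hv : P.vars = ∅ := Finset.card_eq_zero.1 (P.card_vars.trans hw)
    simp [hP ▸ hw, hP ▸ hv, hP]
  · have hw : P.weight ≠ 0 := fun h => hP (weight_eq_zero_iff.1 h)
    rw [if_neg hP, if_neg hw, Finset.prod_congr rfl fun w hw => hX w (P.lt_of_mem_vars hw),
      Finset.prod_div_distrib, Finset.prod_const, P.card_vars, h12, mul_pow, one_div, inv_pow]
    field_simp
    ring

/-- The norms of the derivatives of the polynomial bound the local norms of the Hamiltonian. -/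
theorem sum_localNorm_le (hloc : IsLocalHamiltonian k α) (hL : ListsTerms α L) :
    ∑ q, localNorm α q ≤ √12 ^ k * ∑ v ∈ Finset.range (4 * n),
      √(∑ i ∈ Finset.range L.length with
        v ∈ termSet (fun i => (termString L i).weight) (termVar k L) i,
        scaledCoef (fun i => (termString L i).weight) (fun i => α (termString L i)) i ^ 2) := by
  classical
  obtain ⟨g, hg⟩ : ∃ g : PauliString n → ℝ, g = fun P =>
    if P.weight = 0 then 0 else α P / √12 ^ P.weight := ⟨_, rfl⟩
  have h1 : ∀ v, ∑ i ∈ Finset.range L.length with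
        v ∈ termSet (fun i => (termString L i).weight) (termVar k L) i,
        scaledCoef (fun i => (termString L i).weight) (fun i => α (termString L i)) i ^ 2 =
      ∑ P : PauliString n with v ∈ P.vars, g P ^ 2 := by
    intro v
    rw [Finset.sum_filter, Finset.sum_filter, ← sum_termString hL (f := fun P : PauliString n =>
      if v ∈ P.vars then g P ^ 2 else 0) fun P hP => by simp [hg, hP]]
    refine Finset.sum_congr rfl fun i hi => ?_
    rw [termSet_termVar (Finset.mem_range.1 hi), hg, scaledCoef]
  simp only [h1]
  have h2 : ∑ v ∈ Finset.range (4 * n), √(∑ P : PauliString n with v ∈ P.vars, g P ^ 2) =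
      ∑ q : Fin n, ∑ p : Fin 4,
        √(∑ P : PauliString n with 4 * q.val + p.val ∈ P.vars, g P ^ 2) := by
    rw [mul_comm, Finset.sum_range, ← Fintype.sum_prod_type']
    refine (Fintype.sum_equiv finProdFinEquiv _ _ fun x => ?_).symm
    rw [finProdFinEquiv_apply_val, add_comm]
  rw [h2, Finset.mul_sum]
  refine Finset.sum_le_sum fun q _ => ?_
  -- Each local term on the qubit `q` occurs in the derivative by one of the variables of `q`.
  have h3 : localNorm α q ^ 2 ≤
      (√12 ^ k) ^ 2 * ∑ p : Fin 4, ∑ P : PauliString n with 4 * q.val + p.val ∈ P.vars, g P ^ 2 := by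
    rw [localNorm, Real.sq_sqrt (Finset.sum_nonneg fun _ _ => sq_nonneg _)]
    have h4 : ∑ P : PauliString n with P q ≠ 0, g P ^ 2 ≤
        ∑ p : Fin 4, ∑ P : PauliString n with 4 * q.val + p.val ∈ P.vars, g P ^ 2 := by
      simp only [Finset.sum_filter]
      rw [Finset.sum_comm]
      refine Finset.sum_le_sum fun P _ => ?_
      split_ifs with hP
      · have hm : 4 * q.val + (P q).val ∈ P.vars := PauliString.code_mem_vars.2 ⟨hP, rfl⟩
        refine le_trans (le_of_eq ?_) (Finset.single_le_sum (f := fun p : Fin 4 =>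
          if 4 * q.val + p.val ∈ P.vars then g P ^ 2 else 0)
          (fun p _ => by split_ifs <;> positivity) (Finset.mem_univ (P q)))
        simp only [hm, if_true]
      · exact Finset.sum_nonneg fun p _ => by split_ifs <;> positivity
    refine le_trans ?_ (mul_le_mul_of_nonneg_left h4 (sq_nonneg _))
    rw [Finset.mul_sum]
    refine Finset.sum_le_sum fun P hP => ?_
    have hw : P.weight ≠ 0 := fun h => (Finset.mem_filter.1 hP).2 (by
      rw [weight_eq_zero_iff.1 h]; rfl)
    rw [hg]
    simp only [hw, if_false]
    rcases eq_or_ne (α P) 0 with h0 | h0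
    · simp [h0]
    · have e : √12 ^ k * (α P / √12 ^ P.weight) = √12 ^ (k - P.weight) * α P := by
        rw [← Nat.sub_add_cancel (hloc P h0), pow_add, Nat.add_sub_cancel]
        field_simp
      rw [← mul_pow, e, mul_pow]
      refine le_mul_of_one_le_left (sq_nonneg _) (one_le_pow₀ (one_le_pow₀ ?_))
      exact Real.one_le_sqrt.2 (by norm_num)
  refine abs_le_of_sq_le_sq' (h3.trans ?_) (by positivity) |>.2
  rw [mul_pow]
  refine mul_le_mul_of_nonneg_left ?_ (sq_nonneg _)
  refine le_trans (le_of_eq ?_) (Finset.sum_sq_le_sq_sum_of_nonneg fun p _ => Real.sqrt_nonneg _)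
  exact Finset.sum_congr rfl fun p _ =>
    (Real.sq_sqrt (Finset.sum_nonneg fun _ _ => sq_nonneg _)).symm

end

/-! ### The algorithm -/

/-- The randomized algorithm: all samples are drawn after the means have been computed. -/
def mainProgram : Program := .seq meansProgram (.seq roundProgram outputProgram)

/-- The means of the random signs, as a function on all natural numbers; the value `0` for `w ≥ N` plays
no role. -/
def meanValue (N : ℕ) (y σ : ℕ → ℝ) (t : ℝ) (w : ℕ) : ℝ := if w < N then (y w + t * σ w) / 2 else 0

theorem abs_meanValue_le {N : ℕ} {y σ : ℕ → ℝ} {t : ℝ} (hy : ∀ w < N, y w = 1 ∨ y w = -1)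
    (hσ : ∀ w < N, σ w = 1 ∨ σ w = -1) (ht : |t| ≤ 1) (w : ℕ) : |meanValue N y σ t w| ≤ 1 := by
  rw [abs_le] at ht ⊢
  unfold meanValue
  split_ifs with hw
  · rcases hy w hw with h | h <;> rcases hσ w hw with h' | h' <;> rw [h, h'] <;>
      constructor <;> linarith
  · norm_num

theorem sq_le_two_mul_two_pow (k : ℕ) : k * k ≤ 2 * 2 ^ k := by
  rcases Nat.lt_or_ge k 3 with h | h
  · interval_cases k <;> norm_num
  · induction k, h using Nat.le_induction with
    | base => norm_num
    | succ k hk ih => rw [pow_succ]; nlinarith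

/-- The sum of the time bounds of the parts is `O(n k + m 2 ^ k)`, since `k ^ 2 ≤ 2 * 2 ^ k`. -/
theorem cost_le {n k m : ℕ} (hn : 1 ≤ n) (hk : 1 ≤ k) :
    m * (k * 50 + 100) + 50 + (m * (k * (k * 300 + 230) + 50) + 50 + (k * 40 + 40 +
        ((4 * n + m * (k * k)) * 300 + 4 * n * 200 + 50)) +
      (4 * n * 100 + 50 + (2 * k * (m * (k * 100 + 80) + 130) + 50))) +
      (4 * n * 100 + 50 + (n * 150 + 50)) ≤ 10000 * (n * k + m * 2 ^ k) := by
  have e1 : m * (k * k) ≤ 2 * (m * 2 ^ k) :=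
    (Nat.mul_le_mul_left m (sq_le_two_mul_two_pow k)).trans_eq (by ring)
  have e2 : m * k ≤ m * 2 ^ k := Nat.mul_le_mul_left m Nat.lt_two_pow_self.le
  have e3 : m ≤ m * k := Nat.le_mul_of_pos_right m hk
  have e4 : n ≤ n * k := Nat.le_mul_of_pos_right n hk
  have e5 : k ≤ n * k := Nat.le_mul_of_pos_left k hn
  have e6 : m * (k * 50 + 100) + 50 + (m * (k * (k * 300 + 230) + 50) + 50 + (k * 40 + 40 +
        ((4 * n + m * (k * k)) * 300 + 4 * n * 200 + 50)) +
      (4 * n * 100 + 50 + (2 * k * (m * (k * 100 + 80) + 130) + 50))) +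
      (4 * n * 100 + 50 + (n * 150 + 50)) =
      800 * (m * (k * k)) + 440 * (m * k) + 150 * m + 2950 * n + 300 * k + 390 := by ring
  omega

/-- The three losses combine to `√12 ^ k * 3 ^ (k - 1) * √3 ^ (k - 1) = 18 ^ k / (3√3)`. -/
theorem large_le {k : ℕ} (hk : 1 ≤ k) {B S x : ℝ} (hB : B ≤ √12 ^ k * S)
    (hS : S ≤ 3 ^ (k - 1) * (√3 ^ (k - 1) * x)) : 3 * √3 / 18 ^ k * B ≤ x := by
  have h12 : √12 = 2 * √3 := by
    rw [show (12 : ℝ) = 2 ^ 2 * 3 by norm_num, Real.sqrt_mul (by norm_num),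
      Real.sqrt_sq (by norm_num)]
  have h3 : √3 * √3 = 3 := Real.mul_self_sqrt (by norm_num)
  obtain ⟨l, rfl⟩ : ∃ l, k = l + 1 := ⟨k - 1, by omega⟩
  rw [Nat.add_sub_cancel] at hS
  have h1 : B ≤ √12 ^ (l + 1) * (3 ^ l * (√3 ^ l * x)) :=
    hB.trans (mul_le_mul_of_nonneg_left hS (by positivity))
  have h2 : √12 ^ (l + 1) * (3 ^ l * (√3 ^ l * x)) = 2 * √3 * (18 ^ l * x) := by
    have : (2 * √3) ^ l * √3 ^ l * 3 ^ l = 18 ^ l := by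
      rw [← mul_pow, ← mul_pow]
      congr 1
      linear_combination 6 * h3
    rw [h12, pow_succ, ← this]
    ring
  rw [h2] at h1
  have h4 : 0 ≤ 3 * √3 / 18 ^ (l + 1) := by positivity
  refine (mul_le_mul_of_nonneg_left h1 h4).trans (le_of_eq ?_)
  rw [pow_succ]
  field_simp
  linear_combination 6 * x * h3

/-- The state is obtained by rounding means `X` that do not depend on the samples, and the mean energy
deviates from `α_I` by a multiple of the sum of the local norms. -/
theorem mainProgram_spec {n k : ℕ} (hn : 1 ≤ n) (hk : 1 ≤ k) {α : PauliString n → ℝ}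
    (hloc : IsLocalHamiltonian k α) {L : List (PauliString n)} (hL : ListsTerms α L) :
    ∃ X : ℕ → ℝ, (∀ w, |X w| ≤ 1) ∧
      (∀ ω, ∃ (t : ℕ) (s : MachineState), Runs mainProgram (inputState k α L ω) t s ∧
        t ≤ 10000 * (n * k + nnz α * 2 ^ k) ∧
        outputVectors n s = signState n fun w => roundSign (X w) (ω w)) ∧
      3 * √3 / 18 ^ k * ∑ q, localNorm α q ≤
        |∑ P : PauliString n, α P * ((1 / √3) ^ P.weight * ∏ w ∈ P.vars, X w) -
          α (identityString n)| := by
  obtain ⟨t, s, hr, ht, y, σ, r, hM⟩ := meansProgram_reaches (termData hloc hL)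
    (N := 4 * n) (by omega) hk (input_inputState fun _ => 0) (fresh_inputState fun _ => 0)
  refine ⟨meanValue (4 * n) y σ r, abs_meanValue_le hM.sign_y hM.sign_σ hM.abs_le, fun ω => ?_, ?_⟩
  · -- The means do not depend on the samples, so the run is the same for all of them.
    have h1 : Reaches meansProgram (inputState k α L ω) _ fun s' => s' = s.withTape ω :=
      ⟨t, _, hr.withTape meansProgram_sampleFree ω, ht, rfl⟩
    obtain ⟨t', s', hr', ht', hq⟩ := h1.seq (q := .seq roundProgram outputProgram)
      (T' := 4 * n * 100 + 50 + (n * 150 + 50))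
      (R := fun s => outputVectors n s =
        signState n fun w => roundSign (meanValue (4 * n) y σ r w) (ω w)) (by
      rintro _ rfl
      refine (roundProgram_reaches (s := s.withTape ω) (hM.line.congr (fun _ _ => rfl)
        fun _ _ => rfl) hM.node).seq fun s' ⟨hI, h⟩ => outputProgram_reaches ?_ fun w hw => ?_
      · have := hI.bound
        simp only [boundExpr, NatExpr.eval] at this
        omega
      · rw [h w hw, meanValue, if_pos hw]
        rfl)
    refine ⟨t', s', hr', ht'.trans ?_, hq⟩
    rw [nnz_eq hL]
    exact cost_le hn hk
  · rw [sum_means_eq hL (fun w hw => by rw [meanValue, if_pos hw]), add_sub_cancel_left]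
    exact large_le hk (sum_localNorm_le hloc hL) hM.large

theorem mainTheorem6 :
    (∃ (p : Program) (K : ℕ), ∀ (n k : ℕ), 1 ≤ n → 1 ≤ k →
      ∀ (α : PauliString n → ℝ), IsLocalHamiltonian k α →
      ∀ (L : List (PauliString n)), ListsTerms α L →
      ∃ ψ : (ℕ → unitInterval) → Fin n → Fin 2 → ℂ,
        (∀ ω, (∃ (t : ℕ) (s : MachineState), Runs p (inputState k α L ω) t s ∧
            t ≤ K * (n * k + nnz α * 2 ^ k) ∧ ψ ω = outputVectors n s) ∧
          ∀ i, ∑ b, ‖ψ ω i b‖ ^ 2 = 1) ∧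
        Integrable (fun ω => energy α (productVector (ψ ω))) tapeMeasure ∧
        ∀ (c : ℝ) (d : ℕ), 1 ≤ d → d ≤ n → HasExpansion α c d →
          (haarEnergy α + advantageConstant c d k * nonIdentityNorm α (expansionExponent d) ≤
              ∫ ω, energy α (productVector (ψ ω)) ∂tapeMeasure) ∨
          (∫ ω, energy α (productVector (ψ ω)) ∂tapeMeasure ≤
            haarEnergy α - advantageConstant c d k * nonIdentityNorm α (expansionExponent d))) ∧
    (∀ (n : ℕ) (α : PauliString n → ℝ), haarEnergy α = α (identityString n)) ∧
    (∀ k : ℕ, 1 ≤ k → ∃ A B : ℝ, 0 < A ∧ 0 < B ∧ ∀ (c : ℝ) (d : ℕ), 0 < c → 1 ≤ d →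
      A * (1 / c ^ (1 / (2 * (d : ℝ)))) ≤ advantageConstant c d k ∧
      advantageConstant c d k ≤ B * (1 / c ^ (1 / (2 * (d : ℝ))))) := by
  refine ⟨⟨mainProgram, 10000, fun n k hn hk α hloc L hL => ?_⟩, fun n α => haarEnergy_eq α,
    advantageConstant_bounds⟩
  obtain ⟨X, hX, hrun, hlarge⟩ := mainProgram_spec hn hk hloc hL
  obtain ⟨hint, hval⟩ := integral_energy_roundSign α (fun w => (abs_le.1 (hX w)).1)
    fun w => (abs_le.1 (hX w)).2
  refine ⟨fun ω => signState n fun w => roundSign (X w) (ω w), fun ω => ⟨?_, fun q =>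
    sum_norm_sq_signState (fun w => roundSign_eq _ _) q⟩, hint, fun c d hd hdn hexp => ?_⟩
  · obtain ⟨t, s, hr, ht, hs⟩ := hrun ω
    exact ⟨t, s, hr, ht, hs.symm⟩
  · have h1 := advantageConstant_mul_le (hexp.nonneg hdn) hd hk
      (Finset.sum_nonneg fun q _ => Real.sqrt_nonneg _) (hexp.nonIdentityNorm_le hd hdn)
    have h2 := h1.trans hlarge
    rw [hval, haarEnergy_eq]
    rcases le_abs.1 h2 with h | h
    · exact Or.inl (by linarith)
    · exact Or.inr (by linarith)

end
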